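/- **Setting.** Let $E>0$. All $L^2$ spaces on $\mathbb R$ and $\mathbb R_+=[0,\infty)$ are taken with respect to $d\lambda/\sqrt{2\pi}$, and a function $\phi\in L^2(\mathbb R_+)$ is regarded as an element of $L^2(\mathbb R)$ by setting $\phi=0$ on $(-\infty,0)$. Let $Q$ be multiplication by $\lambda$ and $P=-i\,d/d\lambda$ on $L^2(\mathbb R)$, and read $\langle\phi|Q^2|\phi\rangle=\|Q\phi\|^2$ and $\langle\phi|P^2|\phi\rangle=\|P\phi\|^2$ as quadratic forms, with value $+\infty$ off the domain of $Q$, respectively off the domain $\{\phi\in L^2(\mathbb R):\phi'\in L^2(\mathbb R)\text{ weakly}\}$ of $P$. Let $\mathcal F^{-1}[\phi](g)=\int\phi(\lambda)e^{i\lambda g}\frac{d\lambda}{\sqrt{2\pi}}$, extended unitarily to $L^2(\mathbb R)$. The group $\mathbb R$ acts on $L^2(\mathbb R_+)$ by $(f(g)\phi)(\lambda)=e^{-ig\lambda}\phi(\lambda)$. Let $\mathcal S$ be the set of density operators on $L^2(\mathbb R_+)$ and $\mathcal M_{\rm cov}$ the set of covariant POVMs $M$ on $L^2(\mathbb R_+)$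 with values in $\mathbb R$, i.e. $f(g)M(B)f(g)^\dagger=M(g+B)$. Put $$\mathcal D_R(\rho,M)=\sup_{g\in\mathbb R}\int(\hat g-g)^2\,\mathrm{Tr}\,f(g)\rho f(g)^\dagger M(d\hat g).$$ Let $M_{\mathcal I}$ be the standard POVM, given by $\langle\phi|M_{\mathcal I}(B)|\phi\rangle=\int_B|\mathcal F^{-1}[\phi](\hat g)|^2\frac{d\hat g}{\sqrt{2\pi}}$; it is covariant. A subscript $n$ denotes unit vectors, "odd" denotes odd functions, and $\{p_i\}$ runs over the (finite or countable) probability distributions. **Theorem.** The following minima exist and $$\begin{aligned} &\min_{\rho\in\mathcal S}\ \min_{M\in\mathcal M_{\rm cov}}\{\mathcal D_R(\rho,M)\mid \mathrm{Tr}\,\rho Q^2\le E\}\\ =&\min_{\{p_i\}}\ \min_{\rho_i\in\mathcal S}\ \min_{M_i\in\mathcal M_{\rm cov}}\Big\{\sum_ip_i\mathcal D_R(\rho_i,M_i)\ \Big|\ \sum_ip_i\mathrm{Tr}\,\rho_iQ^2\le E\Big\}\\ =&\min_{\phi\in L^2_n(\mathbb R_+)}\Big\{\int_{-\infty}^\infty\hat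 g^2|\mathcal F^{-1}[\phi](\hat g)|^2\tfrac{d\hat g}{\sqrt{2\pi}}\ \Big|\ \int_0^\infty\lambda^2|\phi(\lambda)|^2\tfrac{d\lambda}{\sqrt{2\pi}}\le E\Big\}\\ =&\min_{\phi\in L^2_n(\mathbb R_+)}\{\langle\phi|P^2|\phi\rangle\mid\langle\phi|Q^2|\phi\rangle\le E\}\\ =&\min_{\tilde\phi\in L^2_{{\rm odd},n}(\mathbb R)}\{\langle\tilde\phi|P^2|\tilde\phi\rangle\mid\langle\tilde\phi|Q^2|\tilde\phi\rangle\le E\}=\frac{9}{4E}. \end{aligned}$$ Let $\phi_E(\lambda)=\sqrt2\,(3/E)^{3/4}\lambda e^{-3\lambda^2/(4E)}\in L^2_n(\mathbb R_+)$ and $\tilde\phi_E(\lambda)=(3/E)^{3/4}\lambda e^{-3\lambda^2/(4E)}\in L^2_{{\rm odd},n}(\mathbb R)$. 1. Up to a constant phase factor, $\phi_E$ is the unique minimizer of the third and of the fourth problem, and $\tilde\phi_E$ is the unique minimizer of the fifth problem. 2. A state $\rho\in\mathcal S$ with $\mathrm{Tr}\,\rho Q^2\le E$ satisfies $\mathcal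 D_R(\rho,M_{\mathcal I})=\frac9{4E}$ if and only if $\rho=|\phi_E\rangle\langle\phi_E|$. If the covariant POVM may be chosen freely, then a state $\rho\in\mathcal S$ with $\mathrm{Tr}\,\rho Q^2\le E$ satisfies $\mathcal D_R(\rho,M)=\frac{9}{4E}$ for some $M\in\mathcal M_{\rm cov}$ if and only if $\rho=|\phi\rangle\langle\phi|$ with $|\phi(\lambda)|=\phi_E(\lambda)$ for almost every $\lambda\ge0$. 3. $\mathcal F^{-1}[\tilde\phi_E](\hat g)=i\,(4E/3)^{3/4}\,\hat g\,e^{-\hat g^2E/3}$. -/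

import Mathlib

noncomputable section

open MeasureTheory Set
open scoped ENNReal InnerProductSpace FourierTransform ContDiff

namespace RealEstimation

/-! ## The spaces `L²(ℝ)` and `L²(ℝ₊)` and elementary operators on them -/

/-- The invariant measure `dx / √(2π)`, used both on the group `ℝ` and on the weight space `ℝ`. -/
def haarR : Measure ℝ := ENNReal.ofReal (1 / √(2 * Real.pi)) • volume

/-- `L²(ℝ)` with respect to `dx / √(2π)`. -/
abbrev L2R : Type := Lp ℂ 2 haarR

/-- `L²(ℝ₊)`, `ℝ₊ = [0, ∞)`, with respect to `dx / √(2π)`. -/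
abbrev L2Pos : Type := Lp ℂ 2 (haarR.restrict (Ici 0))

theorem memLp_indicator_Ici (φ : L2Pos) : MemLp ((Ici (0 : ℝ)).indicator φ) 2 haarR :=
  (memLp_indicator_iff_restrict measurableSet_Ici).2 (Lp.memLp φ)

/-- A function on `ℝ₊` regarded as a function on `ℝ` that vanishes on the negative half line. -/
def extendByZero : L2Pos →ₗᵢ[ℂ] L2R where
  toFun φ := (memLp_indicator_Ici φ).toLp _
  map_add' φ ψ := by
    rw [← MemLp.toLp_add]
    refine MemLp.toLp_congr _ _ ?_
    have h := (ae_restrict_iff' measurableSet_Ici).1 (Lp.coeFn_add φ ψ)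
    filter_upwards [h] with x hx
    by_cases hx0 : x ∈ Ici (0 : ℝ)
    · simpa [Set.indicator_of_mem hx0] using hx hx0
    · simp [Set.indicator_of_notMem hx0]
  map_smul' c φ := by
    rw [RingHom.id_apply, ← MemLp.toLp_const_smul]
    refine MemLp.toLp_congr _ _ ?_
    have h := (ae_restrict_iff' measurableSet_Ici).1 (Lp.coeFn_smul c φ)
    filter_upwards [h] with x hx
    by_cases hx0 : x ∈ Ici (0 : ℝ)
    · simpa [Set.indicator_of_mem hx0] using hx hx0
    · simp [Set.indicator_of_notMem hx0]
  norm_map' φ := by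
    change ‖(memLp_indicator_Ici φ).toLp _‖ = ‖φ‖
    rw [Lp.norm_toLp, eLpNorm_indicator_eq_eLpNorm_restrict measurableSet_Ici, Lp.norm_def]

theorem memLp_mul {μ : Measure ℝ} {m : ℝ → ℂ} (hm : Measurable m) (hb : ∀ x, ‖m x‖ ≤ 1)
    (φ : Lp ℂ 2 μ) : MemLp (fun x => m x * φ x) 2 μ :=
  (Lp.memLp φ).of_le (hm.aestronglyMeasurable.mul (Lp.aestronglyMeasurable φ))
    (Filter.Eventually.of_forall fun x => by
      rw [norm_mul]
      exact mul_le_of_le_one_left (norm_nonneg _) (hb x))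

/-- Multiplication by a measurable function `m` with `|m| ≤ 1`, as a bounded operator on `L²`. -/
def mulOp (μ : Measure ℝ) (m : ℝ → ℂ) (hm : Measurable m) (hb : ∀ x, ‖m x‖ ≤ 1) :
    Lp ℂ 2 μ →L[ℂ] Lp ℂ 2 μ :=
  LinearMap.mkContinuous
    { toFun := fun φ => (memLp_mul hm hb φ).toLp _
      map_add' := fun φ ψ => by
        rw [← MemLp.toLp_add]
        refine MemLp.toLp_congr _ _ ?_
        filter_upwards [Lp.coeFn_add φ ψ] with x hx
        simp only [Pi.add_apply, hx]
        ring
      map_smul' := fun c φ => by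
        rw [RingHom.id_apply, ← MemLp.toLp_const_smul]
        refine MemLp.toLp_congr _ _ ?_
        filter_upwards [Lp.coeFn_smul c φ] with x hx
        simp only [Pi.smul_apply, hx, smul_eq_mul]
        ring }
    1 (fun φ => by
      change ‖(memLp_mul hm hb φ).toLp _‖ ≤ 1 * ‖φ‖
      rw [one_mul]
      refine Lp.norm_le_norm_of_ae_le ?_
      filter_upwards [(memLp_mul hm hb φ).coeFn_toLp] with x hx
      rw [hx, norm_mul]
      exact mul_le_of_le_one_left (norm_nonneg _) (hb x))

theorem mulOp_coeFn {μ : Measure ℝ} {m : ℝ → ℂ} (hm : Measurable m) (hb : ∀ x, ‖m x‖ ≤ 1)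
    (φ : Lp ℂ 2 μ) : mulOp μ m hm hb φ =ᵐ[μ] fun x => m x * φ x :=
  (memLp_mul hm hb φ).coeFn_toLp

/-- The representation of the group `ℝ` on `L²(ℝ₊)`: `(f(g) φ)(x) = e^{-i g x} φ(x)`. -/
def rep (g : ℝ) : L2Pos →L[ℂ] L2Pos :=
  mulOp _ (fun x => Complex.exp ((-(g * x) : ℝ) * Complex.I)) (by fun_prop)
    (fun x => (Complex.norm_exp_ofReal_mul_I _).le)

/-- The projection of `L²(ℝ)` onto the functions supported in a measurable set `B`. -/
def projOp (B : Set ℝ) (hB : MeasurableSet B) : L2R →L[ℂ] L2R :=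
  mulOp _ (B.indicator fun _ => 1) (measurable_const.indicator hB)
    (fun x => by
      by_cases hx : x ∈ B
      · simp [hx]
      · simp [hx])

/-! ## The inverse Fourier transform -/

theorem memLp_volume (φ : L2R) : MemLp φ 2 (volume : Measure ℝ) := by
  have hc : ENNReal.ofReal (1 / √(2 * Real.pi)) ≠ 0 := by
    rw [Ne, ENNReal.ofReal_eq_zero, not_le]
    positivity
  have h := (Lp.memLp φ).smul_measure (c := (ENNReal.ofReal (1 / √(2 * Real.pi)))⁻¹)
    (ENNReal.inv_ne_top.2 hc)
  have h1 : (ENNReal.ofReal (1 / √(2 * Real.pi)))⁻¹ • haarR = (volume : Measure ℝ) := by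
    rw [haarR, smul_smul, ENNReal.inv_mul_cancel hc ENNReal.ofReal_ne_top, one_smul]
  rwa [h1] at h

/-- For `φ ∈ L²`, the function `F⁻¹[φ](g) = ∫ φ(x) e^{i x g} dx / √(2π)` (extended from `L¹ ∩ L²`
by Plancherel's theorem).  Mathlib's transform is `(𝓕⁻ φ)(w) = ∫ φ(x) e^{2π i x w} dx`. -/
def invFourierFun (φ : L2R) : ℝ → ℂ := fun g =>
  ((1 / √(2 * Real.pi) : ℝ) : ℂ) *
    (𝓕⁻ ((memLp_volume φ).toLp φ : Lp ℂ 2 (volume : Measure ℝ)) : Lp ℂ 2 (volume : Measure ℝ))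
      ((2 * Real.pi)⁻¹ * g)

theorem map_scale_volume : Measure.map (fun g : ℝ => (2 * Real.pi)⁻¹ * g) volume
    = ENNReal.ofReal (2 * Real.pi) • (volume : Measure ℝ) := by
  have h0 : (2 * Real.pi)⁻¹ ≠ 0 := by positivity
  rw [Real.map_volume_mul_left h0, inv_inv, abs_of_pos (by positivity)]

theorem ae_scale {p : ℝ → Prop} (h : ∀ᵐ x ∂(volume : Measure ℝ), p x) :
    ∀ᵐ g ∂haarR, p ((2 * Real.pi)⁻¹ * g) := by
  have h1 : ∀ᵐ x ∂(Measure.map (fun g : ℝ => (2 * Real.pi)⁻¹ * g) volume), p x := by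
    rw [map_scale_volume]
    exact Measure.smul_absolutelyContinuous.ae_le h
  have h2 := ae_of_ae_map (by fun_prop) h1
  exact Measure.smul_absolutelyContinuous.ae_le h2

theorem ae_volume_of_haarR {p : ℝ → Prop} (h : ∀ᵐ x ∂haarR, p x) :
    ∀ᵐ x ∂(volume : Measure ℝ), p x := by
  have hc : ENNReal.ofReal (1 / √(2 * Real.pi)) ≠ 0 := by
    rw [Ne, ENNReal.ofReal_eq_zero, not_le]
    positivity
  exact (Measure.ae_ennreal_smul_measure_iff hc).1 h

theorem eLpNorm_invFourierFun (φ : L2R) :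
    eLpNorm (invFourierFun φ) 2 haarR = eLpNorm φ 2 haarR := by
  set ψ : Lp ℂ 2 (volume : Measure ℝ) := 𝓕⁻ ((memLp_volume φ).toLp φ) with hψ
  have hnorm : eLpNorm ψ 2 volume = eLpNorm φ 2 volume := by
    have h1 : ‖ψ‖ = ‖(memLp_volume φ).toLp φ‖ :=
      (Lp.fourierTransformₗᵢ ℝ ℂ).symm.norm_map _
    rw [Lp.norm_def, Lp.norm_toLp] at h1
    exact (ENNReal.toReal_eq_toReal_iff' (Lp.eLpNorm_ne_top ψ) (memLp_volume φ).2.ne).1 h1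
  have hcomp : eLpNorm (fun g : ℝ => ψ ((2 * Real.pi)⁻¹ * g)) 2 volume
      = ENNReal.ofReal (2 * Real.pi) ^ (1 / 2 : ℝ) * eLpNorm ψ 2 volume := by
    have h := eLpNorm_map_measure (p := 2) (μ := volume) (f := fun g : ℝ => (2 * Real.pi)⁻¹ * g)
      (g := ψ) (by
        rw [map_scale_volume]
        exact (Lp.memLp ψ).1.mono_ac Measure.smul_absolutelyContinuous) (by fun_prop)
    rw [map_scale_volume, eLpNorm_smul_measure_of_ne_top (by simp)] at h
    rw [show (fun g : ℝ => ψ ((2 * Real.pi)⁻¹ * g)) = ψ ∘ fun g : ℝ => (2 * Real.pi)⁻¹ * g from rfl,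
      ← h]
    simp
  have hconst : ‖((1 / √(2 * Real.pi) : ℝ) : ℂ)‖ₑ * ENNReal.ofReal (2 * Real.pi) ^ (1 / 2 : ℝ)
      = 1 := by
    rw [ENNReal.ofReal_rpow_of_nonneg (by positivity) (by norm_num), ← Real.sqrt_eq_rpow,
      ← ofReal_norm, Complex.norm_real, Real.norm_of_nonneg (by positivity),
      ← ENNReal.ofReal_mul (by positivity), one_div, inv_mul_cancel₀ (by positivity),
      ENNReal.ofReal_one]
  have hfun : invFourierFun φ
      = ((1 / √(2 * Real.pi) : ℝ) : ℂ) • fun g : ℝ => ψ ((2 * Real.pi)⁻¹ * g) := rfl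
  have hscale : ∀ f : ℝ → ℂ, eLpNorm f 2 haarR
      = ENNReal.ofReal (1 / √(2 * Real.pi)) ^ (1 / (2 : ℝ≥0∞)).toReal • eLpNorm f 2 volume :=
    fun f => eLpNorm_smul_measure_of_ne_top (by simp) f _
  rw [hscale, hscale, hfun, eLpNorm_const_smul, hcomp, ← mul_assoc, hconst, one_mul, hnorm]

theorem memLp_invFourierFun (φ : L2R) : MemLp (invFourierFun φ) 2 haarR := by
  refine ⟨?_, by rw [eLpNorm_invFourierFun]; exact (Lp.memLp φ).2⟩
  refine AEStronglyMeasurable.const_mul ?_ _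
  exact ((Lp.stronglyMeasurable _).comp_measurable (by fun_prop)).aestronglyMeasurable

/-- The inverse Fourier transform as an isometry of `L²(ℝ, dx / √(2π))`. -/
def invFourier : L2R →ₗᵢ[ℂ] L2R where
  toFun φ := (memLp_invFourierFun φ).toLp _
  map_add' φ ψ := by
    rw [← MemLp.toLp_add]
    refine MemLp.toLp_congr _ _ ?_
    have h : (memLp_volume (φ + ψ)).toLp (φ + ψ : L2R)
        = (memLp_volume φ).toLp φ + (memLp_volume ψ).toLp ψ := by
      rw [← MemLp.toLp_add]
      exact MemLp.toLp_congr _ _ (ae_volume_of_haarR (Lp.coeFn_add φ ψ))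
    have h2 := ae_scale (Lp.coeFn_add (𝓕⁻ ((memLp_volume φ).toLp φ) : Lp ℂ 2 (volume : Measure ℝ))
      (𝓕⁻ ((memLp_volume ψ).toLp ψ) : Lp ℂ 2 (volume : Measure ℝ)))
    filter_upwards [h2] with x hx
    simp only [Pi.add_apply] at hx ⊢
    rw [invFourierFun, h, FourierTransform.fourierInv_add, hx, invFourierFun, invFourierFun]
    ring
  map_smul' c φ := by
    rw [RingHom.id_apply, ← MemLp.toLp_const_smul]
    refine MemLp.toLp_congr _ _ ?_
    have h : (memLp_volume (c • φ)).toLp (c • φ : L2R) = c • (memLp_volume φ).toLp φ := by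
      rw [← MemLp.toLp_const_smul]
      exact MemLp.toLp_congr _ _ (ae_volume_of_haarR (Lp.coeFn_smul c φ))
    have h2 := ae_scale
      (Lp.coeFn_smul c (𝓕⁻ ((memLp_volume φ).toLp φ) : Lp ℂ 2 (volume : Measure ℝ)))
    filter_upwards [h2] with x hx
    simp only [Pi.smul_apply, smul_eq_mul] at hx ⊢
    rw [invFourierFun, h, FourierTransform.fourierInv_smul, hx, invFourierFun]
    ring
  norm_map' φ := by
    change ‖(memLp_invFourierFun φ).toLp _‖ = ‖φ‖
    rw [Lp.norm_toLp, eLpNorm_invFourierFun, Lp.norm_def]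

/-! ## The quadratic forms of `Q²` and `P²` -/

/-- `⟨φ|Q²|φ⟩ = ∫ x² |φ(x)|² dx / √(2π)`, with value `∞` if `φ` is not in the domain of `Q`. -/
def secondMoment (φ : L2R) : ℝ≥0∞ := ∫⁻ x, ENNReal.ofReal (x ^ 2) * ‖φ x‖ₑ ^ 2 ∂haarR

/-- `ψ` is the weak derivative of `φ` on `ℝ`. -/
def IsWeakDeriv (φ ψ : L2R) : Prop :=
  ∀ η : ℝ → ℝ, ContDiff ℝ ∞ η → HasCompactSupport η →
    ∫ x, ((deriv η x : ℝ) : ℂ) * φ x = -∫ x, ((η x : ℝ) : ℂ) * ψ x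

/-- `⟨φ|P²|φ⟩ = ‖Pφ‖²` for the momentum operator `P = -i d/dx`, whose domain consists of
the `φ ∈ L²(ℝ)` with a (necessarily unique) weak derivative in `L²(ℝ)`; the value is `∞` if `φ` is
not in the domain of `P`. -/
def momentumForm (φ : L2R) : ℝ≥0∞ := ⨅ (ψ : L2R) (_ : IsWeakDeriv φ ψ), ‖ψ‖ₑ ^ 2

/-- `φ` is an odd function. -/
def IsOdd (φ : L2R) : Prop := ∀ᵐ x ∂haarR, φ (-x) = -φ x

/-! ## States, positive operator valued measures and outcome distributions -/

section Quantum

variable {H : Type*} [NormedAddCommGroup H] [InnerProductSpace ℂ H]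

variable (H) in
/-- A positive operator valued measure on `H` with values in `ℝ`, weakly `σ`-additive. -/
structure POVM where
  /-- The operator of an event; its values are relevant only on measurable sets. -/
  op : Set ℝ → H →L[ℂ] H
  positive : ∀ B, MeasurableSet B → (op B).IsPositive
  op_univ : op univ = 1
  additive : ∀ B : ℕ → Set ℝ, (∀ n, MeasurableSet (B n)) → Pairwise (Function.onFun Disjoint B) →
    ∀ φ ψ : H, HasSum (fun n => ⟪φ, op (B n) ψ⟫_ℂ) ⟪φ, op (⋃ n, B n) ψ⟫_ℂ

theorem POVM.op_empty (M : POVM H) (φ : H) : ⟪φ, M.op ∅ φ⟫_ℂ = 0 := by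
  have h := M.additive (fun _ => ∅) (fun _ => MeasurableSet.empty)
    (fun _ _ _ => disjoint_bot_left) φ φ
  exact tendsto_nhds_unique tendsto_const_nhds h.summable.tendsto_atTop_zero

/-- The measure `B ↦ ⟨φ|M(B)|φ⟩`. -/
def POVM.dist (M : POVM H) (φ : H) : Measure ℝ :=
  Measure.ofMeasurable (fun B _ => ENNReal.ofReal (⟪φ, M.op B φ⟫_ℂ).re)
    (by simp [M.op_empty φ])
    (fun B hB hd => by
      have h := Complex.hasSum_re (M.additive B hB hd φ φ)
      rw [← h.tsum_eq]
      exact ENNReal.ofReal_tsum_of_nonneg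
        (fun n => (M.positive (B n) (hB n)).re_inner_nonneg_right φ) h.summable)

variable [CompleteSpace H]

variable (H) in
/-- The index set of some orthonormal (Hilbert) basis of `H`. -/
def basisIndex : Set H := Classical.choose (exists_hilbertBasis ℂ H)

variable (H) in
/-- Some orthonormal (Hilbert) basis of `H`. -/
def onb : HilbertBasis (basisIndex H) ℂ H :=
  Classical.choose (Classical.choose_spec (exists_hilbertBasis ℂ H))

/-- The trace of a positive operator: the sum of its diagonal entries in an orthonormal basis. -/
def trPos (A : H →L[ℂ] H) : ℝ≥0∞ := ∑' i, ENNReal.ofReal (⟪onb H i, A (onb H i)⟫_ℂ).re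

/-- `ρ` is a density operator: a positive operator of trace one. -/
def IsDensity (ρ : H →L[ℂ] H) : Prop := ρ.IsPositive ∧ trPos ρ = 1

/-- The projection `|φ⟩⟨φ|` (for a unit vector `φ`). -/
def pureState (φ : H) : H →L[ℂ] H := InnerProductSpace.rankOne ℂ φ φ

/-- The vectors `√ρ eᵢ` for an orthonormal basis `(eᵢ)`, so that `ρ = ∑ᵢ |√ρ eᵢ⟩⟨√ρ eᵢ|` and
`Tr ρ A = Tr √ρ A √ρ = ∑ᵢ ⟨√ρ eᵢ|A|√ρ eᵢ⟩` for every positive operator `A`. -/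
def rootVec (ρ : H →L[ℂ] H) (i : basisIndex H) : H := CFC.sqrt ρ (onb H i)

/-- The outcome distribution `B ↦ Tr ρ M(B) = Tr √ρ M(B) √ρ` of the measurement `M` in the
state `ρ`. -/
def POVM.outcome (M : POVM H) (ρ : H →L[ℂ] H) : Measure ℝ :=
  Measure.sum fun i => M.dist (rootVec ρ i)

end Quantum

/-! ## The estimation problem on `L²(ℝ₊)` -/

/-- `M` is covariant: `f(g) M(B) f(g)† = M(g + B)`. -/
def IsCovariant (M : POVM L2Pos) : Prop :=
  ∀ (g : ℝ) (B : Set ℝ), MeasurableSet B →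
    rep g ∘L M.op B ∘L ContinuousLinearMap.adjoint (rep g) = M.op ((fun x => g + x) '' B)

/-- `D_{R,g}(ρ, M)`, the mean square error if the true parameter is `g`. -/
def errorAt (g : ℝ) (ρ : L2Pos →L[ℂ] L2Pos) (M : POVM L2Pos) : ℝ≥0∞ :=
  ∫⁻ x, ENNReal.ofReal ((x - g) ^ 2)
    ∂(M.outcome (rep g ∘L ρ ∘L ContinuousLinearMap.adjoint (rep g)))

/-- `D_R(ρ, M)`, the worst case of the mean square error. -/
def worstError (ρ : L2Pos →L[ℂ] L2Pos) (M : POVM L2Pos) : ℝ≥0∞ := ⨆ g : ℝ, errorAt g ρ M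

/-- The average energy `Tr ρ Q² = Tr √ρ Q² √ρ`. -/
def energy (ρ : L2Pos →L[ℂ] L2Pos) : ℝ≥0∞ :=
  ∑' i, secondMoment (extendByZero (rootVec ρ i))

/-- The map `φ ↦ F⁻¹[φ]` on `L²(ℝ₊)`. -/
def invFourierPos : L2Pos →ₗᵢ[ℂ] L2R := invFourier.comp extendByZero

theorem inner_projOp (B : Set ℝ) (hB : MeasurableSet B) (φ ψ : L2R) :
    ⟪φ, projOp B hB ψ⟫_ℂ = ∫ x in B, ⟪φ x, ψ x⟫_ℂ ∂haarR := by
  rw [L2.inner_def, ← integral_indicator hB]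
  refine integral_congr_ae ?_
  filter_upwards [mulOp_coeFn (μ := haarR) (m := B.indicator fun _ => 1)
    (measurable_const.indicator hB) (fun x => by by_cases hx : x ∈ B <;> simp [hx]) ψ] with x hx
  rw [projOp, hx]
  by_cases hxB : x ∈ B
  · simp [hxB]
  · simp [hxB]

open Classical in
/-- The standard covariant measurement, `⟨φ|M(B)|φ⟩ = ∫_B |F⁻¹[φ](g)|² dg / √(2π)`. -/
def standardPOVM : POVM L2Pos where
  op B := if hB : MeasurableSet B then
      ContinuousLinearMap.adjoint invFourierPos.toContinuousLinearMap ∘L projOp B hB ∘L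
        invFourierPos.toContinuousLinearMap
    else 0
  positive B hB := by
    rw [dif_pos hB, ContinuousLinearMap.isPositive_iff_complex]
    intro φ
    have h : ⟪(ContinuousLinearMap.adjoint invFourierPos.toContinuousLinearMap ∘L projOp B hB ∘L
        invFourierPos.toContinuousLinearMap) φ, φ⟫_ℂ
        = ((∫ x in B, ‖invFourierPos φ x‖ ^ 2 ∂haarR : ℝ) : ℂ) := by
      rw [← inner_conj_symm, ContinuousLinearMap.comp_apply, ContinuousLinearMap.comp_apply,
        ContinuousLinearMap.adjoint_inner_right, inner_projOp, ← integral_conj,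
        ← integral_complex_ofReal]
      refine integral_congr_ae (Filter.Eventually.of_forall fun x => ?_)
      simp only [LinearIsometry.coe_toContinuousLinearMap]
      rw [inner_conj_symm, inner_self_eq_norm_sq_to_K]
      simp
    rw [h]
    exact ⟨by simp, by
      simpa using integral_nonneg (μ := haarR.restrict B) fun x => sq_nonneg ‖invFourierPos φ x‖⟩
  op_univ := by
    rw [dif_pos MeasurableSet.univ]
    refine ContinuousLinearMap.ext fun ψ => ext_inner_left ℂ fun φ => ?_
    rw [ContinuousLinearMap.comp_apply, ContinuousLinearMap.comp_apply,
      ContinuousLinearMap.adjoint_inner_right, inner_projOp, setIntegral_univ, ← L2.inner_def]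
    exact invFourierPos.inner_map_map φ ψ
  additive B hB hd φ ψ := by
    have key : ∀ (C : Set ℝ) (hC : MeasurableSet C),
        ⟪φ, (if hC : MeasurableSet C then
          ContinuousLinearMap.adjoint invFourierPos.toContinuousLinearMap ∘L projOp C hC ∘L
            invFourierPos.toContinuousLinearMap
          else 0) ψ⟫_ℂ = ∫ x in C, ⟪invFourierPos φ x, invFourierPos ψ x⟫_ℂ ∂haarR := by
      intro C hC
      rw [dif_pos hC, ContinuousLinearMap.comp_apply, ContinuousLinearMap.comp_apply,
        ContinuousLinearMap.adjoint_inner_right, inner_projOp]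
      rfl
    rw [key _ (MeasurableSet.iUnion hB)]
    simp_rw [fun n => key (B n) (hB n)]
    exact hasSum_integral_iUnion hB hd (L2.integrable_inner _ _).integrableOn

/-! ## The optimization problems -/

/-- Errors in Scheme 1: one state `ρ` on `L²(ℝ₊)` and one covariant measurement. -/
def scheme1Errors (E : ℝ) : Set ℝ≥0∞ :=
  {d | ∃ (ρ : L2Pos →L[ℂ] L2Pos) (M : POVM L2Pos), IsDensity ρ ∧ IsCovariant M ∧
    energy ρ ≤ ENNReal.ofReal E ∧ d = worstError ρ M}

/-- Errors in Scheme 2: the pair `(ρ i, M i)` is used with probability `p i`, `i = 0, 1, 2, …`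
(finitely many if all other `p i` are `0`). -/
def scheme2Errors (E : ℝ) : Set ℝ≥0∞ :=
  {d | ∃ (p : ℕ → ℝ≥0∞) (ρ : ℕ → L2Pos →L[ℂ] L2Pos) (M : ℕ → POVM L2Pos),
    ∑' i, p i = 1 ∧ (∀ i, IsDensity (ρ i)) ∧ (∀ i, IsCovariant (M i)) ∧
    ∑' i, p i * energy (ρ i) ≤ ENNReal.ofReal E ∧ d = ∑' i, p i * worstError (ρ i) (M i)}

/-- `∫ g² |F⁻¹[φ](g)|² dg / √(2π)` for unit vectors `φ ∈ L²(ℝ₊)` with `⟨φ|Q²|φ⟩ ≤ E`. -/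
def inputErrors (E : ℝ) : Set ℝ≥0∞ :=
  {d | ∃ φ : L2Pos, ‖φ‖ = 1 ∧ secondMoment (extendByZero φ) ≤ ENNReal.ofReal E ∧
    d = secondMoment (invFourierPos φ)}

/-- `⟨φ|P²|φ⟩` for unit vectors `φ ∈ L²(ℝ₊)` with `⟨φ|Q²|φ⟩ ≤ E`. -/
def momentumValues (E : ℝ) : Set ℝ≥0∞ :=
  {d | ∃ φ : L2Pos, ‖φ‖ = 1 ∧ secondMoment (extendByZero φ) ≤ ENNReal.ofReal E ∧
    d = momentumForm (extendByZero φ)}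

/-- `⟨φ|P²|φ⟩` for odd unit vectors `φ ∈ L²(ℝ)` with `⟨φ|Q²|φ⟩ ≤ E`. -/
def oddMomentumValues (E : ℝ) : Set ℝ≥0∞ :=
  {d | ∃ φ : L2R, IsOdd φ ∧ ‖φ‖ = 1 ∧ secondMoment φ ≤ ENNReal.ofReal E ∧ d = momentumForm φ}

/-- The function `(3/E)^{3/4} x e^{-3x²/(4E)}`. -/
def oddOptimal (E x : ℝ) : ℝ := (3 / E) ^ (3 / 4 : ℝ) * x * Real.exp (-(3 * x ^ 2) / (4 * E))

/-- The function `√2 (3/E)^{3/4} x e^{-3x²/(4E)}`. -/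
def optimalInput (E x : ℝ) : ℝ :=
  √2 * (3 / E) ^ (3 / 4 : ℝ) * x * Real.exp (-(3 * x ^ 2) / (4 * E))

end RealEstimation

end

open MeasureTheory Set RealEstimation

noncomputable section

open MeasureTheory Set RealEstimation
open scoped ENNReal InnerProductSpace FourierTransform ContDiff

namespace RealEstimation

/-! ## Comparison of `haarR` with Lebesgue measure -/

/-! The lower bound reduces a covariant measurement to the modulus of the wave function, and the
modulus to a Hardy-type inequality on the half line. For a covariant `M` let V(s) = ∫ e^{isx} M(dx).
Covariance gives the Weyl relation V(s) f(g) = e^{isg} f(g) V(s), so for s ≥ 0 the contraction V(s)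
is a weighted shift, (V(s)ψ)(x+s) = m(x) ψ(x) with |m| ≤ 1 on the half line
(`exists_multiplier_of_shift`). Hence the real part of ⟨φ, V(s) φ⟩ is at most ∫ |φ(x+s)||φ(x)|,
which says that ∫ 2(1 − cos sx) against the outcome distribution is at least the squared norm of
|φ|(· + s) − |φ|. Dividing by s² and letting s tend to 0 bounds the mean square error from below by
the momentum form of |φ| (`IsCovariant.tsum_momentumForm_le`, with `momentumForm_eq_secondMoment`
and Fatou's lemma).

On the half line, extension by zero forces a function of finite momentum form to vanish at the
origin. Expanding 0 ≤ ∫ (u' + (ax − 1/x) u)² then gives 3a‖u‖² ≤ ‖u'‖² + a²‖xu‖² for every a > 0,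
with equality only for multiples of x e^{−ax²/2} (`uncertainty_L2Pos`); odd functions are treated by
splitting at 0 (`uncertainty_isOdd`). Summing over the vectors √ρ eᵢ yields 3a ≤ D + a²·energy
(`IsDensity.le_worstError_add_energy`). This is affine in the pair (error, energy), so it survives
randomization over schemes. The best choice is a = 3/(2E), for which 3a − a²E = 9/(4E), and the
Gaussian-type functions attain it.

In the equality case every √ρ e has modulus proportional to x e^{−ax²/2}. Applying this to sums of
two vectors and polarizing shows that the range of √ρ is one-dimensional, so ρ is pure with
prescribed modulus (`IsDensity.exists_eq_pureState`). For the standard measurement the error is the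
momentum form of φ itself, so the phase must be constant as well. With a free choice of measurement
any phase can be absorbed by conjugating with a multiplication operator (`exists_phase`). -/

theorem haarR_const_ne_zero : ENNReal.ofReal (1 / √(2 * Real.pi)) ≠ 0 := by
  rw [Ne, ENNReal.ofReal_eq_zero, not_le]
  positivity

theorem ae_haarR_iff {p : ℝ → Prop} : (∀ᵐ x ∂haarR, p x) ↔ ∀ᵐ x ∂(volume : Measure ℝ), p x :=
  Measure.ae_ennreal_smul_measure_iff haarR_const_ne_zero

theorem integral_haarR {G : Type*} [NormedAddCommGroup G] [NormedSpace ℝ G] (f : ℝ → G) :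
    ∫ x, f x ∂haarR = (1 / √(2 * Real.pi)) • ∫ x, f x := by
  rw [haarR, integral_smul_measure, ENNReal.toReal_ofReal (by positivity)]

theorem lintegral_haarR (f : ℝ → ℝ≥0∞) :
    ∫⁻ x, f x ∂haarR = ENNReal.ofReal (1 / √(2 * Real.pi)) * ∫⁻ x, f x := by
  rw [haarR, lintegral_smul_measure, smul_eq_mul]

theorem memLp_haarR_iff {f : ℝ → ℂ} {p : ℝ≥0∞} : MemLp f p haarR ↔ MemLp f p volume := by
  refine ⟨fun h => ?_, fun h => h.smul_measure ENNReal.ofReal_ne_top⟩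
  have h := h.smul_measure (c := (ENNReal.ofReal (1 / √(2 * Real.pi)))⁻¹)
    (ENNReal.inv_ne_top.2 haarR_const_ne_zero)
  rwa [haarR, smul_smul, ENNReal.inv_mul_cancel haarR_const_ne_zero ENNReal.ofReal_ne_top,
    one_smul] at h

/-- Two functions in `L²` that agree as distributions agree almost everywhere. -/
theorem ae_eq_of_forall_integral_mul_eq {f f' : ℝ → ℂ} (hf : MemLp f 2 haarR)
    (hf' : MemLp f' 2 haarR)
    (h : ∀ η : ℝ → ℂ, ContDiff ℝ ∞ η → HasCompactSupport η →
      ∫ x, η x * f x = ∫ x, η x * f' x) : f =ᵐ[haarR] f' := by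
  refine ae_haarR_iff.2 (ae_eq_of_integral_contDiff_smul_eq
    ((memLp_haarR_iff.1 hf).locallyIntegrable (by norm_num))
    ((memLp_haarR_iff.1 hf').locallyIntegrable (by norm_num)) fun g hg hgc => ?_)
  have := h (fun x => (g x : ℂ)) (Complex.ofRealCLM.contDiff.comp hg)
    (hgc.comp_left (g := fun x : ℝ => (x : ℂ)) rfl)
  simpa only [Complex.real_smul] using this

/-! ## The inverse Fourier transform as an integral -/

/-- The integral `∫ f(x) e^{i x g} dx / √(2π)`. -/
def invFourierInt (f : ℝ → ℂ) (g : ℝ) : ℂ :=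
  ((1 / √(2 * Real.pi) : ℝ) : ℂ) * ∫ x, Complex.exp ((g * x : ℝ) * Complex.I) * f x

theorem invFourierInt_eq (f : ℝ → ℂ) (g : ℝ) :
    invFourierInt f g = ((1 / √(2 * Real.pi) : ℝ) : ℂ) * 𝓕⁻ f ((2 * Real.pi)⁻¹ * g) := by
  rw [invFourierInt, Real.fourierInv_eq']
  congr 2
  ext x
  rw [smul_eq_mul]
  congr 3
  simp
  field_simp

theorem invFourier_coeFn (φ : L2R) : invFourier φ =ᵐ[haarR] invFourierFun φ :=
  (memLp_invFourierFun φ).coeFn_toLp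

/-- The Fourier transform is symmetric for the bilinear pairing. -/
theorem integral_mul_invFourierFun (φ : L2R) {η : ℝ → ℂ} (h1 : ContDiff ℝ ∞ η)
    (h2 : HasCompactSupport η) :
    ∫ x, η x * invFourierFun φ x = ∫ y, invFourierInt η y * φ y := by
  have hpi : (2 * Real.pi) ≠ 0 := by positivity
  set Φ : Lp ℂ 2 (volume : Measure ℝ) := (memLp_volume φ).toLp φ with hΦ
  -- The dilation by 2π absorbs the difference between the kernels e^{ixg} and e^{2πixw}.
  set η2 : ℝ → ℂ := fun t => η ((2 * Real.pi) * t) with hη2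
  have h1' : ContDiff ℝ ∞ η2 := h1.comp (by fun_prop)
  have h2' : HasCompactSupport η2 :=
    h2.comp_homeomorph (Homeomorph.mulLeft₀ (2 * Real.pi) hpi)
  let s := h2'.toSchwartzMap h1'
  -- The L² transform agrees with the transform of tempered distributions, which is defined by
  -- moving the transform onto the Schwartz function.
  have key := congrArg (fun T => T s) (Lp.fourierInv_toTemperedDistribution_eq Φ)
  simp only [TemperedDistribution.fourierInv_apply, Lp.toTemperedDistribution_apply] at key
  have e1 : ∫ x, η x * invFourierFun φ x = ((1 / √(2 * Real.pi) : ℝ) : ℂ) * ((2 * Real.pi : ℝ) *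
      ∫ t, η2 t * (𝓕⁻ Φ : Lp ℂ 2 (volume : Measure ℝ)) t) := by
    have := Measure.integral_comp_mul_left (fun x => η x * invFourierFun φ x) (2 * Real.pi)
    rw [abs_of_pos (by positivity)] at this
    rw [← integral_const_mul, ← integral_const_mul]
    have e : ∫ x, η x * invFourierFun φ x
      = (2 * Real.pi) • ∫ x, η (2 * Real.pi * x) * invFourierFun φ (2 * Real.pi * x) := by
      rw [this, smul_smul, mul_inv_cancel₀ hpi, one_smul]
    rw [e, ← integral_smul]
    congr 1
    ext t
    simp only [invFourierFun, hη2, Complex.real_smul, inv_mul_cancel_left₀ hpi]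
    ring
  have e2 : ∀ y, invFourierInt η y = ((1 / √(2 * Real.pi) : ℝ) : ℂ) * ((2 * Real.pi : ℝ) *
      (𝓕⁻ s) y) := by
    intro y
    rw [invFourierInt, SchwartzMap.fourierInv_coe, Real.fourierInv_eq']
    congr 1
    have := Measure.integral_comp_mul_left
      (fun x => Complex.exp ((y * x : ℝ) * Complex.I) * η x) (2 * Real.pi)
    rw [abs_of_pos (by positivity)] at this
    rw [← integral_const_mul]
    have e : ∫ x, Complex.exp ((y * x : ℝ) * Complex.I) * η x = (2 * Real.pi) • ∫ x,
        Complex.exp ((y * (2 * Real.pi * x) : ℝ) * Complex.I) * η (2 * Real.pi * x) := by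
      rw [this, smul_smul, mul_inv_cancel₀ hpi, one_smul]
    rw [e, ← integral_smul]
    congr 1
    ext t
    simp only [Complex.real_smul, smul_eq_mul, s, HasCompactSupport.toSchwartzMap_toFun, hη2,
      RCLike.inner_apply, conj_trivial]
    congr 3
    push_cast
    ring
  rw [e1]
  simp_rw [e2]
  have e3 : ∀ y, ((1 / √(2 * Real.pi) : ℝ) : ℂ) * (((2 * Real.pi : ℝ) : ℂ) * (𝓕⁻ s) y) * φ y
     = ((1 / √(2 * Real.pi) : ℝ) : ℂ) * (((2 * Real.pi : ℝ) : ℂ) * ((𝓕⁻ s) y * φ y)) :=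
    fun y => by ring
  simp_rw [e3, integral_const_mul]
  congr 2
  refine Eq.trans ?_ (key.symm.trans ?_)
  · rfl
  · refine integral_congr_ae ?_
    filter_upwards [(memLp_volume φ).coeFn_toLp] with y hy
    rw [smul_eq_mul, hΦ, hy]

theorem integral_mul_invFourier (φ : L2R) {η : ℝ → ℂ} (h1 : ContDiff ℝ ∞ η)
    (h2 : HasCompactSupport η) :
    ∫ x, η x * invFourier φ x = ∫ y, invFourierInt η y * φ y := by
  rw [← integral_mul_invFourierFun φ h1 h2]
  refine integral_congr_ae ?_
  filter_upwards [ae_haarR_iff.1 (invFourier_coeFn φ)] with x hx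
  rw [hx]

/-- Fubini: the kernel e^{ixy} is symmetric in its two variables. The integrable counterpart of
`integral_mul_invFourier`; comparing the two identifies the L² transform with the integral. -/
theorem integral_mul_invFourierInt {f g : ℝ → ℂ} (hf : Integrable f) (hg : Integrable g) :
    ∫ x, g x * invFourierInt f x = ∫ x, invFourierInt g x * f x := by
  have h := (VectorFourier.integral_fourierIntegral_smul_eq_flip (μ := volume) (ν := volume)
    (L := (2 * Real.pi)⁻¹ • -innerₗ ℝ) (e := Real.fourierChar)
    Real.continuous_fourierChar (by
      simp only [LinearMap.smul_apply, LinearMap.neg_apply, innerₗ_apply_apply]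
      fun_prop) hg hf).symm
  have e : ∀ (h : ℝ → ℂ) (x : ℝ), ∫ y, Complex.exp ((x * y : ℝ) * Complex.I) * h y
    = VectorFourier.fourierIntegral Real.fourierChar volume ((2 * Real.pi)⁻¹ • -innerₗ ℝ) h x := by
    intro h x
    rw [VectorFourier.fourierIntegral]
    congr 1
    ext y
    rw [Circle.smul_def, Real.fourierChar_apply, smul_eq_mul]
    congr 3
    simp
    field_simp
  have e' : ∀ (h : ℝ → ℂ) (x : ℝ), ∫ y, Complex.exp ((x * y : ℝ) * Complex.I) * h y
    = VectorFourier.fourierIntegral Real.fourierChar volume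
      ((2 * Real.pi)⁻¹ • -innerₗ ℝ).flip h x := by
    intro h x
    rw [e]
    congr 1
    ext
    simp
  simp only [invFourierInt]
  simp_rw [← e', ← e] at h
  have a1 : ∀ x, g x * (((1 / √(2 * Real.pi) : ℝ) : ℂ) *
      ∫ y, Complex.exp ((x * y : ℝ) * Complex.I) * f y) = ((1 / √(2 * Real.pi) : ℝ) : ℂ) *
      (g x • ∫ y, Complex.exp ((x * y : ℝ) * Complex.I) * f y) := fun x => by
    rw [smul_eq_mul]; ring
  simp_rw [a1, integral_const_mul, h, mul_assoc, smul_eq_mul, integral_const_mul]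

/-- On integrable functions the inverse Fourier transform is given by the integral. -/
theorem invFourier_ae_eq_invFourierInt (φ : L2R) (hφ : Integrable φ) :
    invFourier φ =ᵐ[haarR] invFourierInt φ := by
  refine ae_haarR_iff.2 (ae_eq_of_integral_contDiff_smul_eq
    ((memLp_haarR_iff.1 (Lp.memLp _)).locallyIntegrable (by norm_num)) ?_ fun g hg hgc => ?_)
  · refine Continuous.locallyIntegrable ?_
    have : invFourierInt φ = fun g => ((1 / √(2 * Real.pi) : ℝ) : ℂ) *
        𝓕⁻ (φ : ℝ → ℂ) ((2 * Real.pi)⁻¹ * g) := funext fun g => invFourierInt_eq _ g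
    rw [this]
    have hc : Continuous (𝓕⁻ (φ : ℝ → ℂ)) := by
      have := VectorFourier.fourierIntegral_continuous (μ := volume)
        Real.continuous_fourierChar (L := -innerₗ ℝ) (by
          simp only [LinearMap.neg_apply, innerₗ_apply_apply]
          fun_prop) hφ
      exact this
    fun_prop
  · have h1 : ContDiff ℝ ∞ (fun x => (g x : ℂ)) := Complex.ofRealCLM.contDiff.comp hg
    have h2 : HasCompactSupport (fun x => (g x : ℂ)) :=
      hgc.comp_left (g := fun x : ℝ => (x : ℂ)) rfl
    have := integral_mul_invFourier φ h1 h2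
    rw [← integral_mul_invFourierInt hφ (h1.continuous.integrable_of_hasCompactSupport h2)] at this
    simpa only [Complex.real_smul] using this

theorem invFourierInt_congr_ae {f g : ℝ → ℂ} (h : f =ᵐ[volume] g) :
    invFourierInt f = invFourierInt g := by
  ext x
  rw [invFourierInt, invFourierInt]
  congr 1
  refine integral_congr_ae ?_
  filter_upwards [h] with y hy
  rw [hy]

/-- Modulation becomes translation. -/
theorem invFourierInt_exp_mul (f : ℝ → ℂ) (g x : ℝ) :
    invFourierInt (fun y => Complex.exp ((g * y : ℝ) * Complex.I) * f y) x
      = invFourierInt f (x + g) := by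
  rw [invFourierInt, invFourierInt]
  congr 2
  ext y
  rw [← mul_assoc, ← Complex.exp_add]
  congr 2
  push_cast
  ring

/-- Translation becomes modulation. -/
theorem invFourierInt_comp_add (f : ℝ → ℂ) (s x : ℝ) :
    invFourierInt (fun y => f (y + s)) x
      = Complex.exp ((-(x * s) : ℝ) * Complex.I) * invFourierInt f x := by
  rw [invFourierInt, invFourierInt, mul_left_comm]
  congr 1
  rw [← integral_const_mul, ← integral_add_right_eq_self (fun y => Complex.exp
    ((-(x * s) : ℝ) * Complex.I) * (Complex.exp ((x * y : ℝ) * Complex.I) * f y)) s]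
  congr 1
  ext y
  rw [← mul_assoc, ← Complex.exp_add]
  congr 2
  push_cast
  ring

/-! ### Translations, modulations and Plancherel's theorem -/

theorem enorm_sq_eq_lintegral {μ : Measure ℝ} (φ : Lp ℂ 2 μ) : ‖φ‖ₑ ^ 2 = ∫⁻ x, ‖φ x‖ₑ ^ 2 ∂μ := by
  rw [Lp.enorm_def, eLpNorm_eq_lintegral_rpow_enorm_toReal (by norm_num) (by norm_num)]
  simp only [ENNReal.toReal_ofNat, ENNReal.rpow_ofNat, one_div]
  rw [← ENNReal.rpow_natCast, ← ENNReal.rpow_mul]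
  norm_num

theorem measurePreserving_add_haarR (s : ℝ) : MeasurePreserving (fun x => x + s) haarR haarR := by
  refine ⟨by fun_prop, ?_⟩
  rw [haarR, Measure.map_smul, (measurePreserving_add_right volume s).map_eq]

theorem measurePreserving_neg_haarR : MeasurePreserving (fun x : ℝ => -x) haarR haarR := by
  refine ⟨by fun_prop, ?_⟩
  rw [haarR, Measure.map_smul, (Measure.measurePreserving_neg (volume : Measure ℝ)).map_eq]

theorem memLp_comp_add (φ : L2R) (s : ℝ) : MemLp (fun x => φ (x + s)) 2 haarR :=
  (Lp.memLp φ).comp_measurePreserving (measurePreserving_add_haarR s)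

theorem contDiff_exp_mul_I (s : ℝ) :
    ContDiff ℝ ∞ (fun x : ℝ => Complex.exp ((s * x : ℝ) * Complex.I)) := by
  have : ContDiff ℝ ∞ (fun x : ℝ => ((s * x : ℝ) : ℂ)) :=
    Complex.ofRealCLM.contDiff.comp (contDiff_const.mul contDiff_id)
  exact (this.mul contDiff_const).cexp

/-- Modulation becomes translation. -/
theorem invFourier_of_ae_eq_exp_mul {φ ψ : L2R} (g : ℝ)
    (h : ψ =ᵐ[haarR] fun x => Complex.exp ((-(g * x) : ℝ) * Complex.I) * φ x) :
    invFourier ψ =ᵐ[haarR] fun x => invFourier φ (x - g) := by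
  refine ae_eq_of_forall_integral_mul_eq (Lp.memLp _)
    (memLp_comp_add _ (-g)) fun η h1 h2 => ?_
  have h1' : ContDiff ℝ ∞ (fun y => η (y + g)) := h1.comp (by fun_prop)
  have h2' : HasCompactSupport (fun y => η (y + g)) := h2.comp_homeomorph (Homeomorph.addRight g)
  have e := integral_mul_invFourier φ h1' h2'
  rw [← integral_add_right_eq_self (fun x => η x * invFourier φ (x - g)) g]
  simp only [add_sub_cancel_right]
  rw [e, integral_mul_invFourier ψ h1 h2]
  refine integral_congr_ae ?_
  filter_upwards [ae_haarR_iff.1 h] with y hy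
  rw [hy, invFourierInt_comp_add, ← mul_assoc, mul_comm (invFourierInt η y), mul_comm y g]

/-- Translation becomes modulation. -/
theorem invFourier_of_ae_eq_comp_add {φ ψ : L2R} (s : ℝ) (h : ψ =ᵐ[haarR] fun x => φ (x + s)) :
    invFourier ψ =ᵐ[haarR] fun x => Complex.exp ((-s * x : ℝ) * Complex.I) * invFourier φ x := by
  refine ae_eq_of_forall_integral_mul_eq (Lp.memLp _)
    (memLp_mul (by fun_prop) (fun x => (Complex.norm_exp_ofReal_mul_I _).le) _) fun η h1 h2 => ?_
  have h1' : ContDiff ℝ ∞ (fun y => Complex.exp ((-s * y : ℝ) * Complex.I) * η y) :=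
    (contDiff_exp_mul_I (-s)).mul h1
  have h2' : HasCompactSupport (fun y => Complex.exp ((-s * y : ℝ) * Complex.I) * η y) :=
    h2.mul_left
  have e := integral_mul_invFourier φ h1' h2'
  have e2 : ∀ x, η x * (Complex.exp ((-s * x : ℝ) * Complex.I) * invFourier φ x)
      = Complex.exp ((-s * x : ℝ) * Complex.I) * η x * invFourier φ x := fun x => by ring
  simp_rw [e2]
  rw [e, integral_mul_invFourier ψ h1 h2]
  simp_rw [invFourierInt_exp_mul]
  rw [← integral_add_right_eq_self (fun x => invFourierInt η (x + -s) * φ x) s]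
  simp only [add_neg_cancel_right]
  refine integral_congr_ae ?_
  filter_upwards [ae_haarR_iff.1 h] with y hy
  rw [hy]

theorem enorm_exp_mul_I_sub_one_sq (y : ℝ) :
    ‖Complex.exp ((y : ℝ) * Complex.I) - 1‖ₑ ^ 2 = ENNReal.ofReal (2 * (1 - Real.cos y)) := by
  rw [← ofReal_norm, ← ENNReal.ofReal_pow (norm_nonneg _), Complex.sq_norm, Complex.normSq_apply,
    Complex.exp_ofReal_mul_I]
  congr 1
  have := Real.sin_sq_add_cos_sq y
  simp only [Complex.sub_re, Complex.add_re, Complex.ofReal_re, Complex.ofReal_im, Complex.mul_re,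
    Complex.I_re, Complex.I_im, Complex.one_re, Complex.sub_im, Complex.add_im, Complex.mul_im,
    Complex.one_im]
  nlinarith

/-- The norm of a difference of translates, computed in the dual space. -/
theorem lintegral_enorm_comp_add_sub (φ : L2R) (s : ℝ) :
    ∫⁻ x, ‖φ (x + s) - φ x‖ₑ ^ 2 ∂haarR
      = ∫⁻ x, ENNReal.ofReal (2 * (1 - Real.cos (s * x))) * ‖invFourier φ x‖ₑ ^ 2 ∂haarR := by
  set ψ : L2R := (memLp_comp_add φ s).toLp _
  have hψ : ψ =ᵐ[haarR] fun x => φ (x + s) := (memLp_comp_add φ s).coeFn_toLp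
  have e1 : ‖ψ - φ‖ₑ ^ 2 = ∫⁻ x, ‖φ (x + s) - φ x‖ₑ ^ 2 ∂haarR := by
    rw [enorm_sq_eq_lintegral]
    refine lintegral_congr_ae ?_
    filter_upwards [hψ, Lp.coeFn_sub ψ φ] with x h1 h2
    rw [h2, Pi.sub_apply, h1]
  have e2 : ‖ψ - φ‖ₑ = ‖invFourier ψ - invFourier φ‖ₑ := by
    rw [← map_sub, ← ofReal_norm, ← ofReal_norm, invFourier.norm_map]
  rw [← e1, e2, enorm_sq_eq_lintegral]
  refine lintegral_congr_ae ?_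
  filter_upwards [invFourier_of_ae_eq_comp_add s hψ, Lp.coeFn_sub (invFourier ψ) (invFourier φ)]
    with x h1 h2
  rw [h2, Pi.sub_apply, h1, ← sub_one_mul, enorm_mul, mul_pow, enorm_exp_mul_I_sub_one_sq,
    neg_mul, Real.cos_neg]

/-- The preimage is the Fourier transform of `χ` after undoing the dilation and the constant in
`invFourierFun`. Surjectivity is what allows a weak derivative to be defined by prescribing its
transform. -/
theorem invFourier_surjective : Function.Surjective invFourier := by
  intro χ
  have hpi : (2 * Real.pi) ≠ 0 := by positivity
  have hc : ((1 / √(2 * Real.pi) : ℝ) : ℂ) ≠ 0 := by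
    rw [Complex.ofReal_ne_zero]; positivity
  have hχ : MemLp (fun t => ((1 / √(2 * Real.pi) : ℝ) : ℂ)⁻¹ * χ (2 * Real.pi * t)) 2 volume := by
    refine MemLp.const_mul ?_ _
    have hm : MemLp χ 2 (Measure.map (fun t : ℝ => 2 * Real.pi * t) volume) := by
      rw [Real.map_volume_mul_left hpi]
      exact (memLp_volume χ).smul_measure ENNReal.ofReal_ne_top
    exact hm.comp_of_map (by fun_prop)
  set Φ : Lp ℂ 2 (volume : Measure ℝ) := 𝓕 (hχ.toLp _) with hΦ
  set φ : L2R := (memLp_haarR_iff.2 (Lp.memLp Φ)).toLp _ with hφ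
  refine ⟨φ, ?_⟩
  have h1 : (memLp_volume φ).toLp φ = Φ := by
    refine Lp.ext ?_
    filter_upwards [(memLp_volume φ).coeFn_toLp,
      ae_haarR_iff.1 ((memLp_haarR_iff.2 (Lp.memLp Φ)).coeFn_toLp)] with x h1 h2
    rw [h1, hφ, h2]
  refine Lp.ext ?_
  filter_upwards [invFourier_coeFn φ, ae_scale hχ.coeFn_toLp] with x h2 h3
  rw [h2, invFourierFun, h1, hΦ, FourierTransform.fourierInv_fourier_eq, h3,
    mul_inv_cancel_left₀ hpi, mul_inv_cancel_left₀ hc]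

theorem invFourierInt_deriv {η : ℝ → ℂ} (h1 : ContDiff ℝ ∞ η) (h2 : HasCompactSupport η) (x : ℝ) :
    invFourierInt (deriv η) x = -(Complex.I * x) * invFourierInt η x := by
  have hd : Differentiable ℝ η := h1.differentiable (by simp)
  have hc' : Continuous (deriv η) := h1.continuous_deriv (by simp)
  have he : ∀ y : ℝ, HasDerivAt (fun y : ℝ => Complex.exp ((x * y : ℝ) * Complex.I))
      (Complex.I * x * Complex.exp ((x * y : ℝ) * Complex.I)) y := by
    intro y
    have h : HasDerivAt (fun y : ℝ => ((x * y : ℝ) : ℂ) * Complex.I) ((x : ℂ) * Complex.I) y := by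
      have := ((hasDerivAt_id y).const_mul x).ofReal_comp.mul_const Complex.I
      simpa using this
    convert h.cexp using 1
    ring
  have hce : Continuous (fun y : ℝ => Complex.exp ((x * y : ℝ) * Complex.I)) := by fun_prop
  have hibp := integral_mul_deriv_eq_deriv_mul_of_integrable (fun y _ => he y)
    (fun y _ => (hd y).hasDerivAt)
    ((hce.mul hc').integrable_of_hasCompactSupport h2.deriv.mul_left)
    (((continuous_const.mul hce).mul h1.continuous).integrable_of_hasCompactSupport h2.mul_left)
    ((hce.mul h1.continuous).integrable_of_hasCompactSupport h2.mul_left)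
  rw [invFourierInt, invFourierInt, hibp]
  simp_rw [mul_assoc, integral_const_mul]
  ring

theorem enorm_invFourier (φ : L2R) : ‖invFourier φ‖ₑ = ‖φ‖ₑ := by
  rw [← ofReal_norm, invFourier.norm_map, ofReal_norm]

/-- If the position variable is square integrable in the dual space, then `φ` has a weak
derivative in `L²`. -/
theorem exists_isWeakDeriv {φ : L2R} (htop : secondMoment (invFourier φ) ≠ ⊤) :
    ∃ ψ, IsWeakDeriv φ ψ ∧ ‖ψ‖ₑ ^ 2 = secondMoment (invFourier φ) := by
  have hsq : ∀ x, ‖-(Complex.I * x) * invFourier φ x‖ₑ ^ 2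
      = ENNReal.ofReal (x ^ 2) * ‖invFourier φ x‖ₑ ^ 2 := by
    intro x
    rw [enorm_mul, mul_pow, enorm_neg, enorm_mul, ← ofReal_norm (x : ℂ), Complex.norm_real,
      ← ofReal_norm Complex.I, Complex.norm_I, ENNReal.ofReal_one, one_mul,
      ← ENNReal.ofReal_pow (norm_nonneg _), Real.norm_eq_abs, sq_abs]
  have hm : MemLp (fun x : ℝ => -(Complex.I * x) * invFourier φ x) 2 haarR := by
    refine ⟨?_, ?_⟩
    · exact (Continuous.aestronglyMeasurable (by fun_prop)).mul (Lp.aestronglyMeasurable _)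
    · rw [eLpNorm_lt_top_iff_lintegral_rpow_enorm_lt_top (by norm_num) (by norm_num)]
      simp only [ENNReal.toReal_ofNat, ENNReal.rpow_ofNat]
      simp_rw [hsq]
      exact lt_of_le_of_ne le_top htop
  -- The candidate for the derivative is the function with transform −ix · F⁻¹[φ].
  obtain ⟨ψ, hψ⟩ := invFourier_surjective (hm.toLp _)
  have hψc : invFourier ψ =ᵐ[haarR] fun x : ℝ => -(Complex.I * x) * invFourier φ x := by
    rw [hψ]; exact hm.coeFn_toLp
  have hnorm : ‖ψ‖ₑ ^ 2 = secondMoment (invFourier φ) := by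
    rw [← enorm_invFourier, enorm_sq_eq_lintegral, secondMoment]
    refine lintegral_congr_ae ?_
    filter_upwards [hψc] with x hx
    rw [hx, hsq]
  refine ⟨ψ, fun η hη hηc => ?_, hnorm⟩
  have h1 : ContDiff ℝ ∞ (fun x => (η x : ℂ)) := Complex.ofRealCLM.contDiff.comp hη
  have h2 : HasCompactSupport (fun x => (η x : ℂ)) :=
    hηc.comp_left (g := fun x : ℝ => (x : ℂ)) rfl
  have hdη : ∀ x, deriv (fun x => (η x : ℂ)) x = ((deriv η x : ℝ) : ℂ) := fun x =>
    ((hη.differentiable (by simp) x).hasDerivAt.ofReal_comp).deriv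
  have hi1 : Integrable (fun x => (η x : ℂ)) := h1.continuous.integrable_of_hasCompactSupport h2
  have hi2 : Integrable (deriv fun x => (η x : ℂ)) :=
    (h1.continuous_deriv (by simp)).integrable_of_hasCompactSupport h2.deriv
  have m1 : MemLp (fun x => (η x : ℂ)) 2 haarR :=
    memLp_haarR_iff.2 (h1.continuous.memLp_of_hasCompactSupport h2)
  have m2 : MemLp (deriv fun x => (η x : ℂ)) 2 haarR :=
    memLp_haarR_iff.2 ((h1.continuous_deriv (by simp)).memLp_of_hasCompactSupport h2.deriv)
  have f1 : invFourier (m1.toLp _) =ᵐ[haarR] invFourierInt (fun x => (η x : ℂ)) := by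
    have e := ae_haarR_iff.1 m1.coeFn_toLp
    rw [← invFourierInt_congr_ae e]
    exact invFourier_ae_eq_invFourierInt _ ((integrable_congr e).2 hi1)
  have f2 : invFourier (m2.toLp _) =ᵐ[haarR] invFourierInt (deriv fun x => (η x : ℂ)) := by
    have e := ae_haarR_iff.1 m2.coeFn_toLp
    rw [← invFourierInt_congr_ae e]
    exact invFourier_ae_eq_invFourierInt _ ((integrable_congr e).2 hi2)
  -- By Plancherel the defining identity of a weak derivative becomes a pointwise identity of
  -- transforms. As the test function is real, the conjugation in the inner product does no harm.
  have key : ⟪m2.toLp _, φ⟫_ℂ = -⟪m1.toLp _, ψ⟫_ℂ := by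
    rw [← invFourier.inner_map_map, ← invFourier.inner_map_map _ ψ, L2.inner_def, L2.inner_def,
      ← integral_neg]
    refine integral_congr_ae ?_
    filter_upwards [f1, f2, hψc] with x e1 e2 e3
    rw [e1, e2, e3, invFourierInt_deriv h1 h2]
    simp only [RCLike.inner_apply, map_mul, map_neg, Complex.conj_I, Complex.conj_ofReal]
    ring
  rw [L2.inner_def, L2.inner_def, ← integral_neg, integral_haarR, integral_haarR] at key
  have key := smul_right_injective ℂ (r := 1 / √(2 * Real.pi)) (by positivity) key
  rw [integral_neg] at key
  refine Eq.trans (integral_congr_ae ?_) (key.trans (congrArg _ (integral_congr_ae ?_)))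
  · filter_upwards [ae_haarR_iff.1 m2.coeFn_toLp] with x hx
    rw [hx, hdη]
    simp [mul_comm]
  · filter_upwards [ae_haarR_iff.1 m1.coeFn_toLp] with x hx
    rw [hx]
    simp [mul_comm]

/-! ## Weak derivatives -/

theorem exists_pos_forall_le_abs_notMem_tsupport {g : ℝ → ℝ} (hg : HasCompactSupport g) :
    ∃ R : ℝ, 0 < R ∧ ∀ x, R ≤ |x| → x ∉ tsupport g := by
  obtain ⟨R, hR⟩ := hg.isCompact.isBounded.subset_closedBall 0
  refine ⟨max R 0 + 1, by positivity, fun x hx h => ?_⟩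
  have := hR h
  rw [mem_closedBall_zero_iff, Real.norm_eq_abs] at this
  linarith [le_max_left R 0]

theorem integral_eq_of_eq_zero_of_le_abs {w : ℝ → ℝ} {R : ℝ} (hw : ∀ x, R ≤ |x| → w x = 0) :
    ∫ x in (-R)..R, w x = ∫ x, w x := by
  refine intervalIntegral.integral_eq_integral_of_support_subset fun x hx => ?_
  by_contra hxR
  refine hx (hw x ?_)
  rw [mem_Ioc, not_and_or, not_lt, not_le] at hxR
  rw [le_abs]
  rcases hxR with h | h
  · right; linarith
  · left; exact h.le

/-- The primitive starting left of the support vanishes to the right of it exactly because the total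
integral is zero. -/
theorem exists_contDiff_hasCompactSupport_deriv_eq {g : ℝ → ℝ} (hg : ContDiff ℝ ∞ g)
    (hgc : HasCompactSupport g) (h0 : ∫ x, g x = 0) :
    ∃ θ : ℝ → ℝ, ContDiff ℝ ∞ θ ∧ HasCompactSupport θ ∧ deriv θ = g := by
  obtain ⟨R, hR0, hR'⟩ := exists_pos_forall_le_abs_notMem_tsupport hgc
  have hR : ∀ x, R ≤ |x| → g x = 0 := fun x hx => image_eq_zero_of_notMem_tsupport (hR' x hx)
  have hgi : ∀ a b, IntervalIntegrable g volume a b := fun a b => hg.continuous.intervalIntegrable a b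
  have hd : ∀ x, HasDerivAt (fun x => ∫ t in (-R)..x, g t) (g x) x := fun x =>
    intervalIntegral.integral_hasDerivAt_right (hgi _ _)
      hg.continuous.stronglyMeasurable.stronglyMeasurableAtFilter hg.continuous.continuousAt
  have hde : deriv (fun x => ∫ t in (-R)..x, g t) = g := funext fun x => (hd x).deriv
  refine ⟨fun x => ∫ t in (-R)..x, g t, ?_, ?_, hde⟩
  · rw [contDiff_infty_iff_deriv, hde]
    exact ⟨fun x => (hd x).differentiableAt, hg⟩
  · refine HasCompactSupport.of_support_subset_isCompact (isCompact_Icc (a := -R) (b := R)) ?_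
    intro x hx
    by_contra hxR
    apply hx
    rw [mem_Icc, not_and_or, not_le, not_le] at hxR
    rcases hxR with h | h
    · change ∫ t in (-R)..x, g t = 0
      rw [intervalIntegral.integral_symm, neg_eq_zero]
      refine intervalIntegral.integral_zero_ae (Filter.Eventually.of_forall fun t ht => ?_)
      rw [uIoc_of_le h.le] at ht
      exact hR t (le_abs.2 (Or.inr (by linarith [ht.2])))
    · change ∫ t in (-R)..x, g t = 0
      rw [← intervalIntegral.integral_add_adjacent_intervals (hgi (-R) R) (hgi R x),
        integral_eq_of_eq_zero_of_le_abs hR, h0, zero_add]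
      refine intervalIntegral.integral_zero_ae (Filter.Eventually.of_forall fun t ht => ?_)
      rw [uIoc_of_le h.le] at ht
      exact hR t (le_abs.2 (Or.inl ht.1.le))

/-- A function whose weak derivative vanishes is constant. -/
theorem exists_ae_eq_const_of_integral_deriv_smul_eq_zero {f : ℝ → ℂ}
    (hf : LocallyIntegrable f)
    (h : ∀ η : ℝ → ℝ, ContDiff ℝ ∞ η → HasCompactSupport η → ∫ x, deriv η x • f x = 0) :
    ∃ c : ℂ, f =ᵐ[volume] fun _ => c := by
  obtain ⟨χ, hχ, hχc, hχ1⟩ : ∃ χ : ℝ → ℝ, ContDiff ℝ ∞ χ ∧ HasCompactSupport χ ∧ ∫ x, χ x = 1 := by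
    let b : ContDiffBump (0 : ℝ) := ⟨1, 2, by norm_num, by norm_num⟩
    exact ⟨b.normed volume, b.contDiff_normed, b.hasCompactSupport_normed, b.integral_normed⟩
  refine ⟨∫ x, χ x • f x, ae_eq_of_integral_contDiff_smul_eq hf (locallyIntegrable_const _)
    fun η hη hηc => ?_⟩
  have hi : ∀ {ξ : ℝ → ℝ}, ContDiff ℝ ∞ ξ → HasCompactSupport ξ → Integrable ξ :=
    fun h1 h2 => h1.continuous.integrable_of_hasCompactSupport h2
  have hif : ∀ {ξ : ℝ → ℝ}, ContDiff ℝ ∞ ξ → HasCompactSupport ξ → Integrable fun x => ξ x • f x :=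
    fun h1 h2 => hf.integrable_smul_left_of_hasCompactSupport h1.continuous h2
  -- Subtracting (∫ η) χ leaves a test function of mean zero, hence a derivative of a test function,
  -- on which `f` vanishes. So `f` acts on η as the constant ∫ χ f.
  have hg : ContDiff ℝ ∞ (fun x => η x - (∫ y, η y) * χ x) := hη.sub (contDiff_const.mul hχ)
  have hgc : HasCompactSupport (fun x => η x - (∫ y, η y) * χ x) :=
    hηc.sub (hχc.mul_left (f := fun _ => ∫ y, η y))
  obtain ⟨θ, h1, h2, h3⟩ := exists_contDiff_hasCompactSupport_deriv_eq hg hgc (by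
    rw [integral_sub (hi hη hηc) ((hi hχ hχc).const_mul _), integral_const_mul, hχ1, mul_one,
      sub_self])
  have h4 := h θ h1 h2
  rw [h3] at h4
  simp_rw [sub_smul, mul_smul] at h4
  have hi2 : Integrable fun x => (∫ y, η y) • χ x • f x := (hif hχ hχc).smul (∫ y, η y)
  rw [integral_sub (hif hη hηc) hi2, integral_smul, sub_eq_zero] at h4
  rw [h4, integral_smul_const]

/-- Integration by parts for absolutely continuous functions on an interval [−R, R] around the
support of `η`, where the boundary terms vanish. It is stated for real `v`; complex functions are
handled through real and imaginary parts. -/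
theorem integral_deriv_mul_primitive {v : ℝ → ℝ} (hv : LocallyIntegrable v) {η : ℝ → ℝ}
    (hη : ContDiff ℝ ∞ η) (hηc : HasCompactSupport η) :
    ∫ x, deriv η x * ∫ t in (0 : ℝ)..x, v t = -∫ x, η x * v x := by
  obtain ⟨R, hR0, hR⟩ := exists_pos_forall_le_abs_notMem_tsupport hηc
  have hvi : ∀ a b, IntervalIntegrable v volume a b := fun a b =>
    intervalIntegrable_iff.2 ((hv.integrableOn_isCompact isCompact_uIcc).mono_set uIoc_subset_uIcc)
  have hac : AbsolutelyContinuousOnInterval (fun x => ∫ t in (0 : ℝ)..x, v t) (-R) R :=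
    (hvi (-R) R).absolutelyContinuousOnInterval_intervalIntegral
      (by rw [uIcc_of_le (by linarith)]; constructor <;> linarith)
  have hηac : AbsolutelyContinuousOnInterval η (-R) R :=
    (hη.of_le (by simp)).contDiffOn.absolutelyContinuousOnInterval
  have h := hac.integral_mul_deriv_eq_deriv_mul hηac
  have z1 : η R = 0 := image_eq_zero_of_notMem_tsupport (hR R (le_abs_self R))
  have z2 : η (-R) = 0 := image_eq_zero_of_notMem_tsupport (hR (-R) (by rw [abs_neg]; exact le_abs_self R))
  rw [z1, z2, mul_zero, mul_zero, sub_zero, zero_sub] at h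
  have hsub : ∀ {w : ℝ → ℝ}, (∀ x, x ∉ tsupport η → w x = 0) → ∫ x in (-R)..R, w x = ∫ x, w x :=
    fun hw => integral_eq_of_eq_zero_of_le_abs fun x hx => hw x (hR x hx)
  have e1 : ∫ x in (-R)..R, (∫ t in (0 : ℝ)..x, v t) * deriv η x
      = ∫ x, deriv η x * ∫ t in (0 : ℝ)..x, v t := by
    rw [hsub fun x hx => by
      rw [image_eq_zero_of_notMem_tsupport (f := deriv η) fun h => hx (tsupport_deriv_subset h),
        mul_zero]]
    simp_rw [mul_comm]
  have e2 : ∫ x in (-R)..R, deriv (fun x => ∫ t in (0 : ℝ)..x, v t) x * η x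
      = ∫ x, η x * v x := by
    rw [← hsub fun x hx => by rw [image_eq_zero_of_notMem_tsupport hx, zero_mul]]
    refine intervalIntegral.integral_congr_ae ?_
    filter_upwards [(hvi (-R) R).ae_hasDerivAt_integral] with x hx hxR
    rw [(hx (uIoc_subset_uIcc hxR) 0 (by
      rw [uIcc_of_le (by linarith)]; constructor <;> linarith)).deriv, mul_comm]
  rw [← e1, ← e2, h]

theorem locallyIntegrable_L2R (φ : L2R) : LocallyIntegrable φ :=
  (memLp_haarR_iff.1 (Lp.memLp φ)).locallyIntegrable (by norm_num)

theorem intervalIntegrable_L2R (φ : L2R) (a b : ℝ) : IntervalIntegrable φ volume a b :=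
  intervalIntegrable_iff.2 (((locallyIntegrable_L2R φ).integrableOn_isCompact isCompact_uIcc).mono_set
    uIoc_subset_uIcc)

theorem re_intervalIntegral {f : ℝ → ℂ} {a b : ℝ} (hf : IntervalIntegrable f volume a b) :
    (∫ t in a..b, f t).re = ∫ t in a..b, (f t).re :=
  (Complex.reCLM.intervalIntegral_comp_comm hf).symm

theorem im_intervalIntegral {f : ℝ → ℂ} {a b : ℝ} (hf : IntervalIntegrable f volume a b) :
    (∫ t in a..b, f t).im = ∫ t in a..b, (f t).im :=
  (Complex.imCLM.intervalIntegral_comp_comm hf).symm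

theorem continuous_primitive_L2R (ψ : L2R) : Continuous fun x : ℝ => ∫ t in (0 : ℝ)..x, ψ t :=
  intervalIntegral.continuous_primitive (intervalIntegrable_L2R ψ) 0

/-- A function with a weak derivative is a primitive of it. -/
theorem IsWeakDeriv.exists_ae_eq_primitive {φ ψ : L2R} (h : IsWeakDeriv φ ψ) :
    ∃ c : ℂ, φ =ᵐ[volume] fun x => c + ∫ t in (0 : ℝ)..x, ψ t := by
  have hψ := locallyIntegrable_L2R ψ
  have hU := continuous_primitive_L2R ψ
  -- The difference between `φ` and the primitive of `ψ` has vanishing weak derivative.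
  obtain ⟨c, hc⟩ := exists_ae_eq_const_of_integral_deriv_smul_eq_zero
    ((locallyIntegrable_L2R φ).sub hU.locallyIntegrable) (fun η hη hηc => by
      have hd : Continuous (deriv η) := hη.continuous_deriv (by simp)
      have i1 : Integrable fun x => deriv η x • φ x :=
        (locallyIntegrable_L2R φ).integrable_smul_left_of_hasCompactSupport hd hηc.deriv
      have i2 : Integrable fun x => deriv η x • ∫ t in (0 : ℝ)..x, ψ t :=
        hU.locallyIntegrable.integrable_smul_left_of_hasCompactSupport hd hηc.deriv
      have i3 : Integrable fun x => η x • ψ x :=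
        hψ.integrable_smul_left_of_hasCompactSupport hη.continuous hηc
      simp_rw [Pi.sub_apply, smul_sub]
      rw [integral_sub i1 i2, sub_eq_zero]
      have h' := h η hη hηc
      simp_rw [← Complex.real_smul] at h'
      rw [h']
      apply Complex.ext
      · have r1 := Complex.reCLM.integral_comp_comm i2
        have r2 := Complex.reCLM.integral_comp_comm i3
        have hv : LocallyIntegrable fun x => (ψ x).re := fun x =>
          let ⟨s, hs, h⟩ := hψ x; ⟨s, hs, Complex.reCLM.integrable_comp h⟩
        have := integral_deriv_mul_primitive hv hη hηc
        simp only [Complex.reCLM_apply, Complex.real_smul, Complex.re_ofReal_mul] at r1 r2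
        simp only [Complex.real_smul]
        rw [Complex.neg_re, ← r1, ← r2, ← this]
        simp_rw [re_intervalIntegral (intervalIntegrable_L2R ψ _ _)]
      · have r1 := Complex.imCLM.integral_comp_comm i2
        have r2 := Complex.imCLM.integral_comp_comm i3
        have hv : LocallyIntegrable fun x => (ψ x).im := fun x =>
          let ⟨s, hs, h⟩ := hψ x; ⟨s, hs, Complex.imCLM.integrable_comp h⟩
        have := integral_deriv_mul_primitive hv hη hηc
        simp only [Complex.imCLM_apply, Complex.real_smul, Complex.im_ofReal_mul] at r1 r2
        simp only [Complex.real_smul]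
        rw [Complex.neg_im, ← r1, ← r2, ← this]
        simp_rw [im_intervalIntegral (intervalIntegrable_L2R ψ _ _)])
  refine ⟨c, ?_⟩
  filter_upwards [hc] with x hx
  rw [← hx, Pi.sub_apply, sub_add_cancel]

/-- Cauchy-Schwarz against the constant 1 on an interval of length `s`. The integral is moved to the
fixed interval (0, s] so that Tonelli applies afterwards. -/
theorem intervalIntegral_enorm_sq_le (ψ : L2R) {s : ℝ} (hs : 0 < s) (x : ℝ) :
    ‖∫ t in x..(x + s), ψ t‖ₑ ^ 2 ≤ ENNReal.ofReal s * ∫⁻ t in Ioc 0 s, ‖ψ (x + t)‖ₑ ^ 2 := by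
  have h1 : ‖∫ t in x..(x + s), ψ t‖ₑ ≤ ∫⁻ t in Ioc 0 s, ‖ψ (x + t)‖ₑ := by
    have e : ∫ t in x..(x + s), ψ t = ∫ t in (0 : ℝ)..s, ψ (x + t) := by
      rw [intervalIntegral.integral_comp_add_left (fun t => ψ t) x, add_zero]
    rw [e, intervalIntegral.integral_of_le hs.le]
    exact enorm_integral_le_lintegral_enorm _
  have hm : Measurable fun t => ‖ψ (x + t)‖ₑ :=
    ((Lp.stronglyMeasurable ψ).measurable.comp (measurable_const_add x)).enorm
  have h2 := ENNReal.lintegral_mul_le_Lp_mul_Lq (volume.restrict (Ioc 0 s))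
    (Real.HolderConjugate.two_two) (f := fun _ => 1) (g := fun t => ‖ψ (x + t)‖ₑ)
    aemeasurable_const hm.aemeasurable
  simp only [Pi.mul_apply, one_mul, lintegral_const, MeasurableSet.univ,
    Measure.restrict_apply, univ_inter, Real.volume_Ioc, sub_zero, one_div, ENNReal.rpow_ofNat] at h2
  calc _ ≤ _ := pow_le_pow_left₀ (zero_le) (h1.trans h2) 2
    _ = _ := by
      have hr : ∀ a : ℝ≥0∞, (a ^ (2⁻¹ : ℝ)) ^ 2 = a := fun a => by
        rw [← ENNReal.rpow_natCast, ← ENNReal.rpow_mul]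
        norm_num
      rw [mul_pow, hr, hr, one_pow, one_mul]

/-- The difference quotients are bounded by the norm of the weak derivative. -/
theorem IsWeakDeriv.lintegral_enorm_comp_add_sub_le {φ ψ : L2R} (h : IsWeakDeriv φ ψ) {s : ℝ}
    (hs : 0 < s) :
    ∫⁻ x, ‖φ (x + s) - φ x‖ₑ ^ 2 ∂haarR ≤ ENNReal.ofReal (s ^ 2) * ‖ψ‖ₑ ^ 2 := by
  obtain ⟨c, hc⟩ := h.exists_ae_eq_primitive
  have hc' := (measurePreserving_add_right volume s).quasiMeasurePreserving.ae hc
  have hm : Measurable fun x : ℝ => ‖ψ x‖ₑ := (Lp.stronglyMeasurable ψ).measurable.enorm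
  calc ∫⁻ x, ‖φ (x + s) - φ x‖ₑ ^ 2 ∂haarR
      ≤ ∫⁻ x, ENNReal.ofReal s * (∫⁻ t in Ioc 0 s, ‖ψ (x + t)‖ₑ ^ 2) ∂haarR := by
        refine lintegral_mono_ae (ae_haarR_iff.2 ?_)
        filter_upwards [hc, hc'] with x h1 h2
        rw [h1, h2, add_sub_add_left_eq_sub, intervalIntegral.integral_interval_sub_left
          (intervalIntegrable_L2R ψ _ _) (intervalIntegrable_L2R ψ _ _)]
        exact intervalIntegral_enorm_sq_le ψ hs x
    -- Tonelli; afterwards translation invariance makes the inner integral independent of `t`, and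
    -- the second factor `s` is the length of the interval.
    _ = ENNReal.ofReal s * ∫⁻ t in Ioc 0 s, (∫⁻ x, ‖ψ (x + t)‖ₑ ^ 2 ∂haarR) := by
        have : SFinite haarR := by rw [haarR]; infer_instance
        have hm2 : Measurable (Function.uncurry fun x t : ℝ => ‖ψ (x + t)‖ₑ ^ 2) :=
          (hm.comp measurable_add).pow_const 2
        rw [← lintegral_lintegral_swap hm2.aemeasurable]
        exact lintegral_const_mul _ hm2.lintegral_prod_right'
    _ = ENNReal.ofReal s * ∫⁻ t in Ioc 0 s, ‖ψ‖ₑ ^ 2 := by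
        congr 1
        refine lintegral_congr fun t => ?_
        rw [enorm_sq_eq_lintegral]
        exact (measurePreserving_add_haarR t).lintegral_comp (hm.pow_const 2)
    _ = _ := by
        rw [lintegral_const, Measure.restrict_apply MeasurableSet.univ, univ_inter, Real.volume_Ioc,
          sub_zero, sq s, ENNReal.ofReal_mul hs.le]
        ring

/-- The second moment of a measure is controlled by its Fourier transform near the origin. -/
theorem lintegral_sq_le_of_lintegral_cos_le (ν : Measure ℝ) (D : ℝ≥0∞)
    (h : ∀ s : ℝ, 0 < s → ∫⁻ x, ENNReal.ofReal (2 * (1 - Real.cos (s * x))) ∂ν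
      ≤ ENNReal.ofReal (s ^ 2) * D) :
    ∫⁻ x, ENNReal.ofReal (x ^ 2) ∂ν ≤ D := by
  set s : ℕ → ℝ := fun n => 1 / ((n : ℝ) + 1) with hs
  have hs0 : ∀ n, 0 < s n := fun n => by positivity
  have hslim : Filter.Tendsto s Filter.atTop (nhdsWithin 0 {0}ᶜ) :=
    tendsto_nhdsWithin_iff.2 ⟨tendsto_one_div_add_atTop_nhds_zero_nat,
      Filter.Eventually.of_forall fun n => (hs0 n).ne'⟩
  have hcos : ∀ r x : ℝ, 2 * (1 - Real.cos (r * x)) = (2 * Real.sin (r * x / 2)) ^ 2 := by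
    intro r x
    have h1 := Real.cos_sq (r * x / 2)
    have h2 := Real.sin_sq_add_cos_sq (r * x / 2)
    rw [mul_div_cancel₀ _ (two_ne_zero)] at h1
    nlinarith
  -- After the half-angle formula the integrand divided by s² is the square of a difference quotient
  -- at 0 of r ↦ 2 sin(rx/2), whose derivative there is x. The claim then follows by Fatou's lemma.
  have hlim : ∀ x : ℝ, Filter.Tendsto
      (fun n => ENNReal.ofReal (((s n)⁻¹ * (2 * Real.sin (s n * x / 2))) ^ 2)) Filter.atTop
      (nhds (ENNReal.ofReal (x ^ 2))) := by
    intro x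
    have hd : HasDerivAt (fun r : ℝ => 2 * Real.sin (r * x / 2)) x 0 := by
      have h1 : HasDerivAt (fun r : ℝ => r * x / 2) (x / 2) 0 := by
        simpa using ((hasDerivAt_id (0 : ℝ)).mul_const x).div_const 2
      convert! (h1.sin).const_mul 2 using 1
      simp
      ring
    have := (hd.tendsto_slope_zero).comp hslim
    refine (ENNReal.continuous_ofReal.tendsto _).comp ?_
    refine Filter.Tendsto.pow ?_ 2
    simpa [Function.comp_def] using this
  calc ∫⁻ x, ENNReal.ofReal (x ^ 2) ∂ν
      = ∫⁻ x, Filter.liminf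
        (fun n => ENNReal.ofReal (((s n)⁻¹ * (2 * Real.sin (s n * x / 2))) ^ 2)) Filter.atTop ∂ν :=
        lintegral_congr fun x => (hlim x).liminf_eq.symm
    _ ≤ Filter.liminf (fun n => ∫⁻ x, ENNReal.ofReal (((s n)⁻¹ * (2 * Real.sin (s n * x / 2))) ^ 2)
        ∂ν) Filter.atTop := lintegral_liminf_le fun n => by fun_prop
    _ ≤ D := by
        refine Filter.liminf_le_of_le (by isBoundedDefault) fun b hb => ?_
        obtain ⟨n, hn⟩ := hb.exists
        refine hn.trans ?_
        simp_rw [mul_pow (s n)⁻¹, ← hcos]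
        simp_rw [ENNReal.ofReal_mul (sq_nonneg (s n)⁻¹)]
        rw [lintegral_const_mul _ (by fun_prop)]
        refine (mul_le_mul_right (h (s n) (hs0 n)) _).trans ?_
        rw [← mul_assoc, ← ENNReal.ofReal_mul (sq_nonneg _), ← mul_pow, inv_mul_cancel₀ (hs0 n).ne',
          one_pow, ENNReal.ofReal_one, one_mul]

/-! ### The momentum form as a second moment in the dual space -/

theorem secondMoment_eq_lintegral_withDensity (φ : L2R) :
    secondMoment φ = ∫⁻ x, ENNReal.ofReal (x ^ 2) ∂(haarR.withDensity fun x => ‖φ x‖ₑ ^ 2) := by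
  rw [lintegral_withDensity_eq_lintegral_mul _
    ((Lp.stronglyMeasurable φ).measurable.enorm.pow_const 2) (by fun_prop), secondMoment]
  simp_rw [Pi.mul_apply, mul_comm]

/-- `⟨φ|P²|φ⟩` is the second moment of the Fourier transform. -/
theorem momentumForm_eq_secondMoment (φ : L2R) :
    momentumForm φ = secondMoment (invFourier φ) := by
  refine le_antisymm ?_ (le_iInf₂ fun ψ hψ => ?_)
  · by_cases htop : secondMoment (invFourier φ) = ⊤
    · rw [htop]; exact le_top
    · obtain ⟨ψ, hψ, hn⟩ := exists_isWeakDeriv htop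
      rw [← hn]
      exact iInf₂_le ψ hψ
  -- For an arbitrary weak derivative ψ the difference quotients of φ are bounded by ‖ψ‖; on the
  -- dual side their squared norms are the integrals of 2(1 − cos sx), which control the second
  -- moment.
  rw [secondMoment_eq_lintegral_withDensity]
  refine lintegral_sq_le_of_lintegral_cos_le _ _ fun s hs => ?_
  rw [lintegral_withDensity_eq_lintegral_mul _
    ((Lp.stronglyMeasurable _).measurable.enorm.pow_const 2) (by fun_prop)]
  refine le_trans (le_of_eq ?_) (hψ.lintegral_enorm_comp_add_sub_le hs)
  rw [lintegral_enorm_comp_add_sub]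
  simp_rw [Pi.mul_apply, mul_comm]

/-- The infimum defining the form is attained by the derivative built from the transform, so
estimates for a single weak derivative pass to the form without uniqueness of weak derivatives. -/
theorem exists_isWeakDeriv_enorm_sq_eq {φ : L2R} (h : momentumForm φ ≠ ⊤) :
    ∃ ψ, IsWeakDeriv φ ψ ∧ ‖ψ‖ₑ ^ 2 = momentumForm φ := by
  rw [momentumForm_eq_secondMoment] at h ⊢
  exact exists_isWeakDeriv h

/-! ## The uncertainty relation on the half line -/

section HalfLine

variable {a : ℝ} {v u : ℝ → ℝ}

theorem absolutelyContinuousOnInterval_primitive (hv : ∀ x y, IntervalIntegrable v volume x y)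
    (hu : ∀ x, u x = ∫ t in (0 : ℝ)..x, v t) {x y : ℝ} (hx : 0 < x) (hxy : x ≤ y) :
    AbsolutelyContinuousOnInterval u x y := by
  have h : AbsolutelyContinuousOnInterval (fun x => ∫ t in (0 : ℝ)..x, v t) 0 y :=
    (hv 0 y).absolutelyContinuousOnInterval_intervalIntegral left_mem_uIcc
  rw [← funext hu] at h
  refine h.mono ?_
  rw [uIcc_of_le hxy, uIcc_of_le (hx.le.trans hxy)]
  exact Icc_subset_Icc hx.le le_rfl

theorem ae_hasDerivAt_primitive (hv : ∀ x y, IntervalIntegrable v volume x y)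
    (hu : ∀ x, u x = ∫ t in (0 : ℝ)..x, v t) {x y : ℝ} (hx : 0 < x) (hxy : x ≤ y) :
    ∀ᵐ z, z ∈ uIcc x y → HasDerivAt u (v z) z := by
  filter_upwards [(hv 0 y).ae_hasDerivAt_integral] with z hz hzxy
  rw [uIcc_of_le hxy] at hzxy
  rw [funext hu]
  refine hz ?_ 0 left_mem_uIcc
  rw [uIcc_of_le (hx.le.trans hxy)]
  exact ⟨hx.le.trans hzxy.1, hzxy.2⟩

/-- Completing the square with w(t) = at − 1/t. The cross term is 2wuv = (wu²)' − w'u², and w² − w'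
= a²t² − 3a because the terms 1/t² cancel. This w is minus the logarithmic derivative of t
e^{−at²/2}, the expected extremal. The singularity of w is the reason for staying at positive `x`.
-/
theorem intervalIntegral_sq_add_mul (a : ℝ) (hv : ∀ x y, IntervalIntegrable v volume x y)
    (hv2 : Integrable fun x => v x ^ 2) (hu : ∀ x, u x = ∫ t in (0 : ℝ)..x, v t)
    {x y : ℝ} (hx : 0 < x) (hxy : x ≤ y) :
    ∫ t in x..y, (v t + (a * t - 1 / t) * u t) ^ 2
      = (∫ t in x..y, (v t ^ 2 + a ^ 2 * (t ^ 2 * u t ^ 2) - 3 * a * u t ^ 2))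
        + (a * y - 1 / y) * u y ^ 2 - (a * x - 1 / x) * u x ^ 2 := by
  have hne : ∀ t ∈ uIcc x y, t ≠ 0 := fun t ht => by
    rw [uIcc_of_le hxy] at ht
    exact (hx.trans_le ht.1).ne'
  have huac := absolutelyContinuousOnInterval_primitive hv hu hx hxy
  have hw : ContDiffOn ℝ 1 (fun t : ℝ => a * t - 1 / t) (uIcc x y) :=
    (contDiffOn_const.mul contDiffOn_id).sub (contDiffOn_const.div contDiffOn_id hne)
  have hwac := hw.absolutelyContinuousOnInterval
  have hprod := ((hwac.fun_mul (huac.fun_mul huac))).integral_deriv_eq_sub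
  have huc : ContinuousOn u (uIcc x y) := huac.continuousOn
  have hic : ContinuousOn (fun t : ℝ => 1 / t) (uIcc x y) := continuousOn_const.div continuousOn_id hne
  have i1 : IntervalIntegrable (fun t => v t ^ 2 + a ^ 2 * (t ^ 2 * u t ^ 2) - 3 * a * u t ^ 2)
      volume x y := by
    refine (hv2.intervalIntegrable.add (ContinuousOn.intervalIntegrable ?_)).sub
      (ContinuousOn.intervalIntegrable ?_)
    · fun_prop
    · fun_prop
  have i2 : IntervalIntegrable (fun t => v t * (2 * (a * t - 1 / t) * u t)
      + (a + 1 / t ^ 2) * u t ^ 2) volume x y := by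
    refine ((hv x y).mul_continuousOn ?_).add (ContinuousOn.intervalIntegrable ?_)
    · exact (continuousOn_const.mul hw.continuousOn).mul huc
    · refine (continuousOn_const.add ?_).mul (huc.pow 2)
      exact continuousOn_const.div (continuousOn_id.pow 2) fun t ht => pow_ne_zero 2 (hne t ht)
  have e2 : ∫ t in x..y, (v t * (2 * (a * t - 1 / t) * u t) + (a + 1 / t ^ 2) * u t ^ 2)
      = (a * y - 1 / y) * (u y * u y) - (a * x - 1 / x) * (u x * u x) := by
    rw [← hprod]
    refine intervalIntegral.integral_congr_ae ?_
    filter_upwards [ae_hasDerivAt_primitive hv hu hx hxy] with t ht htxy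
    have htm := uIoc_subset_uIcc htxy
    have h1 := ht htm
    have h2 : HasDerivAt (fun t : ℝ => a * t - 1 / t) (a + 1 / t ^ 2) t := by
      have := ((hasDerivAt_id t).const_mul a).fun_sub (hasDerivAt_inv (hne t htm))
      simpa [one_div] using this
    rw [(h2.fun_mul (h1.fun_mul h1)).deriv]
    ring
  have e1 : ∫ t in x..y, (v t + (a * t - 1 / t) * u t) ^ 2
      = ∫ t in x..y, ((v t ^ 2 + a ^ 2 * (t ^ 2 * u t ^ 2) - 3 * a * u t ^ 2) +
        (v t * (2 * (a * t - 1 / t) * u t) + (a + 1 / t ^ 2) * u t ^ 2)) := by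
    refine intervalIntegral.integral_congr fun t ht => ?_
    have := hne t ht
    field_simp
    ring
  rw [e1, intervalIntegral.integral_add i1 i2, e2]
  ring

theorem integrableOn_sq_add_mul (a : ℝ) (hv : ∀ x y, IntervalIntegrable v volume x y)
    (hv2 : Integrable fun x => v x ^ 2) (hu : ∀ x, u x = ∫ t in (0 : ℝ)..x, v t)
    {x y : ℝ} (hx : 0 < x) (hxy : x ≤ y) :
    IntegrableOn (fun t => (v t + (a * t - 1 / t) * u t) ^ 2) (Ioc x y) := by
  have hucont : Continuous u := by
    rw [funext hu]; exact intervalIntegral.continuous_primitive hv 0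
  have e1 : ∀ t, (v t + (a * t - 1 / t) * u t) ^ 2
      = v t ^ 2 + v t * (2 * (a * t - 1 / t) * u t) + ((a * t - 1 / t) * u t) ^ 2 :=
    fun t => by ring
  simp_rw [e1]
  have hne : ∀ t ∈ uIcc x y, t ≠ 0 := fun t ht => by
    rw [uIcc_of_le hxy] at ht
    exact (hx.trans_le ht.1).ne'
  have hw : ContinuousOn (fun t : ℝ => a * t - 1 / t) (uIcc x y) :=
    (continuousOn_const.mul continuousOn_id).sub (continuousOn_const.div continuousOn_id hne)
  have : IntervalIntegrable (fun t => v t ^ 2 + v t * (2 * (a * t - 1 / t) * u t)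
      + ((a * t - 1 / t) * u t) ^ 2) volume x y := by
    refine (hv2.intervalIntegrable.add ((hv _ _).mul_continuousOn ?_)).add
      (ContinuousOn.intervalIntegrable ?_)
    · exact (continuousOn_const.mul hw).mul hucont.continuousOn
    · exact (hw.mul hucont.continuousOn).pow 2
  exact (intervalIntegrable_iff_integrableOn_Ioc_of_le hxy).1 this

/-- Cauchy-Schwarz in the form ∫ (v − u(x)/x)² ≥ 0 over (0, x). It makes the boundary term u(ε)²/ε
vanish as ε tends to 0. -/
theorem sq_primitive_le (hv : ∀ x y, IntervalIntegrable v volume x y)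
    (hv2 : Integrable fun x => v x ^ 2) (hu : ∀ x, u x = ∫ t in (0 : ℝ)..x, v t)
    {x : ℝ} (hx : 0 < x) : u x ^ 2 ≤ x * ∫ t in (0 : ℝ)..x, v t ^ 2 := by
  have h : 0 ≤ ∫ t in (0 : ℝ)..x, (v t - u x / x) ^ 2 :=
    intervalIntegral.integral_nonneg hx.le fun t _ => sq_nonneg _
  have e : ∫ t in (0 : ℝ)..x, (v t - u x / x) ^ 2
      = (∫ t in (0 : ℝ)..x, v t ^ 2) - 2 * (u x / x) * u x + (u x / x) ^ 2 * x := by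
    have e1 : ∀ t, (v t - u x / x) ^ 2 = v t ^ 2 - 2 * (u x / x) * v t + (u x / x) ^ 2 :=
      fun t => by ring
    simp_rw [e1]
    rw [intervalIntegral.integral_add
      (hv2.intervalIntegrable.sub ((hv 0 x).const_mul _)) (by simp),
      intervalIntegral.integral_sub hv2.intervalIntegrable ((hv 0 x).const_mul _),
      intervalIntegral.integral_const_mul, ← hu, intervalIntegral.integral_const]
    simp
    ring
  rw [e] at h
  have h2 : (∫ t in (0 : ℝ)..x, v t ^ 2) - 2 * (u x / x) * u x + (u x / x) ^ 2 * x
      = (∫ t in (0 : ℝ)..x, v t ^ 2) - u x ^ 2 / x := by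
    field_simp
    ring
  rw [h2, sub_nonneg, div_le_iff₀ hx] at h
  linarith

/-- Otherwise x²u² ≥ δx ≥ δ for all large x, which is not integrable. It provides endpoints R at
which the boundary term a R u(R)² is small. -/
theorem exists_ge_mul_sq_lt (hu : IntegrableOn (fun x => x ^ 2 * u x ^ 2) (Ioi 0)) (N : ℝ)
    {δ : ℝ} (hδ : 0 < δ) : ∃ R, N ≤ R ∧ 0 < R ∧ R * u R ^ 2 < δ := by
  by_contra! h
  have hi : IntegrableOn (fun _ : ℝ => δ) (Ioi (max N 1)) := by
    refine Integrable.mono' (hu.mono_set (Ioi_subset_Ioi (by positivity)))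
      aestronglyMeasurable_const ?_
    refine (ae_restrict_iff' measurableSet_Ioi).2 (Filter.Eventually.of_forall fun x hx => ?_)
    have hx1 : max N 1 < x := hx
    have hx2 : 1 < x := lt_of_le_of_lt (le_max_right _ _) hx1
    have := h x ((le_max_left _ _).trans hx1.le) (by linarith)
    rw [Real.norm_of_nonneg hδ.le]
    nlinarith
  rw [integrableOn_const_iff] at hi
  simp [hδ.ne'] at hi

variable (ha : 0 < a) (hv : ∀ x y, IntervalIntegrable v volume x y)
  (hv2 : Integrable fun x => v x ^ 2) (hu : ∀ x, u x = ∫ t in (0 : ℝ)..x, v t)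
  (hu2 : IntegrableOn (fun x => u x ^ 2) (Ioi 0))
  (hxu : IntegrableOn (fun x => x ^ 2 * u x ^ 2) (Ioi 0))
include ha hv hv2 hu hu2 hxu

/-- The square is completed on a larger interval [ε, R]; since the integrand is nonnegative,
restricting it to [x, y] only decreases the integral. The parts −u(R)²/R and −aε u(ε)² of the
boundary terms have the favourable sign, and the others are made small. The statement for a general
subinterval, rather than mere nonnegativity, is what the equality case needs. -/
theorem intervalIntegral_sq_le_half_line {x y : ℝ} (hx : 0 < x) (hxy : x ≤ y) :
    ∫ t in x..y, (v t + (a * t - 1 / t) * u t) ^ 2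
      ≤ ∫ t in Ioi 0, (v t ^ 2 + a ^ 2 * (t ^ 2 * u t ^ 2) - 3 * a * u t ^ 2) := by
  set F : ℝ → ℝ := fun t => v t ^ 2 + a ^ 2 * (t ^ 2 * u t ^ 2) - 3 * a * u t ^ 2 with hF
  have hucont : Continuous u := by
    rw [funext hu]; exact intervalIntegral.continuous_primitive hv 0
  have hFi : IntegrableOn F (Ioi 0) := (hv2.integrableOn.add (hxu.const_mul _)).sub (hu2.const_mul _)
  have hFint : ∀ p q, IntervalIntegrable F volume p q := fun p q =>
    (hv2.intervalIntegrable.add (Continuous.intervalIntegrable (by fun_prop) _ _)).sub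
      (Continuous.intervalIntegrable (by fun_prop) _ _)
  refine le_of_forall_pos_le_add fun δ hδ => ?_
  have l1 : ∀ᶠ R in Filter.atTop, ∫ t in (0 : ℝ)..R, F t < (∫ t in Ioi 0, F t) + δ / 4 :=
    (intervalIntegral_tendsto_integral_Ioi 0 hFi Filter.tendsto_id).eventually_lt_const (by linarith)
  obtain ⟨N, hN⟩ := l1.exists_forall_of_atTop
  -- The error δ is split into four quarters: the two integral tails and the two boundary terms. The
  -- bound δ/(4a) makes a R u(R)² smaller than δ/4.
  obtain ⟨R, hR1, hR0, hR2⟩ := exists_ge_mul_sq_lt hxu (max N y) (δ := δ / (4 * a)) (by positivity)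
  have hRN := hN R ((le_max_left _ _).trans hR1)
  have hyR : y ≤ R := (le_max_right _ _).trans hR1
  have c1 : Filter.Tendsto (fun ε => ∫ t in (0 : ℝ)..ε, F t) (nhds 0) (nhds 0) := by
    have := (intervalIntegral.continuous_primitive hFint 0).tendsto 0
    simpa using this
  have c2 : Filter.Tendsto (fun ε => ∫ t in (0 : ℝ)..ε, v t ^ 2) (nhds 0) (nhds 0) := by
    have := (intervalIntegral.continuous_primitive
      (fun p q => hv2.intervalIntegrable (a := p) (b := q)) 0).tendsto 0
    simpa using this
  have c3 : ∀ᶠ ε in nhdsWithin (0 : ℝ) (Ioi 0), -(δ / 4) < ∫ t in (0 : ℝ)..ε, F t :=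
    nhdsWithin_le_nhds (c1.eventually_const_lt (by linarith))
  have c4 : ∀ᶠ ε in nhdsWithin (0 : ℝ) (Ioi 0), ∫ t in (0 : ℝ)..ε, v t ^ 2 < δ / 4 :=
    nhdsWithin_le_nhds (c2.eventually_lt_const (by linarith))
  obtain ⟨ε, ⟨⟨h3, h4⟩, hεx⟩, hε0⟩ :=
    (((c3.and c4).and (nhdsWithin_le_nhds (eventually_lt_nhds hx))).and
      (self_mem_nhdsWithin)).exists
  have hε0 : 0 < ε := hε0
  have hεR : ε ≤ R := hεx.le.trans (hxy.trans hyR)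
  have main := intervalIntegral_sq_add_mul a hv hv2 hu hε0 hεR
  have hsplit := intervalIntegral.integral_add_adjacent_intervals (hFint 0 ε) (hFint ε R)
  have hint := integrableOn_sq_add_mul a hv hv2 hu hε0 hεR
  have hmono : ∫ t in x..y, (v t + (a * t - 1 / t) * u t) ^ 2
      ≤ ∫ t in ε..R, (v t + (a * t - 1 / t) * u t) ^ 2 := by
    rw [intervalIntegral.integral_of_le hxy, intervalIntegral.integral_of_le hεR]
    exact setIntegral_mono_set hint (Filter.Eventually.of_forall fun t => sq_nonneg _)
      (LE.le.eventuallyLE (Ioc_subset_Ioc hεx.le hyR))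
  have b1 : (a * R - 1 / R) * u R ^ 2 < δ / 4 := by
    have h1 : (a * R - 1 / R) * u R ^ 2 ≤ a * (R * u R ^ 2) := by
      have : 0 ≤ 1 / R * u R ^ 2 := by positivity
      nlinarith
    have h2 : a * (R * u R ^ 2) < a * (δ / (4 * a)) := mul_lt_mul_of_pos_left hR2 ha
    have h3 : a * (δ / (4 * a)) = δ / 4 := by field_simp
    linarith
  have b2 : -(a * ε - 1 / ε) * u ε ^ 2 < δ / 4 := by
    have h1 := sq_primitive_le hv hv2 hu hε0
    have h2 : 1 / ε * u ε ^ 2 ≤ ∫ t in (0 : ℝ)..ε, v t ^ 2 := by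
      rw [one_div, inv_mul_le_iff₀ hε0]; exact h1
    have h3 : 0 ≤ a * ε * u ε ^ 2 := by positivity
    nlinarith
  linarith

theorem half_line_uncertainty :
    0 ≤ ∫ t in Ioi 0, (v t ^ 2 + a ^ 2 * (t ^ 2 * u t ^ 2) - 3 * a * u t ^ 2) := by
  have := intervalIntegral_sq_le_half_line ha hv hv2 hu hu2 hxu one_pos le_rfl
  simpa using this

/-- Equality makes the square vanish almost everywhere on each [x, y], so u solves u' = (1/t − at)
u, and the solutions on the positive half line form a line. -/
theorem exists_eq_of_half_line_uncertainty_eq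
    (h : ∫ t in Ioi 0, (v t ^ 2 + a ^ 2 * (t ^ 2 * u t ^ 2) - 3 * a * u t ^ 2) = 0) :
    ∃ c : ℝ, ∀ x, 0 < x → u x = c * (x * Real.exp (-(a * x ^ 2) / 2)) := by
  -- An integrating factor: k' = (at − 1/t) k, so (ku)' = k (v + (at − 1/t) u).
  set k : ℝ → ℝ := fun x => Real.exp (a * x ^ 2 / 2) / x with hk
  have hconst : ∀ x y, 0 < x → x ≤ y → k x * u x = k y * u y := by
    intro x y hx hxy
    have hne : ∀ t ∈ uIcc x y, t ≠ 0 := fun t ht => by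
      rw [uIcc_of_le hxy] at ht
      exact (hx.trans_le ht.1).ne'
    have huac := absolutelyContinuousOnInterval_primitive hv hu hx hxy
    have hw : ContDiffOn ℝ 1 k (uIcc x y) :=
      ContDiffOn.div (ContDiff.contDiffOn (by fun_prop)) contDiffOn_id hne
    have hz : ∀ᵐ t ∂volume, t ∈ Ioc x y → (v t + (a * t - 1 / t) * u t) ^ 2 = 0 := by
      have h0 := intervalIntegral_sq_le_half_line ha hv hv2 hu hu2 hxu hx hxy
      rw [h, intervalIntegral.integral_of_le hxy] at h0
      have h1 := (setIntegral_eq_zero_iff_of_nonneg_ae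
        (Filter.Eventually.of_forall fun t => sq_nonneg _)
        (integrableOn_sq_add_mul a hv hv2 hu hx hxy)).1
        (le_antisymm h0 (integral_nonneg fun t => sq_nonneg _))
      exact (ae_restrict_iff' measurableSet_Ioc).1 h1
    have hac := hw.absolutelyContinuousOnInterval.fun_mul huac
    obtain ⟨C, hC⟩ := hac.const_of_ae_hasDerivAt_zero (by
      -- The vanishing is known on the half-open interval only, so the left endpoint is discarded as
      -- a null set.
      have hx' : ∀ᵐ t ∂(volume : Measure ℝ), t ≠ x := by simp [ae_iff]
      filter_upwards [hz, hx', ae_hasDerivAt_primitive hv hu hx hxy] with t h1 h2 h3 ht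
      have h4 := h3 ht
      have htn := hne t ht
      have h5 : HasDerivAt k ((a * t - 1 / t) * k t) t := by
        have e1 : HasDerivAt (fun x : ℝ => Real.exp (a * x ^ 2 / 2))
            (Real.exp (a * t ^ 2 / 2) * (a * t)) t := by
          refine HasDerivAt.exp ?_
          convert! ((hasDerivAt_pow 2 t).const_mul a).div_const 2 using 1
          simp
          ring
        convert! e1.div (hasDerivAt_id t) htn using 1
        simp only [hk, id]
        field_simp
      have h6 := h5.mul h4
      rw [uIcc_of_le hxy] at ht
      have h7 := pow_eq_zero_iff (two_ne_zero) |>.1 (h1 ⟨lt_of_le_of_ne ht.1 h2.symm, ht.2⟩)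
      convert! h6 using 1
      linear_combination (-k t) * h7)
    rw [hC x left_mem_uIcc, hC y right_mem_uIcc]
  refine ⟨k 1 * u 1, fun x hx => ?_⟩
  have h1 : k x * u x = k 1 * u 1 := by
    rcases le_total x 1 with hx1 | hx1
    · exact hconst x 1 hx hx1
    · exact (hconst 1 x one_pos hx1).symm
  rw [← h1, hk, neg_div, Real.exp_neg]
  have := Real.exp_ne_zero (a * x ^ 2 / 2)
  field_simp

end HalfLine

/-! ### From real functions to complex functions in `L²` -/

theorem lintegral_enorm_sq {μ : Measure ℝ} {f : ℝ → ℂ} (hf : Integrable (fun x => ‖f x‖ ^ 2) μ) :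
    ∫⁻ x, ‖f x‖ₑ ^ 2 ∂μ = ENNReal.ofReal (∫ x, ‖f x‖ ^ 2 ∂μ) := by
  rw [ofReal_integral_eq_lintegral_ofReal hf (Filter.Eventually.of_forall fun x => sq_nonneg _)]
  refine lintegral_congr fun x => ?_
  rw [ENNReal.ofReal_pow (norm_nonneg _), ofReal_norm]

theorem lintegral_ofReal_sq_mul_enorm_sq {μ : Measure ℝ} {f : ℝ → ℂ}
    (hf : Integrable (fun x => x ^ 2 * ‖f x‖ ^ 2) μ) :
    ∫⁻ x, ENNReal.ofReal (x ^ 2) * ‖f x‖ₑ ^ 2 ∂μ = ENNReal.ofReal (∫ x, x ^ 2 * ‖f x‖ ^ 2 ∂μ) := by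
  rw [ofReal_integral_eq_lintegral_ofReal hf
    (Filter.Eventually.of_forall fun x => by positivity)]
  refine lintegral_congr fun x => ?_
  rw [ENNReal.ofReal_mul (sq_nonneg _), ENNReal.ofReal_pow (norm_nonneg _), ofReal_norm]

theorem integrable_norm_sq_L2R (φ : L2R) : Integrable (fun x => ‖φ x‖ ^ 2) := by
  have := (memLp_volume φ).integrable_norm_pow (by norm_num)
  simpa using this

/-- The uncertainty relation on the half line, for complex functions. -/
theorem half_line_uncertainty_complex {a : ℝ} (ha : 0 < a) (ψ : L2R) {U : ℝ → ℂ}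
    (hU : ∀ x, U x = ∫ t in (0 : ℝ)..x, ψ t) (h2 : IntegrableOn (fun x => ‖U x‖ ^ 2) (Ioi 0))
    (hx : IntegrableOn (fun x => x ^ 2 * ‖U x‖ ^ 2) (Ioi 0)) :
    3 * a * (∫ x in Ioi 0, ‖U x‖ ^ 2)
      ≤ (∫ x in Ioi 0, ‖ψ x‖ ^ 2) + a ^ 2 * (∫ x in Ioi 0, x ^ 2 * ‖U x‖ ^ 2) ∧
    ((∫ x in Ioi 0, ‖ψ x‖ ^ 2) + a ^ 2 * (∫ x in Ioi 0, x ^ 2 * ‖U x‖ ^ 2)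
      ≤ 3 * a * (∫ x in Ioi 0, ‖U x‖ ^ 2) →
      ∃ c : ℂ, ∀ x, 0 < x → U x = c * (x * Real.exp (-(a * x ^ 2) / 2) : ℝ)) := by
  have hψ2 := integrable_norm_sq_L2R ψ
  have hψi := intervalIntegrable_L2R ψ
  have hUc : Continuous U := by rw [funext hU]; exact continuous_primitive_L2R ψ
  have hsq : ∀ z : ℂ, ‖z‖ ^ 2 = z.re ^ 2 + z.im ^ 2 := fun z => by
    rw [Complex.sq_norm, Complex.normSq_apply]; ring
  have hre : ∀ z : ℂ, z.re ^ 2 ≤ ‖z‖ ^ 2 := fun z => by rw [hsq]; nlinarith [sq_nonneg z.im]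
  have him : ∀ z : ℂ, z.im ^ 2 ≤ ‖z‖ ^ 2 := fun z => by rw [hsq]; nlinarith [sq_nonneg z.re]
  have hψm : Measurable ψ := (Lp.stronglyMeasurable ψ).measurable
  have mono : ∀ {μ : Measure ℝ} {f g : ℝ → ℝ}, Integrable g μ → Measurable f →
      (∀ x, 0 ≤ f x) → (∀ x, f x ≤ g x) → Integrable f μ := fun hg hf h0 hfg =>
    hg.mono' hf.aestronglyMeasurable (Filter.Eventually.of_forall fun x => by
      rw [Real.norm_of_nonneg (h0 x)]; exact hfg x)
  have r1 : Integrable fun x => (ψ x).re ^ 2 :=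
    mono hψ2 (by fun_prop) (fun x => sq_nonneg _) (fun x => hre _)
  have r2 : IntegrableOn (fun x => (U x).re ^ 2) (Ioi 0) :=
    mono h2 (by fun_prop) (fun x => sq_nonneg _) (fun x => hre _)
  have r3 : IntegrableOn (fun x => x ^ 2 * (U x).re ^ 2) (Ioi 0) :=
    mono hx (by fun_prop) (fun x => by positivity)
      (fun x => mul_le_mul_of_nonneg_left (hre _) (sq_nonneg _))
  have i1 : Integrable fun x => (ψ x).im ^ 2 :=
    mono hψ2 (by fun_prop) (fun x => sq_nonneg _) (fun x => him _)
  have i2 : IntegrableOn (fun x => (U x).im ^ 2) (Ioi 0) :=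
    mono h2 (by fun_prop) (fun x => sq_nonneg _) (fun x => him _)
  have i3 : IntegrableOn (fun x => x ^ 2 * (U x).im ^ 2) (Ioi 0) :=
    mono hx (by fun_prop) (fun x => by positivity)
      (fun x => mul_le_mul_of_nonneg_left (him _) (sq_nonneg _))
  have hUre : ∀ x, (U x).re = ∫ t in (0 : ℝ)..x, (ψ t).re := fun x => by
    rw [hU, re_intervalIntegral (hψi _ _)]
  have hUim : ∀ x, (U x).im = ∫ t in (0 : ℝ)..x, (ψ t).im := fun x => by
    rw [hU, im_intervalIntegral (hψi _ _)]
  have hvre : ∀ x y, IntervalIntegrable (fun t => (ψ t).re) volume x y := fun x y =>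
    ⟨(hψi x y).1.re, (hψi x y).2.re⟩
  have hvim : ∀ x y, IntervalIntegrable (fun t => (ψ t).im) volume x y := fun x y =>
    ⟨(hψi x y).1.im, (hψi x y).2.im⟩
  have Jr := half_line_uncertainty ha hvre r1 hUre r2 r3
  have Ji := half_line_uncertainty ha hvim i1 hUim i2 i3
  have key : (∫ x in Ioi 0, ‖ψ x‖ ^ 2) + a ^ 2 * (∫ x in Ioi 0, x ^ 2 * ‖U x‖ ^ 2)
      - 3 * a * (∫ x in Ioi 0, ‖U x‖ ^ 2)
      = (∫ t in Ioi 0, ((ψ t).re ^ 2 + a ^ 2 * (t ^ 2 * (U t).re ^ 2) - 3 * a * (U t).re ^ 2))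
      + ∫ t in Ioi 0, ((ψ t).im ^ 2 + a ^ 2 * (t ^ 2 * (U t).im ^ 2) - 3 * a * (U t).im ^ 2) := by
    have lin : ∀ {p q r : ℝ → ℝ}, IntegrableOn p (Ioi 0) → IntegrableOn q (Ioi 0) →
        IntegrableOn r (Ioi 0) → ∫ t in Ioi 0, (p t + a ^ 2 * q t - 3 * a * r t)
          = (∫ t in Ioi 0, p t) + a ^ 2 * (∫ t in Ioi 0, q t) - 3 * a * ∫ t in Ioi 0, r t := by
      intro p q r hp hq hr
      have hpq : IntegrableOn (fun t => p t + a ^ 2 * q t) (Ioi 0) := hp.add (hq.const_mul _)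
      rw [integral_sub hpq (hr.const_mul _), integral_add hp (hq.const_mul _), integral_const_mul,
        integral_const_mul]
    rw [lin r1.integrableOn r3 r2, lin i1.integrableOn i3 i2]
    simp_rw [hsq, mul_add]
    rw [integral_add r1.integrableOn i1.integrableOn, integral_add r2 i2, integral_add r3 i3]
    ring
  refine ⟨by linarith, fun hle => ?_⟩
  -- The real and imaginary parts contribute two nonnegative defects with nonpositive sum, so both
  -- vanish.
  obtain ⟨c, hc⟩ := exists_eq_of_half_line_uncertainty_eq ha hvre r1 hUre r2 r3 (by linarith)
  obtain ⟨d, hd⟩ := exists_eq_of_half_line_uncertainty_eq ha hvim i1 hUim i2 i3 (by linarith)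
  refine ⟨⟨c, d⟩, fun x hx0 => ?_⟩
  apply Complex.ext
  · rw [hc x hx0, Complex.re_mul_ofReal]
  · rw [hd x hx0, Complex.im_mul_ofReal]

/-- The hypothesis `h` carries the Dirichlet condition: the primitive starts at 0 without a
constant. The normalization of `haarR` is a common factor and cancels. -/
theorem half_line_uncertainty_L2R {a : ℝ} (ha : 0 < a) {φ ψ : L2R}
    (h : φ =ᵐ[volume] fun x => ∫ t in (0 : ℝ)..x, ψ t)
    (htop : ∫⁻ x in Ioi 0, ENNReal.ofReal (x ^ 2) * ‖φ x‖ₑ ^ 2 ∂haarR ≠ ⊤) :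
    ENNReal.ofReal (3 * a) * ∫⁻ x in Ioi 0, ‖φ x‖ₑ ^ 2 ∂haarR
      ≤ ∫⁻ x in Ioi 0, ‖ψ x‖ₑ ^ 2 ∂haarR
        + ENNReal.ofReal (a ^ 2) * ∫⁻ x in Ioi 0, ENNReal.ofReal (x ^ 2) * ‖φ x‖ₑ ^ 2 ∂haarR ∧
    (∫⁻ x in Ioi 0, ‖ψ x‖ₑ ^ 2 ∂haarR
        + ENNReal.ofReal (a ^ 2) * ∫⁻ x in Ioi 0, ENNReal.ofReal (x ^ 2) * ‖φ x‖ₑ ^ 2 ∂haarR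
      ≤ ENNReal.ofReal (3 * a) * ∫⁻ x in Ioi 0, ‖φ x‖ₑ ^ 2 ∂haarR →
      ∃ c : ℂ, ∀ᵐ x ∂volume, 0 < x → φ x = c * (x * Real.exp (-(a * x ^ 2) / 2) : ℝ)) := by
  have hK := haarR_const_ne_zero
  have hK' : ENNReal.ofReal (1 / √(2 * Real.pi)) ≠ ⊤ := ENNReal.ofReal_ne_top
  have hres : haarR.restrict (Ioi 0)
      = ENNReal.ofReal (1 / √(2 * Real.pi)) • volume.restrict (Ioi 0) := by
    rw [haarR, Measure.restrict_smul]
  simp only [hres, lintegral_smul_measure, smul_eq_mul] at htop ⊢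
  generalize ENNReal.ofReal (1 / √(2 * Real.pi)) = K at hK hK' htop
  set U : ℝ → ℂ := fun x => ∫ t in (0 : ℝ)..x, ψ t with hU
  have hUc : Continuous U := continuous_primitive_L2R ψ
  have h' : φ =ᵐ[volume.restrict (Ioi 0)] U := ae_restrict_of_ae h
  have e1 : ∫⁻ x in Ioi 0, ENNReal.ofReal (x ^ 2) * ‖φ x‖ₑ ^ 2
      = ∫⁻ x in Ioi 0, ENNReal.ofReal (x ^ 2) * ‖U x‖ₑ ^ 2 := by
    refine lintegral_congr_ae ?_
    filter_upwards [h'] with x hx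
    rw [hx]
  have e2 : ∫⁻ x in Ioi 0, ‖φ x‖ₑ ^ 2 = ∫⁻ x in Ioi 0, ‖U x‖ₑ ^ 2 := by
    refine lintegral_congr_ae ?_
    filter_upwards [h'] with x hx
    rw [hx]
  have htop' : ∫⁻ x in Ioi 0, ENNReal.ofReal (x ^ 2) * ‖U x‖ₑ ^ 2 ≠ ⊤ := fun h0 => by
    rw [e1, h0, ENNReal.mul_top hK] at htop
    exact htop rfl
  have hψ2 := (integrable_norm_sq_L2R ψ).integrableOn (s := Ioi 0)
  have hU2 : IntegrableOn (fun x => ‖U x‖ ^ 2) (Ioi 0) := by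
    refine (integrable_norm_sq_L2R φ).integrableOn.congr ?_
    filter_upwards [h'] with x hx
    rw [hx]
  have hxU : IntegrableOn (fun x => x ^ 2 * ‖U x‖ ^ 2) (Ioi 0) := by
    refine ⟨Continuous.aestronglyMeasurable (by fun_prop), ?_⟩
    rw [hasFiniteIntegral_iff_ofReal (Filter.Eventually.of_forall fun x => by positivity)]
    refine lt_of_le_of_ne le_top ?_
    convert htop' using 4 with x
    rw [ENNReal.ofReal_mul (sq_nonneg _), ENNReal.ofReal_pow (norm_nonneg _), ofReal_norm]
  obtain ⟨m1, m2⟩ := half_line_uncertainty_complex ha ψ (fun x => rfl) hU2 hxU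
  have hA : 0 ≤ ∫ x in Ioi 0, ‖U x‖ ^ 2 := integral_nonneg fun x => sq_nonneg _
  have hB : 0 ≤ ∫ x in Ioi 0, ‖ψ x‖ ^ 2 := integral_nonneg fun x => sq_nonneg _
  have hC : 0 ≤ ∫ x in Ioi 0, x ^ 2 * ‖U x‖ ^ 2 := integral_nonneg fun x => by positivity
  have comb : ∀ A B C : ℝ≥0∞, ENNReal.ofReal (a ^ 2) * (K * C) = K * (ENNReal.ofReal (a ^ 2) * C) ∧
      ENNReal.ofReal (3 * a) * (K * A) = K * (ENNReal.ofReal (3 * a) * A) := fun A B C =>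
    ⟨by ring, by ring⟩
  rw [(comb 0 0 _).1, (comb _ 0 0).2, ← mul_add, ENNReal.mul_le_mul_iff_right hK hK',
    ENNReal.mul_le_mul_iff_right hK hK', e1, e2, lintegral_enorm_sq hψ2, lintegral_enorm_sq hU2,
    lintegral_ofReal_sq_mul_enorm_sq hxU, ← ENNReal.ofReal_mul (by positivity),
    ← ENNReal.ofReal_mul (by positivity), ← ENNReal.ofReal_add hB (by positivity)]
  refine ⟨ENNReal.ofReal_le_ofReal m1, fun hle => ?_⟩
  rw [ENNReal.ofReal_le_ofReal_iff (by positivity)] at hle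
  obtain ⟨c, hc⟩ := m2 hle
  refine ⟨c, ?_⟩
  filter_upwards [h] with x hx hx0
  rw [hx, ← hc x hx0]

/-- A continuous function that vanishes almost everywhere on the negative half line vanishes
at `0`. -/
theorem Continuous.eq_zero_of_ae_neg {U : ℝ → ℂ} (hU : Continuous U)
    (h : ∀ᵐ x ∂(volume : Measure ℝ), x < 0 → U x = 0) : U 0 = 0 := by
  have h1 : EqOn U (fun _ => 0) (Iio 0) := by
    refine Measure.eqOn_open_of_ae_eq (μ := volume) ?_ isOpen_Iio hU.continuousOn
      continuousOn_const
    exact (ae_restrict_iff' measurableSet_Iio).2 h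
  have h2 := h1.of_subset_closure hU.continuousOn continuousOn_const (Iio_subset_Iic_self)
    (by rw [closure_Iio])
  exact h2 self_mem_Iic

/-! ### Functions on the half line and odd functions -/

theorem extendByZero_coeFn (φ : L2Pos) : extendByZero φ =ᵐ[haarR] (Ici (0 : ℝ)).indicator φ :=
  (memLp_indicator_Ici φ).coeFn_toLp

theorem restrict_Ici_eq_Ioi : haarR.restrict (Ici 0) = haarR.restrict (Ioi 0) := by
  rw [haarR, Measure.restrict_smul, Measure.restrict_smul, restrict_Ioi_eq_restrict_Ici]

theorem lintegral_extendByZero (φ : L2Pos) (w : ℝ → ℝ≥0∞) :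
    ∫⁻ x, w x * ‖extendByZero φ x‖ₑ ^ 2 ∂haarR
      = ∫⁻ x in Ioi 0, w x * ‖extendByZero φ x‖ₑ ^ 2 ∂haarR := by
  rw [← restrict_Ici_eq_Ioi, ← lintegral_indicator measurableSet_Ici]
  refine lintegral_congr_ae ?_
  filter_upwards [extendByZero_coeFn φ] with x hx
  by_cases h : x ∈ Ici (0 : ℝ)
  · rw [indicator_of_mem h]
  · rw [indicator_of_notMem h, hx, indicator_of_notMem h]
    simp

theorem enorm_sq_L2Pos (φ : L2Pos) : ‖φ‖ₑ ^ 2 = ∫⁻ x in Ioi 0, ‖extendByZero φ x‖ₑ ^ 2 ∂haarR := by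
  have := lintegral_extendByZero φ (fun _ => 1)
  simp only [one_mul] at this
  rw [← this, ← enorm_sq_eq_lintegral, ← ofReal_norm, ← ofReal_norm, extendByZero.norm_map]

/-- The continuous representative vanishes on the negative half line, hence at 0, which kills the
constant of integration. -/
theorem IsWeakDeriv.ae_eq_primitive_of_extendByZero {φ : L2Pos} {ψ : L2R}
    (h : IsWeakDeriv (extendByZero φ) ψ) :
    extendByZero φ =ᵐ[volume] fun x => ∫ t in (0 : ℝ)..x, ψ t := by
  obtain ⟨c, hc⟩ := h.exists_ae_eq_primitive
  have h0 : c + ∫ t in (0 : ℝ)..0, ψ t = 0 := by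
    refine Continuous.eq_zero_of_ae_neg (U := fun x => c + ∫ t in (0 : ℝ)..x, ψ t)
      (continuous_const.add (continuous_primitive_L2R ψ)) ?_
    filter_upwards [hc, ae_haarR_iff.1 (extendByZero_coeFn φ)] with x h1 h2 hx
    rw [← h1, h2, indicator_of_notMem (by simpa using hx)]
  rw [intervalIntegral.integral_same, add_zero] at h0
  simpa [h0] using hc

/-- The uncertainty relation for `L²(ℝ₊)`. -/
theorem uncertainty_L2Pos {a : ℝ} (ha : 0 < a) (φ : L2Pos) :
    ENNReal.ofReal (3 * a) * ‖φ‖ₑ ^ 2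
      ≤ momentumForm (extendByZero φ) + ENNReal.ofReal (a ^ 2) * secondMoment (extendByZero φ) ∧
    (secondMoment (extendByZero φ) ≠ ⊤ →
      momentumForm (extendByZero φ) + ENNReal.ofReal (a ^ 2) * secondMoment (extendByZero φ)
        ≤ ENNReal.ofReal (3 * a) * ‖φ‖ₑ ^ 2 →
      ∃ c : ℂ, φ =ᵐ[haarR.restrict (Ici 0)]
        fun x => c * (x * Real.exp (-(a * x ^ 2) / 2) : ℝ)) := by
  have ha2 : ENNReal.ofReal (a ^ 2) ≠ 0 := by
    rw [Ne, ENNReal.ofReal_eq_zero, not_le]; positivity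
  by_cases h1 : secondMoment (extendByZero φ) = ⊤
  · rw [h1, ENNReal.mul_top ha2, add_top]
    exact ⟨le_top, fun h => absurd rfl h⟩
  by_cases h2 : momentumForm (extendByZero φ) = ⊤
  · rw [h2, top_add]
    refine ⟨le_top, fun _ h => absurd h ?_⟩
    rw [not_le]
    refine ENNReal.mul_lt_top ENNReal.ofReal_lt_top ?_
    rw [← ofReal_norm]
    exact ENNReal.pow_lt_top ENNReal.ofReal_lt_top
  obtain ⟨ψ, hψ, hn⟩ := exists_isWeakDeriv_enorm_sq_eq h2
  have hs := lintegral_extendByZero φ (fun x => ENNReal.ofReal (x ^ 2))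
  obtain ⟨m1, m2⟩ := half_line_uncertainty_L2R ha hψ.ae_eq_primitive_of_extendByZero
    (by rw [← hs]; exact h1)
  -- Only the part of the derivative on the positive half line enters the estimate, so an inequality
  -- suffices.
  have hle : ∫⁻ x in Ioi 0, ‖ψ x‖ₑ ^ 2 ∂haarR ≤ momentumForm (extendByZero φ) := by
    rw [← hn, enorm_sq_eq_lintegral]
    exact setLIntegral_le_lintegral _ _
  rw [← hs, ← enorm_sq_L2Pos] at m1 m2
  refine ⟨m1.trans (add_le_add_left hle _), fun _ h => ?_⟩
  obtain ⟨c, hc⟩ := m2 ((add_le_add_left hle _).trans h)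
  refine ⟨c, ?_⟩
  have e := (ae_restrict_iff' measurableSet_Ioi).2 (ae_haarR_iff.2 hc)
  rw [← restrict_Ici_eq_Ioi] at e
  filter_upwards [e, ae_restrict_of_ae (s := Ici 0) (extendByZero_coeFn φ),
    ae_restrict_mem measurableSet_Ici] with x h1 h2 h3
  rw [← h1, h2, indicator_of_mem h3]

/-- The continuous representative is odd everywhere, so its value at 0 equals its own negative. -/
theorem IsWeakDeriv.ae_eq_primitive_of_isOdd {φ ψ : L2R} (hφ : IsOdd φ) (h : IsWeakDeriv φ ψ) :
    φ =ᵐ[volume] fun x => ∫ t in (0 : ℝ)..x, ψ t := by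
  obtain ⟨c, hc⟩ := h.exists_ae_eq_primitive
  have hcont : Continuous fun x : ℝ => c + ∫ t in (0 : ℝ)..x, ψ t :=
    continuous_const.add (continuous_primitive_L2R ψ)
  have h0 : (fun x : ℝ => c + ∫ t in (0 : ℝ)..(-x), ψ t)
      = -fun x : ℝ => c + ∫ t in (0 : ℝ)..x, ψ t := by
    refine Continuous.ae_eq_iff_eq volume (hcont.comp continuous_neg) hcont.neg |>.1 ?_
    filter_upwards [hc, (Measure.measurePreserving_neg (volume : Measure
      ℝ)).quasiMeasurePreserving.ae hc, ae_haarR_iff.1 hφ] with x h1 h2 h3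
    rw [Function.comp_apply, Pi.neg_apply, ← h1, ← h3, h2]
  have h1 := congrFun h0 0
  simp only [neg_zero, intervalIntegral.integral_same, add_zero, Pi.neg_apply] at h1
  have h2 : c = 0 := self_eq_neg.1 h1
  simpa [h2] using hc

theorem lintegral_comp_neg_Ioi (w : ℝ → ℝ≥0∞) :
    ∫⁻ x in Ioi 0, w (-x) ∂haarR = ∫⁻ x in Iio 0, w x ∂haarR := by
  have h := measurePreserving_neg_haarR.setLIntegral_comp_preimage_emb
    (MeasurableEquiv.neg ℝ).measurableEmbedding w (Iio 0)
  rw [← h]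
  congr 2
  ext x
  simp

theorem lintegral_haarR_eq_add (w : ℝ → ℝ≥0∞) :
    ∫⁻ x, w x ∂haarR = ∫⁻ x in Ioi 0, w x ∂haarR + ∫⁻ x in Ioi 0, w (-x) ∂haarR := by
  rw [lintegral_comp_neg_Ioi, ← lintegral_add_compl w measurableSet_Ioi (A := Ioi 0), compl_Ioi]
  congr 2
  rw [haarR, Measure.restrict_smul, Measure.restrict_smul, restrict_Iio_eq_restrict_Iic]

theorem IsOdd.lintegral_eq {φ : L2R} (hφ : IsOdd φ) {w : ℝ → ℝ≥0∞} (hw : ∀ x, w (-x) = w x) :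
    ∫⁻ x, w x * ‖φ x‖ₑ ^ 2 ∂haarR = 2 * ∫⁻ x in Ioi 0, w x * ‖φ x‖ₑ ^ 2 ∂haarR := by
  rw [lintegral_haarR_eq_add, two_mul]
  congr 1
  refine lintegral_congr_ae ?_
  filter_upwards [ae_restrict_of_ae hφ] with x hx
  rw [hx, hw, enorm_neg]

/-- The uncertainty relation for odd functions. -/
theorem uncertainty_isOdd {a : ℝ} (ha : 0 < a) {φ : L2R} (hφ : IsOdd φ) :
    ENNReal.ofReal (3 * a) * ‖φ‖ₑ ^ 2
      ≤ momentumForm φ + ENNReal.ofReal (a ^ 2) * secondMoment φ ∧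
    (secondMoment φ ≠ ⊤ →
      momentumForm φ + ENNReal.ofReal (a ^ 2) * secondMoment φ
        ≤ ENNReal.ofReal (3 * a) * ‖φ‖ₑ ^ 2 →
      ∃ c : ℂ, φ =ᵐ[haarR] fun x => c * (x * Real.exp (-(a * x ^ 2) / 2) : ℝ)) := by
  have ha2 : ENNReal.ofReal (a ^ 2) ≠ 0 := by
    rw [Ne, ENNReal.ofReal_eq_zero, not_le]; positivity
  have hfin : ENNReal.ofReal (3 * a) * ‖φ‖ₑ ^ 2 < ⊤ := by
    refine ENNReal.mul_lt_top ENNReal.ofReal_lt_top ?_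
    rw [← ofReal_norm]
    exact ENNReal.pow_lt_top ENNReal.ofReal_lt_top
  by_cases h1 : secondMoment φ = ⊤
  · rw [h1, ENNReal.mul_top ha2, add_top]
    exact ⟨le_top, fun h => absurd rfl h⟩
  by_cases h2 : momentumForm φ = ⊤
  · rw [h2, top_add]
    exact ⟨le_top, fun _ h => absurd h (not_le.2 hfin)⟩
  obtain ⟨ψ, hψ, hn⟩ := exists_isWeakDeriv_enorm_sq_eq h2
  have hs : secondMoment φ = 2 * ∫⁻ x in Ioi 0, ENNReal.ofReal (x ^ 2) * ‖φ x‖ₑ ^ 2 ∂haarR :=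
    hφ.lintegral_eq (w := fun x => ENNReal.ofReal (x ^ 2)) fun x => by rw [neg_sq]
  have hN : ‖φ‖ₑ ^ 2 = 2 * ∫⁻ x in Ioi 0, ‖φ x‖ₑ ^ 2 ∂haarR := by
    have := hφ.lintegral_eq (w := fun _ => 1) fun x => rfl
    simpa only [one_mul, ← enorm_sq_eq_lintegral] using this
  have hfin1 : ∫⁻ x in Ioi 0, ENNReal.ofReal (x ^ 2) * ‖φ x‖ₑ ^ 2 ∂haarR ≠ ⊤ := fun h => by
    rw [hs, h] at h1; simp at h1
  have hprim := hψ.ae_eq_primitive_of_isOdd hφ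
  obtain ⟨m1, m2⟩ := half_line_uncertainty_L2R ha hprim hfin1
  -- the reflected pair
  have hχm : MemLp (fun x => ψ (-x)) 2 haarR :=
    (Lp.memLp ψ).comp_measurePreserving measurePreserving_neg_haarR
  set χ : L2R := hχm.toLp _ with hχ
  have hχc : χ =ᵐ[haarR] fun x => ψ (-x) := hχm.coeFn_toLp
  have hprim' : φ =ᵐ[volume] fun x => ∫ t in (0 : ℝ)..x, χ t := by
    filter_upwards [(Measure.measurePreserving_neg (volume : Measure
      ℝ)).quasiMeasurePreserving.ae hprim, ae_haarR_iff.1 hφ] with x h1 h2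
    have e : ∫ t in (0 : ℝ)..x, χ t = ∫ t in (0 : ℝ)..x, ψ (-t) :=
      intervalIntegral.integral_congr_ae (by
        filter_upwards [ae_haarR_iff.1 hχc] with t ht _
        exact ht)
    rw [e, intervalIntegral.integral_comp_neg (fun t => ψ t), neg_zero,
      intervalIntegral.integral_symm, ← h1, h2, neg_neg]
  obtain ⟨m3, -⟩ := half_line_uncertainty_L2R ha hprim' hfin1
  have hψs : momentumForm φ = ∫⁻ x in Ioi 0, ‖ψ x‖ₑ ^ 2 ∂haarR + ∫⁻ x in Ioi 0, ‖χ x‖ₑ ^ 2 ∂haarR := by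
    rw [← hn, enorm_sq_eq_lintegral, lintegral_haarR_eq_add]
    congr 1
    refine lintegral_congr_ae ?_
    filter_upwards [ae_restrict_of_ae hχc] with x hx
    rw [hx]
  rw [hN] at hfin
  rw [hs, hN, hψs]
  generalize ∫⁻ x in Ioi 0, ENNReal.ofReal (x ^ 2) * ‖φ x‖ₑ ^ 2 ∂haarR = C at *
  generalize ∫⁻ x in Ioi 0, ‖φ x‖ₑ ^ 2 ∂haarR = A at *
  generalize ∫⁻ x in Ioi 0, ‖ψ x‖ₑ ^ 2 ∂haarR = B at *
  generalize ∫⁻ x in Ioi 0, ‖χ x‖ₑ ^ 2 ∂haarR = B' at *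
  have e1 : B + B' + ENNReal.ofReal (a ^ 2) * (2 * C)
      = (B + ENNReal.ofReal (a ^ 2) * C) + (B' + ENNReal.ofReal (a ^ 2) * C) := by ring
  have e2 : ENNReal.ofReal (3 * a) * (2 * A)
      = ENNReal.ofReal (3 * a) * A + ENNReal.ofReal (3 * a) * A := by ring
  rw [e2] at hfin
  rw [e1, e2]
  refine ⟨add_le_add m1 m3, fun _ h => ?_⟩
  have hfinA : ENNReal.ofReal (3 * a) * A ≠ ⊤ := (lt_of_le_of_lt le_self_add hfin).ne
  -- The two half-line inequalities add up to an equality. Cancelling the finite bound of the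
  -- reflected pair leaves equality on the right; the formula on the left then follows from oddness.
  obtain ⟨c, hc⟩ := m2 (by
    have := (add_le_add_right m3 (B + ENNReal.ofReal (a ^ 2) * C)).trans h
    exact (ENNReal.add_le_add_iff_right hfinA).1 this)
  refine ⟨c, ae_haarR_iff.2 ?_⟩
  have hne : ∀ᵐ x ∂(volume : Measure ℝ), x ≠ 0 := by simp [ae_iff]
  filter_upwards [hc, (Measure.measurePreserving_neg (volume : Measure
      ℝ)).quasiMeasurePreserving.ae hc, ae_haarR_iff.1 hφ, hne] with x h1 h2 h3 h4
  rcases lt_or_gt_of_ne h4 with h5 | h5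
  · have h6 := h2 (neg_pos.2 h5)
    rw [h3, neg_eq_iff_eq_neg] at h6
    rw [h6, neg_sq, neg_mul, Complex.ofReal_neg, mul_neg, neg_neg]
  · exact h1 h5

/-! ## The characteristic operators of a positive operator valued measure -/

section Characteristic

variable {H : Type*} [NormedAddCommGroup H] [InnerProductSpace ℂ H]

theorem POVM.dist_apply (M : POVM H) (φ : H) {B : Set ℝ} (hB : MeasurableSet B) :
    M.dist φ B = ENNReal.ofReal (⟪φ, M.op B φ⟫_ℂ).re :=
  Measure.ofMeasurable_apply B hB

theorem POVM.dist_univ (M : POVM H) (φ : H) : M.dist φ univ = ENNReal.ofReal (‖φ‖ ^ 2) := by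
  rw [M.dist_apply φ MeasurableSet.univ, M.op_univ, one_apply_eq_self,
    inner_self_eq_norm_sq_to_K]
  norm_cast

instance POVM.isFiniteMeasure_dist (M : POVM H) (φ : H) : IsFiniteMeasure (M.dist φ) :=
  ⟨by rw [M.dist_univ]; exact ENNReal.ofReal_lt_top⟩

theorem POVM.inner_op_eq_ofReal (M : POVM H) (φ : H) {B : Set ℝ} (hB : MeasurableSet B) :
    ⟪φ, M.op B φ⟫_ℂ = (((M.dist φ).real B : ℝ) : ℂ) := by
  have hp := M.positive B hB
  have h0 : 0 ≤ (⟪φ, M.op B φ⟫_ℂ).re := hp.re_inner_nonneg_right φ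
  rw [measureReal_def, M.dist_apply φ hB, ENNReal.toReal_ofReal h0]
  have h1 : (starRingEnd ℂ) ⟪φ, M.op B φ⟫_ℂ = ⟪φ, M.op B φ⟫_ℂ := by
    rw [inner_conj_symm]
    exact hp.1 φ φ
  exact (Complex.conj_eq_iff_re.1 h1).symm

/-- The Cauchy-Schwarz inequality for a positive operator, in additive form. -/
theorem two_mul_norm_inner_le_of_isPositive {A : H →L[ℂ] H} (hA : A.IsPositive) (φ ψ : H) :
    2 * ‖⟪φ, A ψ⟫_ℂ‖ ≤ (⟪φ, A φ⟫_ℂ).re + (⟪ψ, A ψ⟫_ℂ).re := by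
  -- A phase making the off-diagonal term real and nonnegative; the claim is positivity at φ − uψ.
  obtain ⟨u, hu, hu2⟩ : ∃ u : ℂ, ‖u‖ = 1 ∧ u * ⟪φ, A ψ⟫_ℂ = ‖⟪φ, A ψ⟫_ℂ‖ := by
    by_cases h : ⟪φ, A ψ⟫_ℂ = 0
    · exact ⟨1, by simp, by simp [h]⟩
    · refine ⟨‖⟪φ, A ψ⟫_ℂ‖ / ⟪φ, A ψ⟫_ℂ, ?_, div_mul_cancel₀ _ h⟩
      rw [norm_div, Complex.norm_real, norm_norm, div_self (norm_ne_zero_iff.2 h)]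
  have h := hA.re_inner_nonneg_right (φ - u • ψ)
  have h1 : ⟪ψ, A φ⟫_ℂ = (starRingEnd ℂ) ⟪φ, A ψ⟫_ℂ := by
    rw [inner_conj_symm]; exact (hA.1 ψ φ).symm
  have h2 : (starRingEnd ℂ) u * (starRingEnd ℂ) ⟪φ, A ψ⟫_ℂ = ‖⟪φ, A ψ⟫_ℂ‖ := by
    rw [← map_mul, hu2, Complex.conj_ofReal]
  have h3 : (starRingEnd ℂ) u * u = 1 := by
    rw [mul_comm, Complex.mul_conj, Complex.normSq_eq_norm_sq, hu]; simp
  have e : ⟪φ - u • ψ, A (φ - u • ψ)⟫_ℂ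
      = ⟪φ, A φ⟫_ℂ + ⟪ψ, A ψ⟫_ℂ - 2 * (‖⟪φ, A ψ⟫_ℂ‖ : ℂ) := by
    simp only [map_sub, map_smul, inner_sub_left, inner_sub_right, inner_smul_left,
      inner_smul_right, h1]
    linear_combination (-1 : ℂ) * hu2 - h2 + h3 * ⟪ψ, A ψ⟫_ℂ
  rw [e] at h
  have h4 : (2 * (‖⟪φ, A ψ⟫_ℂ‖ : ℂ)).re = 2 * ‖⟪φ, A ψ⟫_ℂ‖ := by norm_cast
  change 0 ≤ (⟪φ, A φ⟫_ℂ + ⟪ψ, A ψ⟫_ℂ - 2 * (‖⟪φ, A ψ⟫_ℂ‖ : ℂ)).re at h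
  rw [Complex.sub_re, Complex.add_re, h4] at h
  linarith

/-- Take for φ the vector Tψ rescaled to the norm of ψ; the inequality becomes 2‖ψ‖‖Tψ‖ ≤ 2‖ψ‖². -/
theorem opNorm_le_one_of_norm_inner_le {T : H →L[ℂ] H}
    (h : ∀ φ ψ, 2 * ‖⟪φ, T ψ⟫_ℂ‖ ≤ ‖φ‖ ^ 2 + ‖ψ‖ ^ 2) : ‖T‖ ≤ 1 := by
  refine T.opNorm_le_bound zero_le_one fun ψ => ?_
  rw [one_mul]
  by_contra! hlt
  have hpos : 0 < ‖T ψ‖ := lt_of_le_of_lt (norm_nonneg _) hlt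
  have := h (((‖ψ‖ / ‖T ψ‖ : ℝ) : ℂ) • T ψ) ψ
  rw [inner_smul_left, norm_mul, norm_smul, RCLike.norm_conj, Complex.norm_real,
    Real.norm_of_nonneg (by positivity), div_mul_cancel₀ _ hpos.ne', inner_self_eq_norm_sq_to_K,
    norm_pow] at this
  simp only [Complex.coe_algebraMap, Complex.norm_real, norm_norm] at this
  have e : ‖ψ‖ / ‖T ψ‖ * ‖T ψ‖ ^ 2 = ‖ψ‖ * ‖T ψ‖ := by field_simp
  rw [e] at this
  rcases eq_or_ne ψ 0 with rfl | hψ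
  · simp at hpos
  · have : 0 < ‖ψ‖ := norm_pos_iff.2 hψ
    nlinarith

/-- Polarization at ψ and Tψ rescaled to the norm of ψ: four vectors of norm at most 2‖ψ‖, each
contributing 4ε‖ψ‖², divided by 4. The constant is not sharp, but any constant serves in a Cauchy
estimate. -/
theorem opNorm_le_of_norm_inner_self_le {T : H →L[ℂ] H} {ε : ℝ} (hε : 0 ≤ ε)
    (h : ∀ ψ, ‖⟪ψ, T ψ⟫_ℂ‖ ≤ ε * ‖ψ‖ ^ 2) : ‖T‖ ≤ 4 * ε := by
  refine T.opNorm_le_bound (by positivity) fun ψ => ?_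
  by_cases hz : T ψ = 0
  · rw [hz, norm_zero]; positivity
  have hpos : 0 < ‖T ψ‖ := norm_pos_iff.2 hz
  have hψ : 0 < ‖ψ‖ := norm_pos_iff.2 fun h0 => hz (by rw [h0, map_zero])
  set φ : H := ((‖ψ‖ / ‖T ψ‖ : ℝ) : ℂ) • T ψ with hφ
  have hφn : ‖φ‖ = ‖ψ‖ := by
    rw [hφ, norm_smul, Complex.norm_real, Real.norm_of_nonneg (by positivity),
      div_mul_cancel₀ _ hpos.ne']
  have hpol := inner_map_polarization' (T : H →ₗ[ℂ] H) ψ φ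
  have hq : ∀ χ : H, ‖χ‖ ≤ 2 * ‖ψ‖ → ‖⟪T χ, χ⟫_ℂ‖ ≤ 4 * ε * ‖ψ‖ ^ 2 := fun χ hχ => by
    rw [norm_inner_symm]
    refine (h χ).trans ?_
    have : ‖χ‖ ^ 2 ≤ (2 * ‖ψ‖) ^ 2 := pow_le_pow_left₀ (norm_nonneg _) hχ 2
    nlinarith
  have hI : ‖Complex.I • φ‖ = ‖ψ‖ := by rw [norm_smul, Complex.norm_I, one_mul, hφn]
  have b1 := hq (ψ + φ) ((norm_add_le _ _).trans (by rw [hφn]; linarith))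
  have b2 := hq (ψ - φ) ((norm_sub_le _ _).trans (by rw [hφn]; linarith))
  have b3 := hq (ψ + Complex.I • φ) ((norm_add_le _ _).trans (by rw [hI]; linarith))
  have b4 := hq (ψ - Complex.I • φ) ((norm_sub_le _ _).trans (by rw [hI]; linarith))
  have hle : ‖⟪T ψ, φ⟫_ℂ‖ ≤ 4 * ε * ‖ψ‖ ^ 2 := by
    simp only [ContinuousLinearMap.coe_coe] at hpol
    rw [hpol, norm_div]
    have e4 : ‖(4 : ℂ)‖ = 4 := by norm_num
    rw [e4, div_le_iff₀ (by norm_num)]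
    refine (norm_add_le _ _).trans ?_
    refine (add_le_add ((norm_sub_le _ _).trans (add_le_add ((norm_sub_le _ _).trans
      (add_le_add b1 b2)) ?_)) ?_).trans (le_of_eq (by ring : 4 * ε * ‖ψ‖ ^ 2 + 4 * ε * ‖ψ‖ ^ 2 +
        4 * ε * ‖ψ‖ ^ 2 + 4 * ε * ‖ψ‖ ^ 2 = _))
    · rw [norm_mul, Complex.norm_I, one_mul]; assumption
    · rw [norm_mul, Complex.norm_I, one_mul]; assumption
  rw [hφ, inner_smul_right, norm_mul, Complex.norm_real, Real.norm_of_nonneg (by positivity),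
    inner_self_eq_norm_sq_to_K, norm_pow] at hle
  simp only [Complex.coe_algebraMap, Complex.norm_real, norm_norm] at hle
  have e : ‖ψ‖ / ‖T ψ‖ * ‖T ψ‖ ^ 2 = ‖ψ‖ * ‖T ψ‖ := by field_simp
  rw [e] at hle
  nlinarith

/-- The phase sx is reduced modulo 2π and rounded down to a multiple of 2π/N. Finitely many values
turn the operator integral into a finite sum, and their having modulus exactly one keeps that sum a
contraction. -/
theorem exists_measurable_nat_approx_exp (s : ℝ) {ε : ℝ} (hε : 0 < ε) :
    ∃ (N : ℕ) (κ : ℝ → ℕ) (z : ℕ → ℂ), Measurable κ ∧ (∀ x, κ x < N) ∧ (∀ k, ‖z k‖ = 1) ∧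
      ∀ x, ‖z (κ x) - Complex.exp ((s * x : ℝ) * Complex.I)‖ ≤ ε := by
  obtain ⟨N, hN⟩ := exists_nat_gt (2 * Real.pi / ε)
  have hN0 : (0 : ℝ) < N := lt_trans (by positivity) hN
  set θ : ℝ → ℝ := fun x => toIcoMod (by positivity : 0 < 2 * Real.pi) 0 (s * x) with hθ
  have hθ0 : ∀ x, 0 ≤ θ x := fun x => left_le_toIcoMod _ _ _
  have hθ1 : ∀ x, θ x < 2 * Real.pi := fun x => by
    have := toIcoMod_lt_right (by positivity : 0 < 2 * Real.pi) 0 (s * x); simpa using this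
  have hexp : ∀ x, Complex.exp ((θ x : ℝ) * Complex.I) = Complex.exp ((s * x : ℝ) * Complex.I) := by
    intro x
    rw [hθ]
    simp only [toIcoMod]
    push_cast
    rw [sub_mul]
    rw [show (toIcoDiv (by positivity : 0 < 2 * Real.pi) 0 (s * x) • (2 * (Real.pi : ℂ))) * Complex.I
      = toIcoDiv (by positivity : 0 < 2 * Real.pi) 0 (s * x) * (2 * Real.pi * Complex.I) by
        rw [zsmul_eq_mul]; ring]
    exact Complex.exp_periodic.sub_int_mul_eq _
  have hθm : Measurable θ := by
    have e : θ = fun x => Int.fract (s * x / (2 * Real.pi)) * (2 * Real.pi) := by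
      funext x
      rw [hθ]
      simp only [toIcoMod_eq_fract_mul]
    rw [e]
    exact (measurable_fract.comp (by fun_prop)).mul_const _
  refine ⟨N, fun x => ⌊θ x * (N / (2 * Real.pi))⌋₊,
    fun k => Complex.exp ((k * (2 * Real.pi / N) : ℝ) * Complex.I), ?_, ?_, ?_, ?_⟩
  · exact Nat.measurable_floor.comp (by fun_prop)
  · intro x
    rw [Nat.floor_lt (by have := hθ0 x; positivity)]
    have := hθ1 x
    rw [← mul_div_assoc, div_lt_iff₀ (by positivity)]
    nlinarith
  · intro k
    exact Complex.norm_exp_ofReal_mul_I _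
  · intro x
    simp only
    rw [← hexp x]
    have hf := Nat.floor_le (a := θ x * (N / (2 * Real.pi))) (by have := hθ0 x; positivity)
    have hf2 := Nat.lt_floor_add_one (θ x * (N / (2 * Real.pi)))
    set k : ℝ := (⌊θ x * (N / (2 * Real.pi))⌋₊ : ℝ)
    have hc : Real.pi ≠ 0 := Real.pi_ne_zero
    have e1 : |k * (2 * Real.pi / N) - θ x| ≤ ε := by
      have e2 : k * (2 * Real.pi / N) - θ x
        = (k - θ x * (N / (2 * Real.pi))) * (2 * Real.pi / N) := by field_simp
      have h3 : 2 * Real.pi / N < ε := by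
        rw [div_lt_iff₀ hN0]; rw [div_lt_iff₀ hε] at hN; linarith
      have h4 : 0 < 2 * Real.pi / N := by positivity
      rw [e2, abs_mul, abs_of_pos h4]
      have h5 : |k - θ x * (N / (2 * Real.pi))| ≤ 1 := abs_le.2 ⟨by linarith, by linarith⟩
      nlinarith
    refine le_trans ?_ e1
    have := Real.norm_exp_I_mul_ofReal_sub_one_le (x := k * (2 * Real.pi / N) - θ x)
    have e6 : Complex.exp ((k * (2 * Real.pi / N) : ℝ) * Complex.I)
        - Complex.exp ((θ x : ℝ) * Complex.I) = Complex.exp ((θ x : ℝ) * Complex.I) *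
        (Complex.exp (Complex.I * ((k * (2 * Real.pi / N) - θ x : ℝ) : ℂ)) - 1) := by
      rw [mul_sub, ← Complex.exp_add, mul_one]
      congr 2
      push_cast
      ring
    rw [e6, norm_mul, Complex.norm_exp_ofReal_mul_I, one_mul]
    simpa using this

/-- `∑ₖ z(k) M(κ = k)`, the integral of the step function `z ∘ κ`. -/
def POVM.stepIntegral (M : POVM H) (N : ℕ) (κ : ℝ → ℕ) (z : ℕ → ℂ) : H →L[ℂ] H :=
  ∑ k ∈ Finset.range N, z k • M.op (κ ⁻¹' {k})

theorem integral_step {μ : Measure ℝ} [IsFiniteMeasure μ] {N : ℕ} {κ : ℝ → ℕ} (hκ : Measurable κ)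
    (hN : ∀ x, κ x < N) (z : ℕ → ℂ) :
    ∫ x, z (κ x) ∂μ = ∑ k ∈ Finset.range N, z k * (μ.real (κ ⁻¹' {k}) : ℂ) := by
  have e : ∀ x, z (κ x) = ∑ k ∈ Finset.range N, (κ ⁻¹' {k}).indicator (fun _ => z k) x := by
    intro x
    rw [Finset.sum_eq_single (κ x)]
    · rw [indicator_of_mem (by simp)]
    · intro k _ hk
      rw [indicator_of_notMem (by simpa using hk.symm)]
    · intro h
      exact absurd (Finset.mem_range.2 (hN x)) h
  simp_rw [e]
  rw [integral_finsetSum _ fun k _ => (integrable_const _).indicator (hκ (measurableSet_singleton k))]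
  refine Finset.sum_congr rfl fun k _ => ?_
  rw [integral_indicator_const _ (hκ (measurableSet_singleton k)), Complex.real_smul, mul_comm]

theorem POVM.inner_stepIntegral (M : POVM H) {N : ℕ} {κ : ℝ → ℕ} (hκ : Measurable κ)
    (hN : ∀ x, κ x < N) (z : ℕ → ℂ) (ψ : H) :
    ⟪ψ, M.stepIntegral N κ z ψ⟫_ℂ = ∫ x, z (κ x) ∂(M.dist ψ) := by
  rw [integral_step hκ hN, stepIntegral, sum_apply, inner_sum]
  refine Finset.sum_congr rfl fun k _ => ?_
  rw [smul_apply, inner_smul_right,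
    M.inner_op_eq_ofReal ψ (hκ (measurableSet_singleton k))]

/-- Cauchy-Schwarz is applied to each positive operator `M.op (κ ⁻¹' {k})`. As the level sets
partition the line, the diagonal terms add up to ‖φ‖² and ‖ψ‖². -/
theorem POVM.norm_stepIntegral_le (M : POVM H) {N : ℕ} {κ : ℝ → ℕ} (hκ : Measurable κ)
    (hN : ∀ x, κ x < N) {z : ℕ → ℂ} (hz : ∀ k, ‖z k‖ = 1) : ‖M.stepIntegral N κ z‖ ≤ 1 := by
  have hsum : ∀ φ : H, ∑ k ∈ Finset.range N, (⟪φ, M.op (κ ⁻¹' {k}) φ⟫_ℂ).re = ‖φ‖ ^ 2 := by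
    intro φ
    have h := integral_step (μ := M.dist φ) hκ hN (fun _ => 1)
    rw [integral_const, measureReal_def, M.dist_univ, ENNReal.toReal_ofReal (by positivity)] at h
    have h' := congrArg Complex.re h
    simp only [Complex.real_smul, mul_one, Complex.ofReal_re, one_mul, Complex.re_sum] at h'
    rw [h']
    refine Finset.sum_congr rfl fun k _ => ?_
    rw [M.inner_op_eq_ofReal φ (hκ (measurableSet_singleton k)), Complex.ofReal_re]
  refine opNorm_le_one_of_norm_inner_le fun φ ψ => ?_
  rw [stepIntegral, sum_apply, inner_sum, ← hsum φ, ← hsum ψ,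
    ← Finset.sum_add_distrib]
  refine (mul_le_mul_of_nonneg_left (norm_sum_le _ _) zero_le_two).trans ?_
  rw [Finset.mul_sum]
  refine Finset.sum_le_sum fun k _ => ?_
  rw [smul_apply, inner_smul_right, norm_mul, hz, one_mul]
  exact two_mul_norm_inner_le_of_isPositive (M.positive _ (hκ (measurableSet_singleton k))) φ ψ

/-- The characteristic operator `∫ e^{isx} M(dx)` exists and is a contraction. -/
theorem POVM.exists_characteristic [CompleteSpace H] (M : POVM H) (s : ℝ) :
    ∃ V : H →L[ℂ] H, ‖V‖ ≤ 1 ∧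
      ∀ ψ, ⟪ψ, V ψ⟫_ℂ = ∫ x, Complex.exp ((s * x : ℝ) * Complex.I) ∂(M.dist ψ) := by
  set ε : ℕ → ℝ := fun n => 1 / ((n : ℝ) + 1) with hε
  have hε0 : ∀ n, 0 < ε n := fun n => by positivity
  choose N κ z hκ hN hz happ using fun n => exists_measurable_nat_approx_exp s (hε0 n)
  set W : ℕ → H →L[ℂ] H := fun n => M.stepIntegral (N n) (κ n) (z n) with hW
  set f : ℝ → ℂ := fun x => Complex.exp ((s * x : ℝ) * Complex.I) with hf
  have hfc : Continuous f := by fun_prop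
  have hfi : ∀ ψ, Integrable f (M.dist ψ) := fun ψ =>
    Integrable.of_bound hfc.aestronglyMeasurable 1
      (Filter.Eventually.of_forall fun x => (Complex.norm_exp_ofReal_mul_I _).le)
  have hzi : ∀ n ψ, Integrable (fun x => z n (κ n x)) (M.dist ψ) := fun n ψ =>
    Integrable.of_bound ((measurable_from_nat.comp (hκ n)).aestronglyMeasurable) 1
      (Filter.Eventually.of_forall fun x => (hz n _).le)
  have hWf : ∀ n ψ, ‖⟪ψ, W n ψ⟫_ℂ - ∫ x, f x ∂(M.dist ψ)‖ ≤ ε n * ‖ψ‖ ^ 2 := by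
    intro n ψ
    rw [hW, M.inner_stepIntegral (hκ n) (hN n), ← integral_sub (hzi n ψ) (hfi ψ)]
    refine (norm_integral_le_of_norm_le_const (C := ε n)
      (Filter.Eventually.of_forall fun x => happ n x)).trans (le_of_eq ?_)
    rw [measureReal_def, M.dist_univ, ENNReal.toReal_ofReal (by positivity)]
  -- The quadratic forms converge uniformly on the unit ball, so by polarization the operators are
  -- Cauchy in norm.
  have hdiff : ∀ n m, ‖W n - W m‖ ≤ 4 * (ε n + ε m) := by
    intro n m
    refine opNorm_le_of_norm_inner_self_le (add_nonneg (hε0 n).le (hε0 m).le) fun ψ => ?_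
    rw [sub_apply, inner_sub_right, add_mul]
    refine le_trans ?_ (add_le_add (hWf n ψ) (hWf m ψ))
    refine le_trans (le_of_eq ?_) (norm_sub_le _ _)
    congr 1
    ring
  have hlim : Filter.Tendsto ε Filter.atTop (nhds 0) := tendsto_one_div_add_atTop_nhds_zero_nat
  have hcauchy : CauchySeq W := by
    refine cauchySeq_of_le_tendsto_0 (fun n => 8 * ε n) (fun n m K hn hm => ?_) ?_
    · rw [dist_eq_norm]
      have h1 : ε n ≤ ε K := one_div_le_one_div_of_le (by positivity) (by exact_mod_cast Nat.succ_le_succ hn)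
      have h2 : ε m ≤ ε K := one_div_le_one_div_of_le (by positivity) (by exact_mod_cast Nat.succ_le_succ hm)
      linarith [hdiff n m]
    · simpa using hlim.const_mul 8
  obtain ⟨V, hV⟩ := cauchySeq_tendsto_of_complete hcauchy
  refine ⟨V, le_of_tendsto hV.norm (Filter.Eventually.of_forall fun n =>
    M.norm_stepIntegral_le (hκ n) (hN n) (hz n)), fun ψ => ?_⟩
  have h1 : Filter.Tendsto (fun n => ⟪ψ, W n ψ⟫_ℂ) Filter.atTop (nhds ⟪ψ, V ψ⟫_ℂ) :=
    tendsto_const_nhds.inner (((ContinuousLinearMap.apply ℂ H ψ).continuous.tendsto V).comp hV)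
  refine tendsto_nhds_unique h1 ?_
  rw [tendsto_iff_norm_sub_tendsto_zero]
  exact squeeze_zero (fun n => norm_nonneg _) (fun n => hWf n ψ) (by simpa using hlim.mul_const _)

end Characteristic

/-! ## Covariant measurements -/

theorem rep_coeFn (g : ℝ) (φ : L2Pos) :
    rep g φ =ᵐ[haarR.restrict (Ici 0)] fun x => Complex.exp ((-(g * x) : ℝ) * Complex.I) * φ x :=
  mulOp_coeFn _ _ φ

theorem rep_neg_rep (g : ℝ) (φ : L2Pos) : rep (-g) (rep g φ) = φ := by
  refine Lp.ext ?_
  filter_upwards [rep_coeFn (-g) (rep g φ), rep_coeFn g φ] with x h1 h2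
  rw [h1, h2, ← mul_assoc, ← Complex.exp_add]
  simp

theorem adjoint_rep (g : ℝ) : ContinuousLinearMap.adjoint (rep g) = rep (-g) := by
  symm
  rw [ContinuousLinearMap.eq_adjoint_iff]
  intro φ ψ
  rw [L2.inner_def, L2.inner_def]
  refine integral_congr_ae ?_
  filter_upwards [rep_coeFn (-g) φ, rep_coeFn g ψ] with x h1 h2
  rw [h1, h2]
  simp only [RCLike.inner_apply, map_mul, ← Complex.exp_conj, Complex.conj_ofReal, Complex.conj_I]
  rw [neg_mul, neg_neg, Complex.ofReal_neg, neg_mul, mul_neg]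
  ring

theorem extendByZero_rep (g : ℝ) (φ : L2Pos) : extendByZero (rep g φ) =ᵐ[haarR]
    fun x => Complex.exp ((-(g * x) : ℝ) * Complex.I) * extendByZero φ x := by
  filter_upwards [extendByZero_coeFn (rep g φ), extendByZero_coeFn φ,
    (ae_restrict_iff' measurableSet_Ici).1 (rep_coeFn g φ)] with x h1 h2 h3
  rw [h1, h2]
  by_cases hx : x ∈ Ici (0 : ℝ)
  · rw [indicator_of_mem hx, indicator_of_mem hx, h3 hx]
  · rw [indicator_of_notMem hx, indicator_of_notMem hx, mul_zero]

theorem IsCovariant.dist_rep_neg {M : POVM L2Pos} (hM : IsCovariant M) (g : ℝ) (ψ : L2Pos) :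
    M.dist (rep (-g) ψ) = (M.dist ψ).map (fun x => x - g) := by
  ext B hB
  rw [Measure.map_apply (by fun_prop) hB, M.dist_apply _ hB, M.dist_apply _ (hB.preimage (by fun_prop))]
  have e : (fun x => x - g) ⁻¹' B = (fun x => g + x) '' B := by
    ext x
    simp only [mem_preimage, mem_image]
    constructor
    · intro h
      exact ⟨x - g, h, by ring⟩
    · rintro ⟨y, hy, rfl⟩
      simpa using hy
  rw [e, ← hM g B hB, ← adjoint_rep, ContinuousLinearMap.comp_apply, ContinuousLinearMap.comp_apply,
    ContinuousLinearMap.adjoint_inner_left]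

/-- The Weyl relation. Translating the outcome distribution by −g multiplies its characteristic
function by e^{−isg}, and over ℂ an operator is determined by its quadratic form. -/
theorem IsCovariant.rep_comp_characteristic {M : POVM L2Pos} (hM : IsCovariant M) {s : ℝ}
    {V : L2Pos →L[ℂ] L2Pos}
    (hV : ∀ ψ, ⟪ψ, V ψ⟫_ℂ = ∫ x, Complex.exp ((s * x : ℝ) * Complex.I) ∂(M.dist ψ)) (g : ℝ) :
    V ∘L rep g = Complex.exp ((s * g : ℝ) * Complex.I) • (rep g ∘L V) := by
  have h1 : rep g ∘L V ∘L rep (-g) = Complex.exp ((-(s * g) : ℝ) * Complex.I) • V := by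
    refine ContinuousLinearMap.coe_injective ((ext_inner_map _ _).1 fun ψ => ?_)
    refine (starRingEnd ℂ).injective ?_
    rw [inner_conj_symm, inner_conj_symm]
    simp only [ContinuousLinearMap.coe_coe, ContinuousLinearMap.comp_apply, smul_apply,
      inner_smul_right]
    rw [← ContinuousLinearMap.adjoint_inner_left, adjoint_rep, hV, hM.dist_rep_neg, hV,
      integral_map (by fun_prop) (Continuous.aestronglyMeasurable (by fun_prop)),
      ← integral_const_mul]
    congr 1
    ext x
    rw [← Complex.exp_add]
    congr 1
    push_cast
    ring
  ext1 ψ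
  have h2 := congrArg (fun T => T (rep g ψ)) h1
  simp only [ContinuousLinearMap.comp_apply, smul_apply, rep_neg_rep] at h2
  rw [ContinuousLinearMap.comp_apply, smul_apply, ContinuousLinearMap.comp_apply, h2, smul_smul,
    ← Complex.exp_add]
  simp

/-- An integrable function is determined by its Fourier transform. -/
theorem ae_eq_zero_of_invFourierInt_eq_zero {F : ℝ → ℂ} (hF : Integrable F)
    (h : ∀ x, invFourierInt F x = 0) : F =ᵐ[volume] 0 := by
  refine ae_eq_zero_of_integral_contDiff_smul_eq_zero hF.locallyIntegrable fun g hg hgc => ?_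
  have hpi : (2 * Real.pi) ≠ 0 := by positivity
  have hc : ((1 / √(2 * Real.pi) : ℝ) : ℂ) ≠ 0 := by
    rw [Complex.ofReal_ne_zero]; positivity
  have h1 : ContDiff ℝ ∞ (fun t => (g (2 * Real.pi * t) : ℂ)) :=
    Complex.ofRealCLM.contDiff.comp (hg.comp (by fun_prop))
  have h2 : HasCompactSupport (fun t => (g (2 * Real.pi * t) : ℂ)) :=
    (hgc.comp_left (g := fun x : ℝ => (x : ℂ)) rfl).comp_homeomorph
      (Homeomorph.mulLeft₀ (2 * Real.pi) hpi)
  set s := h2.toSchwartzMap h1 with hs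
  -- Pairing with the Fourier transform of a dilated test function recovers the test function up to
  -- a constant, by inversion.
  have key := integral_mul_invFourierInt hF (𝓕 s).integrable
  simp only [h, mul_zero, integral_zero] at key
  have e : ∀ y, invFourierInt (𝓕 s : SchwartzMap ℝ ℂ) y = ((1 / √(2 * Real.pi) : ℝ) : ℂ) * (g y : ℂ) := by
    intro y
    rw [invFourierInt_eq, ← SchwartzMap.fourierInv_coe, FourierTransform.fourierInv_fourier_eq, hs,
      HasCompactSupport.toSchwartzMap_toFun, mul_inv_cancel_left₀ hpi]
  simp_rw [e, mul_assoc, integral_const_mul] at key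
  have := (mul_eq_zero.1 key.symm).resolve_left hc
  simpa only [Complex.real_smul] using this

theorem integrable_conj_mul_L2R (φ ψ : L2R) :
    Integrable (fun x => (starRingEnd ℂ) (φ x) * ψ x) := by
  have h : MemLp (fun x => (starRingEnd ℂ) (φ x)) 2 volume := (memLp_volume φ).star
  simpa using! h.integrable_mul (memLp_volume ψ)

theorem inner_extendByZero (φ ψ : L2Pos) : ⟪φ, ψ⟫_ℂ = ((1 / √(2 * Real.pi) : ℝ) : ℂ) *
    ∫ x, (starRingEnd ℂ) (extendByZero φ x) * extendByZero ψ x := by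
  rw [← extendByZero.inner_map_map, L2.inner_def, integral_haarR, Complex.real_smul]
  simp only [RCLike.inner_apply, mul_comm]

/-- An operator that shifts the weights by `s` is, after translation, diagonal. -/
theorem ae_eq_of_shift {s : ℝ} {V : L2Pos →L[ℂ] L2Pos}
    (hV : ∀ g, V ∘L rep g = Complex.exp ((s * g : ℝ) * Complex.I) • (rep g ∘L V)) (φ ψ : L2Pos) :
    ∀ᵐ x, (starRingEnd ℂ) (extendByZero (ContinuousLinearMap.adjoint V φ) x) * extendByZero ψ x
      = (starRingEnd ℂ) (extendByZero φ (x + s)) * extendByZero (V ψ) (x + s) := by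
  set F1 : ℝ → ℂ := fun x => (starRingEnd ℂ) (extendByZero (ContinuousLinearMap.adjoint V φ) x) *
    extendByZero ψ x with hF1
  set F2 : ℝ → ℂ := fun x => (starRingEnd ℂ) (extendByZero φ x) * extendByZero (V ψ) x with hF2
  have i1 : Integrable F1 := integrable_conj_mul_L2R _ _
  have i2 : Integrable F2 := integrable_conj_mul_L2R _ _
  have i3 : Integrable (fun x => F2 (x + s)) := i2.comp_add_right s
  have hc : ((1 / √(2 * Real.pi) : ℝ) : ℂ) ≠ 0 := by
    rw [Complex.ofReal_ne_zero]; positivity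
  -- The matrix elements ⟨φ, V f(−g) ψ⟩, as functions of g, are the transform of F1 up to
  -- normalization; moving V past f(−g) expresses them through F2, and the phase is a translation by
  -- s.
  have key : ∀ g, invFourierInt F1 g = invFourierInt (fun x => F2 (x + s)) g := by
    intro g
    have h1 := congrArg (fun T => ⟪φ, T ψ⟫_ℂ) (hV (-g))
    simp only [ContinuousLinearMap.comp_apply, smul_apply, inner_smul_right] at h1
    rw [← ContinuousLinearMap.adjoint_inner_left, inner_extendByZero, inner_extendByZero] at h1
    rw [invFourierInt_comp_add, invFourierInt, invFourierInt, ← mul_assoc, mul_comm (Complex.exp _),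
      mul_assoc]
    rw [mul_left_comm] at h1
    have h2 := mul_left_cancel₀ hc h1
    congr 1
    have e1 : ∫ x, Complex.exp ((g * x : ℝ) * Complex.I) * F1 x = ∫ x, (starRingEnd ℂ)
        (extendByZero (ContinuousLinearMap.adjoint V φ) x) * extendByZero (rep (-g) ψ) x := by
      refine integral_congr_ae ?_
      filter_upwards [ae_haarR_iff.1 (extendByZero_rep (-g) ψ)] with x hx
      rw [hx, neg_mul, neg_neg]
      ring
    have e2 : ∫ x, Complex.exp ((g * x : ℝ) * Complex.I) * F2 x = ∫ x, (starRingEnd ℂ)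
        (extendByZero φ x) * extendByZero (rep (-g) (V ψ)) x := by
      refine integral_congr_ae ?_
      filter_upwards [ae_haarR_iff.1 (extendByZero_rep (-g) (V ψ))] with x hx
      rw [hx, neg_mul, neg_neg]
      ring
    rw [e1, e2, h2, mul_neg, mul_comm s g]
  have hz : F1 - (fun x => F2 (x + s)) =ᵐ[volume] 0 := by
    refine ae_eq_zero_of_invFourierInt_eq_zero (i1.sub i3) fun g => ?_
    have hexp : ∀ {F : ℝ → ℂ}, Integrable F →
        Integrable fun x => Complex.exp ((g * x : ℝ) * Complex.I) * F x := fun hF =>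
      hF.bdd_mul (c := 1) (Continuous.aestronglyMeasurable (by fun_prop))
        (Filter.Eventually.of_forall fun x => (Complex.norm_exp_ofReal_mul_I _).le)
    have := key g
    rw [invFourierInt, invFourierInt] at this
    rw [invFourierInt]
    simp only [Pi.sub_apply, mul_sub]
    rw [integral_sub (hexp i1) (hexp i3), mul_sub, this, sub_self]
  filter_upwards [hz] with x hx
  exact sub_eq_zero.1 hx

/-- A reference vector without zeros, by which one can divide. -/
theorem memLp_exp_neg : MemLp (fun x : ℝ => ((Real.exp (-x) : ℝ) : ℂ)) 2 (haarR.restrict (Ici 0)) := by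
  have h : MemLp (fun x : ℝ => ((Real.exp (-x) : ℝ) : ℂ)) 2 (volume.restrict (Ici 0)) := by
    rw [memLp_two_iff_integrable_sq_norm (Continuous.aestronglyMeasurable (by fun_prop))]
    have : IntegrableOn (fun x : ℝ => Real.exp (-2 * x)) (Ici 0) := by
      rw [integrableOn_Ici_iff_integrableOn_Ioi]
      exact integrableOn_exp_mul_Ioi (by norm_num) 0
    refine this.congr (Filter.Eventually.of_forall fun x => ?_)
    simp only
    rw [Complex.norm_real, Real.norm_of_nonneg (Real.exp_pos _).le, ← Real.exp_nat_mul]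
    congr 1
    push_cast
    ring
  rw [haarR, Measure.restrict_smul]
  exact h.smul_measure ENNReal.ofReal_ne_top

/-- Taking the reference vector e^{−x} for φ in `ae_eq_of_shift` and dividing by it gives a
multiplier independent of ψ. If |m| > 1 on a set of positive measure in the half line, then V would
enlarge the reference vector cut off to that set. -/
theorem exists_multiplier_of_shift {s : ℝ} (hs : 0 ≤ s) {V : L2Pos →L[ℂ] L2Pos} (hV1 : ‖V‖ ≤ 1)
    (hV : ∀ g, V ∘L rep g = Complex.exp ((s * g : ℝ) * Complex.I) • (rep g ∘L V)) :
    ∃ m : ℝ → ℂ, (∀ᵐ x, 0 ≤ x → ‖m x‖ ≤ 1) ∧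
      ∀ ψ, ∀ᵐ x, extendByZero (V ψ) (x + s) = m x * extendByZero ψ x := by
  set φ₀ : L2Pos := memLp_exp_neg.toLp _ with hφ₀
  have h0 : ∀ᵐ x, 0 ≤ x → extendByZero φ₀ x = ((Real.exp (-x) : ℝ) : ℂ) := by
    filter_upwards [ae_haarR_iff.1 (extendByZero_coeFn φ₀),
      ae_haarR_iff.1 ((ae_restrict_iff' measurableSet_Ici).1 memLp_exp_neg.coeFn_toLp)]
      with x h1 h2 hx
    rw [h1, indicator_of_mem (mem_Ici.2 hx), h2 hx]
  have h0s := (measurePreserving_add_right volume s).quasiMeasurePreserving.ae h0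
  set m : ℝ → ℂ := fun x => (starRingEnd ℂ) (extendByZero (ContinuousLinearMap.adjoint V φ₀) x) /
    ((Real.exp (-(x + s)) : ℝ) : ℂ) with hm
  have hmul : ∀ ψ, ∀ᵐ x, extendByZero (V ψ) (x + s) = m x * extendByZero ψ x := by
    intro ψ
    filter_upwards [ae_eq_of_shift hV φ₀ ψ, h0s, ae_haarR_iff.1 (extendByZero_coeFn ψ),
      (measurePreserving_add_right volume s).quasiMeasurePreserving.ae
        (ae_haarR_iff.1 (extendByZero_coeFn (V ψ)))] with x h1 h2 h3 h4
    -- Left of −s both sides vanish because of the supports; here s ≥ 0 is essential. Elsewhere x +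
    -- s ≥ 0 and the reference vector is known there.
    rcases lt_or_ge x (-s) with hx | hx
    · rw [h3, h4, indicator_of_notMem, indicator_of_notMem, mul_zero]
      · simp only [mem_Ici, not_le]; linarith
      · simp only [mem_Ici, not_le]; linarith
    have hne : ((Real.exp (-(x + s)) : ℝ) : ℂ) ≠ 0 := Complex.ofReal_ne_zero.2 (Real.exp_pos _).ne'
    rw [h2 (by linarith), Complex.conj_ofReal] at h1
    rw [hm]
    simp only
    rw [div_mul_eq_mul_div, h1, mul_div_cancel_left₀ _ hne]
  refine ⟨m, ?_, hmul⟩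
  have hmm : Measurable m := by
    refine Measurable.div ?_ (by fun_prop)
    exact Complex.continuous_conj.measurable.comp (Lp.stronglyMeasurable _).measurable
  set B : Set ℝ := {x | 1 < ‖m x‖} with hB
  have hBm : MeasurableSet B := measurableSet_lt measurable_const hmm.norm
  set ψ : L2Pos := mulOp _ (B.indicator fun _ => 1) (measurable_const.indicator hBm) (fun x => by
    by_cases hx : x ∈ B <;> simp [hx]) φ₀ with hψ
  have hψc : ∀ᵐ x, extendByZero ψ x = (B ∩ Ici 0).indicator (fun x => ((Real.exp (-x) : ℝ) : ℂ)) x := by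
    filter_upwards [ae_haarR_iff.1 (extendByZero_coeFn ψ), ae_haarR_iff.1
      ((ae_restrict_iff' measurableSet_Ici).1 memLp_exp_neg.coeFn_toLp),
      ae_haarR_iff.1 ((ae_restrict_iff' measurableSet_Ici).1 (mulOp_coeFn
        (μ := haarR.restrict (Ici 0)) (m := B.indicator fun _ => 1)
        (measurable_const.indicator hBm) (fun x => by by_cases hx : x ∈ B <;> simp [hx]) φ₀))]
      with x h1 h2 h3
    rw [h1]
    by_cases hx : x ∈ Ici (0 : ℝ)
    · rw [indicator_of_mem hx, hψ, h3 hx, h2 hx]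
      by_cases hxB : x ∈ B
      · simp only [indicator_of_mem hxB, indicator_of_mem (mem_inter hxB hx), one_mul]
      · rw [indicator_of_notMem hxB, indicator_of_notMem (fun h => hxB h.1), zero_mul]
    · rw [indicator_of_notMem hx, indicator_of_notMem (fun h => hx h.2)]
  have hle : ‖extendByZero (V ψ)‖ₑ ^ 2 ≤ ‖extendByZero ψ‖ₑ ^ 2 := by
    have : ‖V ψ‖ ≤ ‖ψ‖ := (V.le_opNorm ψ).trans (mul_le_of_le_one_left (norm_nonneg _) hV1)
    refine pow_le_pow_left₀ (zero_le) ?_ 2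
    rw [← ofReal_norm, ← ofReal_norm, extendByZero.norm_map, extendByZero.norm_map]
    exact ENNReal.ofReal_le_ofReal this
  have hlt : ∫⁻ x, ‖extendByZero ψ x‖ₑ ^ 2 ∂haarR ≠ ⊤ := by
    rw [← enorm_sq_eq_lintegral, ← ofReal_norm]
    exact (ENNReal.pow_lt_top ENNReal.ofReal_lt_top).ne
  -- |m| > 1 on the support gives a pointwise inequality, contractivity the opposite inequality of
  -- finite integrals; so equality holds almost everywhere.
  have hae : (fun x => ‖extendByZero ψ x‖ₑ ^ 2) =ᵐ[haarR]
      fun x => ‖extendByZero (V ψ) (x + s)‖ₑ ^ 2 := by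
    have hme : Measurable fun x => ‖extendByZero (V ψ) x‖ₑ ^ 2 :=
      (Lp.stronglyMeasurable _).measurable.enorm.pow_const 2
    refine ae_eq_of_ae_le_of_lintegral_le (ae_haarR_iff.2 ?_) hlt
      (hme.comp (measurable_add_const s)).aemeasurable ?_
    · filter_upwards [hmul ψ, hψc] with x h1 h2
      rw [h1, enorm_mul, mul_pow]
      by_cases hx : x ∈ B ∩ Ici 0
      · refine le_mul_of_one_le_left (zero_le) (one_le_pow₀ ?_)
        rw [← ofReal_norm, ENNReal.one_le_ofReal]
        exact le_of_lt hx.1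
      · rw [h2, indicator_of_notMem hx]; simp
    · rw [(measurePreserving_add_haarR s).lintegral_comp hme, ← enorm_sq_eq_lintegral,
        ← enorm_sq_eq_lintegral]
      exact hle
  filter_upwards [hmul ψ, hψc, ae_haarR_iff.1 hae] with x h1 h2 h3 hx
  by_contra hx1
  have hxB : x ∈ B ∩ Ici 0 := ⟨not_le.1 hx1, hx⟩
  rw [h1, h2, indicator_of_mem hxB, ← ofReal_norm, ← ofReal_norm,
    ← ENNReal.ofReal_pow (norm_nonneg _), ← ENNReal.ofReal_pow (norm_nonneg _),
    ENNReal.ofReal_eq_ofReal_iff (by positivity) (by positivity), norm_mul, mul_pow] at h3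
  have hpos : 0 < ‖((Real.exp (-x) : ℝ) : ℂ)‖ ^ 2 := by
    have : ((Real.exp (-x) : ℝ) : ℂ) ≠ 0 := Complex.ofReal_ne_zero.2 (Real.exp_pos _).ne'
    positivity
  have h4 : 1 < ‖m x‖ ^ 2 := one_lt_pow₀ (not_le.1 hx1) two_ne_zero
  nlinarith

theorem integrable_norm_mul_norm (φ ψ : L2R) : Integrable (fun x => ‖φ x‖ * ‖ψ x‖) haarR := by
  simpa using! (Lp.memLp φ).norm.integrable_mul (Lp.memLp ψ).norm

/-- The characteristic function of the outcomes of a covariant measurement. -/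
theorem IsCovariant.integral_cos_le {M : POVM L2Pos} (hM : IsCovariant M) {s : ℝ} (hs : 0 ≤ s)
    (φ : L2Pos) : ∫ x, Real.cos (s * x) ∂(M.dist φ)
      ≤ ∫ x, ‖extendByZero φ (x + s)‖ * ‖extendByZero φ x‖ ∂haarR := by
  obtain ⟨V, hV1, hV⟩ := M.exists_characteristic s
  obtain ⟨m, hm1, hm⟩ := exists_multiplier_of_shift hs hV1 fun g => hM.rep_comp_characteristic hV g
  have hre : ∫ x, Real.cos (s * x) ∂(M.dist φ) = (⟪φ, V φ⟫_ℂ).re := by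
    have hi : Integrable (fun x : ℝ => Complex.exp ((s * x : ℝ) * Complex.I)) (M.dist φ) :=
      Integrable.of_bound (Continuous.aestronglyMeasurable (by fun_prop)) 1
        (Filter.Eventually.of_forall fun x => (Complex.norm_exp_ofReal_mul_I _).le)
    rw [hV]
    have := Complex.reCLM.integral_comp_comm hi
    simp only [Complex.reCLM_apply, Complex.exp_ofReal_mul_I_re] at this
    exact this
  have hex : ⟪φ, V φ⟫_ℂ = ∫ x, (starRingEnd ℂ) (extendByZero φ (x + s)) *
      (m x * extendByZero φ x) ∂haarR := by
    rw [inner_extendByZero, integral_haarR, Complex.real_smul, ← integral_add_right_eq_self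
      (fun x => (starRingEnd ℂ) (extendByZero φ x) * extendByZero (V φ) x) s]
    congr 1
    refine integral_congr_ae ?_
    filter_upwards [hm φ] with x hx
    rw [hx]
  rw [hre, hex]
  refine (Complex.re_le_norm _).trans ?_
  set φs : L2R := (memLp_comp_add (extendByZero φ) s).toLp _
  have hφs : φs =ᵐ[haarR] fun x => extendByZero φ (x + s) :=
    (memLp_comp_add (extendByZero φ) s).coeFn_toLp
  have hint : Integrable (fun x => ‖extendByZero φ (x + s)‖ * ‖extendByZero φ x‖) haarR := by
    refine (integrable_norm_mul_norm φs (extendByZero φ)).congr ?_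
    filter_upwards [hφs] with x hx
    rw [hx]
  refine norm_integral_le_of_norm_le hint (ae_haarR_iff.2 ?_)
  filter_upwards [hm1, ae_haarR_iff.1 (extendByZero_coeFn φ)] with x h1 h2
  rw [norm_mul, norm_mul, RCLike.norm_conj]
  refine mul_le_mul_of_nonneg_left ?_ (norm_nonneg _)
  by_cases hx : 0 ≤ x
  · exact mul_le_of_le_one_left (norm_nonneg _) (h1 hx)
  · rw [h2, indicator_of_notMem (by simpa using hx)]
    simp

/-! ### The modulus of a wave function and its difference quotients -/

theorem memLp_abs (φ : L2R) : MemLp (fun x => ((‖φ x‖ : ℝ) : ℂ)) 2 haarR :=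
  (Lp.memLp φ).norm.ofReal

/-- The modulus `|φ|` of a function in `L²(ℝ)`. -/
def absL2R (φ : L2R) : L2R := (memLp_abs φ).toLp _

theorem absL2R_coeFn (φ : L2R) : absL2R φ =ᵐ[haarR] fun x => ((‖φ x‖ : ℝ) : ℂ) :=
  (memLp_abs φ).coeFn_toLp

theorem norm_sq_eq_integral (φ : L2R) : ‖φ‖ ^ 2 = ∫ x, ‖φ x‖ ^ 2 ∂haarR := by
  have h := L2.inner_def (𝕜 := ℂ) φ φ
  simp only [inner_self_eq_norm_sq_to_K] at h
  have h2 : ∀ x, ((‖φ x‖ : ℂ)) ^ 2 = ((‖φ x‖ ^ 2 : ℝ) : ℂ) := fun x => by push_cast; rfl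
  simp only [Complex.coe_algebraMap] at h
  simp_rw [h2] at h
  rw [integral_complex_ofReal] at h
  exact_mod_cast h

/-- The uncertainty of the outcomes of a covariant measurement dominates the difference quotients
of `|φ|`. -/
theorem IsCovariant.lintegral_cos_le {M : POVM L2Pos} (hM : IsCovariant M) {s : ℝ} (hs : 0 ≤ s)
    (φ : L2Pos) :
    ∫⁻ x, ENNReal.ofReal (2 * (1 - Real.cos (s * x))) *
        ‖invFourier (absL2R (extendByZero φ)) x‖ₑ ^ 2 ∂haarR
      ≤ ∫⁻ x, ENNReal.ofReal (2 * (1 - Real.cos (s * x))) ∂(M.dist φ) := by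
  rw [← lintegral_enorm_comp_add_sub]
  set χ := extendByZero φ with hχ
  have habs := absL2R_coeFn χ
  have habs' := (measurePreserving_add_haarR s).quasiMeasurePreserving.ae habs
  set χs : L2R := (memLp_comp_add χ s).toLp _
  have hχs : χs =ᵐ[haarR] fun x => χ (x + s) := (memLp_comp_add χ s).coeFn_toLp
  have j1 : Integrable (fun x => ‖χ x‖ ^ 2) haarR := by
    have := (Lp.memLp χ).integrable_norm_pow (by norm_num)
    simpa using this
  have j2 : Integrable (fun x => ‖χ (x + s)‖ ^ 2) haarR :=
    (measurePreserving_add_haarR s).integrable_comp_of_integrable j1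
  have j3 : Integrable (fun x => ‖χ (x + s)‖ * ‖χ x‖) haarR := by
    refine (integrable_norm_mul_norm χs χ).congr ?_
    filter_upwards [hχs] with x hx
    rw [hx]
  have hexp : ∀ x, (‖χ (x + s)‖ - ‖χ x‖) ^ 2
      = ‖χ (x + s)‖ ^ 2 + ‖χ x‖ ^ 2 - 2 * (‖χ (x + s)‖ * ‖χ x‖) := fun x => by ring
  have j4 : Integrable (fun x => (‖χ (x + s)‖ - ‖χ x‖) ^ 2) haarR := by
    simp_rw [hexp]
    exact (j2.add j1).sub (j3.const_mul 2)
  have hcosb : ∀ x, ‖Real.cos (s * x)‖ ≤ 1 := fun x => Real.abs_cos_le_one _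
  have j5 : Integrable (fun x => Real.cos (s * x)) (M.dist φ) :=
    Integrable.of_bound (Continuous.aestronglyMeasurable (by fun_prop)) 1
      (Filter.Eventually.of_forall hcosb)
  have e1 : ∫⁻ x, ‖absL2R χ (x + s) - absL2R χ x‖ₑ ^ 2 ∂haarR
      = ENNReal.ofReal (∫ x, (‖χ (x + s)‖ - ‖χ x‖) ^ 2 ∂haarR) := by
    rw [ofReal_integral_eq_lintegral_ofReal j4 (Filter.Eventually.of_forall fun x => sq_nonneg _)]
    refine lintegral_congr_ae ?_
    filter_upwards [habs, habs'] with x h1 h2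
    rw [h1, h2, ← Complex.ofReal_sub, ← ofReal_norm, Complex.norm_real,
      ← ENNReal.ofReal_pow (norm_nonneg _), Real.norm_eq_abs, sq_abs]
  have j6 : Integrable (fun x => 2 * (1 - Real.cos (s * x))) (M.dist φ) :=
    ((integrable_const 1).sub j5).const_mul 2
  rw [e1, ← ofReal_integral_eq_lintegral_ofReal j6 (Filter.Eventually.of_forall fun x => by
      have := Real.cos_le_one (s * x)
      simp only [Pi.zero_apply]
      linarith)]
  -- Both sides are 2‖φ‖² minus twice an overlap: ∫ |φ(x+s)||φ(x)| on the left, ∫ cos(sx) on the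
  -- right. What remains is `integral_cos_le`.
  refine ENNReal.ofReal_le_ofReal ?_
  have hsum : Integrable (fun x => ‖χ (x + s)‖ ^ 2 + ‖χ x‖ ^ 2) haarR := j2.add j1
  have hsh : ∫ x, ‖χ (x + s)‖ ^ 2 ∂haarR = ∫ x, ‖χ x‖ ^ 2 ∂haarR := by
    rw [integral_haarR, integral_haarR, integral_add_right_eq_self (fun x => ‖χ x‖ ^ 2) s]
  simp_rw [hexp]
  rw [integral_sub hsum (j3.const_mul 2), integral_add j2 j1, hsh, integral_const_mul,
    integral_const_mul]
  have hc : ∫ x, (1 - Real.cos (s * x)) ∂(M.dist φ)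
      = ‖φ‖ ^ 2 - ∫ x, Real.cos (s * x) ∂(M.dist φ) := by
    rw [integral_sub (integrable_const 1) j5, integral_const, measureReal_def, M.dist_univ,
      ENNReal.toReal_ofReal (by positivity), smul_eq_mul, mul_one]
  have hN : ∫ x, ‖χ x‖ ^ 2 ∂haarR = ‖φ‖ ^ 2 := by
    rw [← norm_sq_eq_integral, hχ, extendByZero.norm_map]
  have := hM.integral_cos_le hs φ
  rw [hc, hN]
  linarith

/-! ## Basis independence of traces -/

theorem tsum_enorm_inner_sq {H : Type*} [NormedAddCommGroup H] [InnerProductSpace ℂ H] {ι : Type*}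
    (b : HilbertBasis ι ℂ H) (x : H) :
    ∑' i, ‖⟪b i, x⟫_ℂ‖ₑ ^ 2 = ‖x‖ₑ ^ 2 := by
  have h := Complex.hasSum_re (b.hasSum_inner_mul_inner x x)
  have e : ∀ i, (⟪x, b i⟫_ℂ * ⟪b i, x⟫_ℂ).re = ‖⟪b i, x⟫_ℂ‖ ^ 2 := fun i => by
    rw [← inner_conj_symm x, mul_comm, Complex.mul_conj, Complex.ofReal_re,
      Complex.normSq_eq_norm_sq]
  simp_rw [e] at h
  have e2 : (⟪x, x⟫_ℂ).re = ‖x‖ ^ 2 := by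
    rw [inner_self_eq_norm_sq_to_K]; norm_cast
  rw [e2] at h
  have h2 := ENNReal.ofReal_tsum_of_nonneg (fun i => sq_nonneg ‖⟪b i, x⟫_ℂ‖) h.summable
  rw [h.tsum_eq, ENNReal.ofReal_pow (norm_nonneg _), ofReal_norm] at h2
  rw [h2]
  refine tsum_congr fun i => ?_
  rw [ENNReal.ofReal_pow (norm_nonneg _), ofReal_norm]

section Trace

variable {H H' : Type*} [NormedAddCommGroup H] [InnerProductSpace ℂ H] [CompleteSpace H]
  [NormedAddCommGroup H'] [InnerProductSpace ℂ H'] [CompleteSpace H']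

/-- Parseval in both bases and an interchange of nonnegative sums. -/
theorem tsum_enorm_sq_adjoint {ι κ : Type*} (b : HilbertBasis ι ℂ H) (c : HilbertBasis κ ℂ H')
    (A : H →L[ℂ] H') :
    ∑' i, ‖A (b i)‖ₑ ^ 2 = ∑' j, ‖ContinuousLinearMap.adjoint A (c j)‖ₑ ^ 2 := by
  simp_rw [← tsum_enorm_inner_sq c, ← tsum_enorm_inner_sq b]
  rw [ENNReal.tsum_comm]
  refine tsum_congr fun j => tsum_congr fun i => ?_
  rw [ContinuousLinearMap.adjoint_inner_right, ← ofReal_norm, ← ofReal_norm, norm_inner_symm]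

/-- The Hilbert-Schmidt norm does not depend on the basis. -/
theorem tsum_enorm_sq_eq {ι κ : Type*} (b : HilbertBasis ι ℂ H) (c : HilbertBasis κ ℂ H)
    (A : H →L[ℂ] H') : ∑' i, ‖A (b i)‖ₑ ^ 2 = ∑' j, ‖A (c j)‖ₑ ^ 2 := by
  rw [tsum_enorm_sq_adjoint b (onb H') A, tsum_enorm_sq_adjoint c (onb H') A]

/-- The square root of a positive operator. -/
def sqrtOp (A : H →L[ℂ] H) : H →L[ℂ] H := CFC.sqrt A

theorem rootVec_eq (ρ : H →L[ℂ] H) (i : basisIndex H) : rootVec ρ i = sqrtOp ρ (onb H i) := rfl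

theorem sqrt_isPositive (A : H →L[ℂ] H) : (sqrtOp A).IsPositive :=
  (ContinuousLinearMap.nonneg_iff_isPositive _).1 (CFC.sqrt_nonneg A)

theorem sqrt_apply_sqrt_apply {A : H →L[ℂ] H} (hA : A.IsPositive) (x : H) :
    sqrtOp A (sqrtOp A x) = A x :=
  congrArg (fun T : H →L[ℂ] H => T x)
    (CFC.sqrt_mul_sqrt_self A ((ContinuousLinearMap.nonneg_iff_isPositive _).2 hA))

theorem inner_sqrt_left (A : H →L[ℂ] H) (x y : H) : ⟪sqrtOp A x, y⟫_ℂ = ⟪x, sqrtOp A y⟫_ℂ :=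
  (sqrt_isPositive A).1 x y

theorem ofReal_re_inner_eq {A : H →L[ℂ] H} (hA : A.IsPositive) (x : H) :
    ENNReal.ofReal (⟪x, A x⟫_ℂ).re = ‖sqrtOp A x‖ₑ ^ 2 := by
  rw [← sqrt_apply_sqrt_apply hA, ← inner_sqrt_left, inner_self_eq_norm_sq_to_K, ← ofReal_norm,
    ← ENNReal.ofReal_pow (norm_nonneg _)]
  norm_cast

theorem IsDensity.tsum_enorm_sq {ρ : H →L[ℂ] H} (hρ : IsDensity ρ) {ι : Type*}
    (b : HilbertBasis ι ℂ H) : ∑' i, ‖sqrtOp ρ (b i)‖ₑ ^ 2 = 1 := by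
  rw [tsum_enorm_sq_eq b (onb H), ← hρ.2, trPos]
  exact tsum_congr fun i => (ofReal_re_inner_eq hρ.1 _).symm

/-- The mass of B is the squared Hilbert-Schmidt norm of √M(B) √ρ. The free choice of basis is used
in the equality case, where the basis must contain a given vector. -/
theorem POVM.outcome_eq_sum (M : POVM H) (ρ : H →L[ℂ] H) {ι : Type*} (b : HilbertBasis ι ℂ H) :
    M.outcome ρ = Measure.sum fun i => M.dist (sqrtOp ρ (b i)) := by
  ext B hB
  rw [outcome, Measure.sum_apply _ hB, Measure.sum_apply _ hB]
  simp_rw [M.dist_apply _ hB, ofReal_re_inner_eq (M.positive B hB), rootVec_eq]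
  exact tsum_enorm_sq_eq (onb H) b (sqrtOp (M.op B) ∘L sqrtOp ρ)

end Trace

theorem withDensity_apply_eq_enorm_sq (φ : L2R) {B : Set ℝ} (hB : MeasurableSet B) :
    haarR.withDensity (fun x => ‖φ x‖ₑ ^ 2) B = ‖projOp B hB φ‖ₑ ^ 2 := by
  rw [withDensity_apply _ hB, enorm_sq_eq_lintegral, ← lintegral_indicator hB]
  refine lintegral_congr_ae ?_
  filter_upwards [mulOp_coeFn (μ := haarR) (m := B.indicator fun _ => 1)
    (measurable_const.indicator hB) (fun x => by by_cases hx : x ∈ B <;> simp [hx]) φ] with x hx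
  rw [projOp, hx]
  by_cases hxB : x ∈ B
  · simp [hxB]
  · simp [hxB]

/-- Reading the sum as the integral of x² against one measure replaces the unbounded Q² by bounded
spectral projections, for which the Hilbert-Schmidt argument applies. -/
theorem energy_eq_tsum (ρ : L2Pos →L[ℂ] L2Pos) {ι : Type*} (b : HilbertBasis ι ℂ L2Pos) :
    energy ρ = ∑' i, secondMoment (extendByZero (sqrtOp ρ (b i))) := by
  rw [energy]
  simp_rw [secondMoment_eq_lintegral_withDensity]
  rw [← lintegral_sum_measure, ← lintegral_sum_measure]
  congr 1
  ext B hB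
  rw [Measure.sum_apply _ hB, Measure.sum_apply _ hB]
  simp_rw [withDensity_apply_eq_enorm_sq _ hB, rootVec_eq]
  exact tsum_enorm_sq_eq (onb L2Pos) b
    (projOp B hB ∘L extendByZero.toContinuousLinearMap ∘L sqrtOp ρ)

/-! ## The lower bound -/

theorem memLp_absPos (φ : L2Pos) : MemLp (fun x => ((‖φ x‖ : ℝ) : ℂ)) 2 (haarR.restrict (Ici 0)) :=
  (Lp.memLp φ).norm.ofReal

/-- The modulus `|φ|` of a function in `L²(ℝ₊)`. -/
def absPos (φ : L2Pos) : L2Pos := (memLp_absPos φ).toLp _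

theorem absPos_coeFn (φ : L2Pos) :
    absPos φ =ᵐ[haarR.restrict (Ici 0)] fun x => ((‖φ x‖ : ℝ) : ℂ) :=
  (memLp_absPos φ).coeFn_toLp

theorem enorm_absPos (φ : L2Pos) : ‖absPos φ‖ₑ = ‖φ‖ₑ := by
  rw [Lp.enorm_def, Lp.enorm_def]
  refine eLpNorm_congr_norm_ae ?_
  filter_upwards [absPos_coeFn φ] with x hx
  rw [hx, Complex.norm_real, norm_norm]

theorem extendByZero_absPos (φ : L2Pos) : extendByZero (absPos φ) = absL2R (extendByZero φ) := by
  refine Lp.ext ?_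
  filter_upwards [extendByZero_coeFn (absPos φ), absL2R_coeFn (extendByZero φ),
    extendByZero_coeFn φ, (ae_restrict_iff' measurableSet_Ici).1 (absPos_coeFn φ)] with x h1 h2 h3 h4
  rw [h1, h2, h3]
  by_cases hx : x ∈ Ici (0 : ℝ)
  · rw [indicator_of_mem hx, indicator_of_mem hx, h4 hx]
  · rw [indicator_of_notMem hx, indicator_of_notMem hx, norm_zero, Complex.ofReal_zero]

theorem secondMoment_absL2R (φ : L2R) : secondMoment (absL2R φ) = secondMoment φ := by
  refine lintegral_congr_ae ?_
  filter_upwards [absL2R_coeFn φ] with x hx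
  rw [hx, ← ofReal_norm, Complex.norm_real, norm_norm, ofReal_norm]

/-- Passing to |φ| changes neither the norm nor the second moment. Only the modulus is constrained,
since a covariant measurement controls only the difference quotients of |φ|. -/
theorem uncertainty_absPos {a : ℝ} (ha : 0 < a) (φ : L2Pos) :
    ENNReal.ofReal (3 * a) * ‖φ‖ₑ ^ 2 ≤ momentumForm (absL2R (extendByZero φ))
      + ENNReal.ofReal (a ^ 2) * secondMoment (extendByZero φ) ∧
    (secondMoment (extendByZero φ) ≠ ⊤ →
      momentumForm (absL2R (extendByZero φ))
        + ENNReal.ofReal (a ^ 2) * secondMoment (extendByZero φ)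
        ≤ ENNReal.ofReal (3 * a) * ‖φ‖ₑ ^ 2 →
      ∃ c : ℝ, 0 ≤ c ∧ ∀ᵐ x ∂haarR.restrict (Ici 0),
        ‖φ x‖ = c * (x * Real.exp (-(a * x ^ 2) / 2))) := by
  have h := uncertainty_L2Pos ha (absPos φ)
  rw [enorm_absPos, extendByZero_absPos, secondMoment_absL2R] at h
  refine ⟨h.1, fun h1 h2 => ?_⟩
  obtain ⟨c, hc⟩ := h.2 h1 h2
  refine ⟨‖c‖, norm_nonneg c, ?_⟩
  filter_upwards [hc, absPos_coeFn φ, ae_restrict_mem measurableSet_Ici] with x h3 h4 h5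
  have h6 := congrArg norm (h4.symm.trans h3)
  have h5 : 0 ≤ x := h5
  rwa [norm_mul, Complex.norm_real, Complex.norm_real, norm_norm,
    Real.norm_of_nonneg (by positivity)] at h6

theorem rep_zero : rep 0 = 1 := by
  refine ContinuousLinearMap.ext fun φ => Lp.ext ?_
  filter_upwards [rep_coeFn 0 φ] with x hx
  rw [hx]
  simp

theorem errorAt_zero (ρ : L2Pos →L[ℂ] L2Pos) (M : POVM L2Pos) :
    errorAt 0 ρ M = ∫⁻ x, ENNReal.ofReal (x ^ 2) ∂(M.outcome ρ) := by
  have h : rep 0 ∘L ρ ∘L ContinuousLinearMap.adjoint (rep 0) = ρ := by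
    rw [adjoint_rep, neg_zero, rep_zero]
    rfl
  rw [errorAt, h]
  simp

/-- The error at g = 0 already suffices. The momentum forms together are the second moment of a sum
of measures, which `lintegral_sq_le_of_lintegral_cos_le` bounds through ∫ 2(1 − cos sx). Covariance
compares that with the outcome distribution, and 2(1 − cos sx) ≤ s²x² finishes. -/
theorem IsCovariant.tsum_momentumForm_le {M : POVM L2Pos} (hM : IsCovariant M)
    (ρ : L2Pos →L[ℂ] L2Pos) {ι : Type*} (b : HilbertBasis ι ℂ L2Pos) :
    ∑' i, momentumForm (absL2R (extendByZero (sqrtOp ρ (b i)))) ≤ worstError ρ M := by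
  refine le_trans ?_ (le_iSup (fun g => errorAt g ρ M) 0)
  rw [errorAt_zero, M.outcome_eq_sum ρ b]
  simp_rw [momentumForm_eq_secondMoment, secondMoment_eq_lintegral_withDensity]
  rw [← lintegral_sum_measure]
  refine lintegral_sq_le_of_lintegral_cos_le _ _ fun s hs => ?_
  calc ∫⁻ x, ENNReal.ofReal (2 * (1 - Real.cos (s * x))) ∂_
      ≤ ∫⁻ x, ENNReal.ofReal (2 * (1 - Real.cos (s * x)))
        ∂Measure.sum fun i => M.dist (sqrtOp ρ (b i)) := by
        rw [lintegral_sum_measure, lintegral_sum_measure]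
        refine ENNReal.tsum_le_tsum fun i => le_trans (le_of_eq ?_) (hM.lintegral_cos_le hs.le _)
        rw [lintegral_withDensity_eq_lintegral_mul _
          ((Lp.stronglyMeasurable _).measurable.enorm.pow_const 2) (by fun_prop)]
        simp_rw [Pi.mul_apply, mul_comm]
    _ ≤ ∫⁻ x, ENNReal.ofReal (s ^ 2) * ENNReal.ofReal (x ^ 2)
        ∂Measure.sum fun i => M.dist (sqrtOp ρ (b i)) := by
        refine lintegral_mono fun x => ?_
        rw [← ENNReal.ofReal_mul (sq_nonneg s)]
        refine ENNReal.ofReal_le_ofReal ?_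
        have := Real.one_sub_sq_div_two_le_cos (x := s * x)
        nlinarith
    _ = _ := lintegral_const_mul _ (by fun_prop)

/-- The termwise uncertainty relations are summed, the trace condition giving the left side. Being
affine in error and energy, the bound can be averaged over a randomized scheme. -/
theorem IsDensity.le_worstError_add_energy {ρ : L2Pos →L[ℂ] L2Pos} (hρ : IsDensity ρ)
    {M : POVM L2Pos} (hM : IsCovariant M) {a : ℝ} (ha : 0 < a) :
    ENNReal.ofReal (3 * a) ≤ worstError ρ M + ENNReal.ofReal (a ^ 2) * energy ρ := by
  have b := onb L2Pos
  refine le_trans ?_ (add_le_add_left (hM.tsum_momentumForm_le ρ b) _)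
  rw [energy_eq_tsum ρ b, ← ENNReal.tsum_mul_left, ← ENNReal.tsum_add,
    ← mul_one (ENNReal.ofReal (3 * a)), ← hρ.tsum_enorm_sq b, ← ENNReal.tsum_mul_left]
  exact ENNReal.tsum_le_tsum fun i => (uncertainty_absPos ha _).1

/-- In the case of equality the moduli of all vectors in the range of `√ρ` are proportional. -/
theorem IsDensity.exists_norm_sqrt_eq {ρ : L2Pos →L[ℂ] L2Pos} (hρ : IsDensity ρ)
    {M : POVM L2Pos} (hM : IsCovariant M) {a : ℝ} (ha : 0 < a)
    (h : worstError ρ M + ENNReal.ofReal (a ^ 2) * energy ρ ≤ ENNReal.ofReal (3 * a)) (e : L2Pos) :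
    ∃ c : ℝ, 0 ≤ c ∧ ∀ᵐ x ∂haarR.restrict (Ici 0),
      ‖sqrtOp ρ e x‖ = c * (x * Real.exp (-(a * x ^ 2) / 2)) := by
  have ha2 : ENNReal.ofReal (a ^ 2) ≠ 0 := by
    rw [Ne, ENNReal.ofReal_eq_zero, not_le]; positivity
  have hen : energy ρ ≠ ⊤ := fun h0 => by
    rw [h0, ENNReal.mul_top ha2, add_top, top_le_iff] at h
    exact ENNReal.ofReal_ne_top h
  have hunit : ∀ e : L2Pos, ‖e‖ = 1 → ∃ c : ℝ, 0 ≤ c ∧ ∀ᵐ x ∂haarR.restrict (Ici 0),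
      ‖sqrtOp ρ e x‖ = c * (x * Real.exp (-(a * x ^ 2) / 2)) := by
    intro e he
    have ho : Orthonormal ℂ ((↑) : ({e} : Set L2Pos) → L2Pos) := by
      refine ⟨fun i => ?_, fun i j hij => absurd (Subsingleton.elim i j) hij⟩
      rw [show (i : L2Pos) = e from i.2, he]
    -- The given unit vector is made a basis vector. The termwise inequalities then add up to an
    -- equality with finite total, so each one is an equality, in particular the one for this
    -- vector.
    obtain ⟨w, b, hw, hb⟩ := ho.exists_hilbertBasis_extension
    have hbi : b ⟨e, hw rfl⟩ = e := congrFun hb _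
    set f : w → ℝ≥0∞ := fun i => ENNReal.ofReal (3 * a) * ‖sqrtOp ρ (b i)‖ₑ ^ 2
    set g : w → ℝ≥0∞ := fun i => momentumForm (absL2R (extendByZero (sqrtOp ρ (b i))))
      + ENNReal.ofReal (a ^ 2) * secondMoment (extendByZero (sqrtOp ρ (b i))) with hg
    have hfsum : ∑' i, f i = ENNReal.ofReal (3 * a) := by
      rw [ENNReal.tsum_mul_left, hρ.tsum_enorm_sq b, mul_one]
    have hgsum : ∑' i, g i ≤ ENNReal.ofReal (3 * a) := by
      refine le_trans ?_ h
      rw [hg, ENNReal.tsum_add, ENNReal.tsum_mul_left, ← energy_eq_tsum ρ b]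
      exact add_le_add_left (hM.tsum_momentumForm_le ρ b) _
    have hle : ∀ i, f i ≤ g i := fun i => (uncertainty_absPos ha _).1
    have hge : g ⟨e, hw rfl⟩ ≤ f ⟨e, hw rfl⟩ := by
      by_contra! hlt
      have := ENNReal.tsum_lt_tsum (f := f) (g := g) (by rw [hfsum]; exact ENNReal.ofReal_ne_top) hle hlt
      rw [hfsum] at this
      exact absurd (this.trans_le hgsum) (lt_irrefl _)
    have hsm : secondMoment (extendByZero (sqrtOp ρ (b ⟨e, hw rfl⟩))) ≠ ⊤ := by
      rw [energy_eq_tsum ρ b] at hen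
      exact ENNReal.ne_top_of_tsum_ne_top hen _
    have := (uncertainty_absPos ha _).2 hsm hge
    rwa [hbi] at this
  rcases eq_or_ne e 0 with rfl | he
  · refine ⟨0, le_rfl, ?_⟩
    rw [map_zero]
    filter_upwards [Lp.coeFn_zero ℂ 2 (haarR.restrict (Ici 0))] with x hx
    rw [hx]; simp
  · have hpos : 0 < ‖e‖ := norm_pos_iff.2 he
    obtain ⟨c, hc0, hc⟩ := hunit (((‖e‖⁻¹ : ℝ) : ℂ) • e) (by
      rw [norm_smul, Complex.norm_real, Real.norm_of_nonneg (by positivity),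
        inv_mul_cancel₀ hpos.ne'])
    refine ⟨‖e‖ * c, by positivity, ?_⟩
    rw [map_smul] at hc
    filter_upwards [hc, Lp.coeFn_smul (((‖e‖⁻¹ : ℝ) : ℂ)) (sqrtOp ρ e)] with x h1 h2
    rw [h2, Pi.smul_apply, norm_smul, Complex.norm_real, Real.norm_of_nonneg (by positivity)] at h1
    rw [mul_assoc, ← h1, mul_inv_cancel_left₀ hpos.ne']

/-! ## Pure states -/

section PureState

variable {H H' : Type*} [NormedAddCommGroup H] [InnerProductSpace ℂ H]
  [NormedAddCommGroup H'] [InnerProductSpace ℂ H']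

theorem pureState_apply (φ x : H) : pureState φ x = ⟪φ, x⟫_ℂ • φ := rfl

theorem isPositive_pureState (φ : H) : (pureState φ).IsPositive :=
  InnerProductSpace.isPositive_rankOne_self φ

theorem pureState_smul {c : ℂ} (hc : ‖c‖ = 1) (φ : H) : pureState (c • φ) = pureState φ := by
  refine ContinuousLinearMap.ext fun x => ?_
  rw [pureState_apply, pureState_apply, inner_smul_left, smul_smul, mul_right_comm,
    mul_comm _ c, Complex.mul_conj, Complex.normSq_eq_norm_sq, hc]
  simp

variable [CompleteSpace H]

theorem sqrtOp_eq_of_mul_self {A B : H →L[ℂ] H} (hB : B.IsPositive) (h : B * B = A) :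
    sqrtOp A = B :=
  CFC.sqrt_unique h ((ContinuousLinearMap.nonneg_iff_isPositive _).2 hB)

theorem sqrtOp_pureState {φ : H} (hφ : ‖φ‖ = 1) : sqrtOp (pureState φ) = pureState φ := by
  refine sqrtOp_eq_of_mul_self (isPositive_pureState φ) (ContinuousLinearMap.ext fun x => ?_)
  rw [mul_apply_eq_comp, pureState_apply, pureState_apply, inner_smul_right,
    inner_self_eq_norm_sq_to_K, hφ]
  simp

theorem tsum_enorm_sq_pureState {ι : Type*} (b : HilbertBasis ι ℂ H) {φ : H} (hφ : ‖φ‖ = 1)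
    (A : H →L[ℂ] H') : ∑' i, ‖A (sqrtOp (pureState φ) (b i))‖ₑ ^ 2 = ‖A φ‖ₑ ^ 2 := by
  have h : ∀ i, ‖A (sqrtOp (pureState φ) (b i))‖ₑ ^ 2 = ‖⟪b i, φ⟫_ℂ‖ₑ ^ 2 * ‖A φ‖ₑ ^ 2 := fun i => by
    rw [sqrtOp_pureState hφ, pureState_apply, map_smul, enorm_smul, mul_pow, ← ofReal_norm,
      norm_inner_symm, ofReal_norm]
  simp_rw [h]
  rw [ENNReal.tsum_mul_right, tsum_enorm_inner_sq, ← ofReal_norm φ, hφ]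
  simp

theorem isDensity_pureState {φ : H} (hφ : ‖φ‖ = 1) : IsDensity (pureState φ) := by
  refine ⟨isPositive_pureState φ, ?_⟩
  rw [trPos]
  simp_rw [ofReal_re_inner_eq (isPositive_pureState φ)]
  have h := tsum_enorm_sq_pureState (onb H) hφ (1 : H →L[ℂ] H)
  simp only [one_apply_eq_self] at h
  rw [h, ← ofReal_norm φ, hφ]
  simp

theorem POVM.outcome_pureState (M : POVM H) {φ : H} (hφ : ‖φ‖ = 1) :
    M.outcome (pureState φ) = M.dist φ := by
  ext B hB
  rw [M.outcome_eq_sum _ (onb H), Measure.sum_apply _ hB]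
  simp_rw [M.dist_apply _ hB, ofReal_re_inner_eq (M.positive B hB)]
  exact tsum_enorm_sq_pureState (onb H) hφ (sqrtOp (M.op B))

theorem comp_pureState_comp_adjoint (U : H →L[ℂ] H) (φ : H) :
    U ∘L pureState φ ∘L ContinuousLinearMap.adjoint U = pureState (U φ) := by
  refine ContinuousLinearMap.ext fun x => ?_
  rw [ContinuousLinearMap.comp_apply, ContinuousLinearMap.comp_apply, pureState_apply,
    pureState_apply, map_smul, ContinuousLinearMap.adjoint_inner_right]

/-- A state whose square root has a one-dimensional range is pure. -/
theorem IsDensity.eq_pureState {ρ : H →L[ℂ] H} (hρ : IsDensity ρ) {φ : H} (hφ : ‖φ‖ = 1)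
    (h : ∀ x, ∃ k : ℂ, sqrtOp ρ x = k • φ) : ρ = pureState φ := by
  have hself : ⟪φ, φ⟫_ℂ = 1 := by rw [inner_self_eq_norm_sq_to_K, hφ]; simp
  have h1 : ∀ x, sqrtOp ρ x = ⟪φ, sqrtOp ρ x⟫_ℂ • φ := fun x => by
    obtain ⟨k, hk⟩ := h x
    rw [hk, inner_smul_right, hself, mul_one]
  -- Self-adjointness makes √ρ a multiple of the projection. Trace one gives |t| = 1, and evaluating
  -- at φ shows that t is real, so t² = 1.
  obtain ⟨t, ht⟩ := h φ
  have h2 : ∀ x, sqrtOp ρ x = ((starRingEnd ℂ) t * ⟪φ, x⟫_ℂ) • φ := fun x => by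
    rw [h1 x, ← inner_sqrt_left, ht, inner_smul_left]
  have ht1 : ‖t‖ = 1 := by
    have h3 := hρ.tsum_enorm_sq (onb H)
    have h4 : ∀ i, ‖sqrtOp ρ (onb H i)‖ₑ ^ 2 = ‖t‖ₑ ^ 2 * ‖⟪onb H i, φ⟫_ℂ‖ₑ ^ 2 := fun i => by
      rw [h2, enorm_smul, enorm_mul, ← ofReal_norm φ, hφ, ENNReal.ofReal_one, mul_one, mul_pow,
        ← ofReal_norm ((starRingEnd ℂ) t), RCLike.norm_conj, ofReal_norm,
        ← ofReal_norm ⟪φ, _⟫_ℂ, norm_inner_symm, ofReal_norm]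
    simp_rw [h4] at h3
    rw [ENNReal.tsum_mul_left, tsum_enorm_inner_sq, ← ofReal_norm φ, hφ, ENNReal.ofReal_one,
      one_pow, mul_one, ← ofReal_norm, ← ENNReal.ofReal_pow (norm_nonneg _),
      ENNReal.ofReal_eq_one] at h3
    exact (pow_eq_one_iff_of_nonneg (norm_nonneg _) two_ne_zero).1 h3
  refine ContinuousLinearMap.ext fun x => ?_
  rw [← sqrt_apply_sqrt_apply hρ.1, h2 x, h2, inner_smul_right, hself, mul_one, ← mul_assoc,
    pureState_apply]
  congr 1
  have h5 : (starRingEnd ℂ) t = t := by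
    have := (h2 φ).symm.trans ht
    rw [hself, mul_one] at this
    have h6 := congrArg (fun y => ⟪φ, y⟫_ℂ) this
    simpa only [inner_smul_right, hself, mul_one] using h6
  rw [h5]
  have h7 : t * t = 1 := by
    nth_rewrite 2 [← h5]
    rw [Complex.mul_conj, Complex.normSq_eq_norm_sq, ht1]; simp
  rw [h7, one_mul]

end PureState

/-- Two functions are proportional if the moduli of all their combinations are proportional to a
fixed function. -/
theorem eq_mul_of_norm_eq {u v : ℂ} {w c₁ c₂ c₃ c₄ : ℝ} (hw : w ≠ 0) (hc : c₁ ≠ 0)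
    (h₁ : ‖u‖ = c₁ * w) (h₂ : ‖v‖ = c₂ * w) (h₃ : ‖u + v‖ = c₃ * w)
    (h₄ : ‖u + Complex.I * v‖ = c₄ * w) :
    v = (⟨(c₃ ^ 2 - c₁ ^ 2 - c₂ ^ 2) / (2 * c₁ ^ 2), -(c₄ ^ 2 - c₁ ^ 2 - c₂ ^ 2) / (2 * c₁ ^ 2)⟩ : ℂ)
      * u := by
  have k : ∀ (z : ℂ) (r : ℝ), ‖z‖ = r → z.re * z.re + z.im * z.im = r ^ 2 := fun z r hz => by
    rw [← hz, ← Complex.normSq_eq_norm_sq, Complex.normSq_apply]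
  have e1 := k _ _ h₁
  have e2 := k _ _ h₂
  have e3 := k _ _ h₃
  have e4 := k _ _ h₄
  simp only [Complex.add_re, Complex.add_im, Complex.mul_re, Complex.mul_im, Complex.I_re,
    Complex.I_im, zero_mul, one_mul, zero_sub, zero_add] at e3 e4
  have hcw : c₁ ^ 2 * w ^ 2 ≠ 0 := by positivity
  -- Polarization: the real part of ūv, and then its imaginary part, are constants times w². Since
  -- |u|² is a constant times w² too, the quotient v/u is a constant.
  have e5 : 2 * (u.re * v.re + u.im * v.im) = (c₃ ^ 2 - c₁ ^ 2 - c₂ ^ 2) * w ^ 2 := by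
    linear_combination e3 - e1 - e2
  have e6 : 2 * (u.re * v.im - u.im * v.re) = -(c₄ ^ 2 - c₁ ^ 2 - c₂ ^ 2) * w ^ 2 := by
    linear_combination -e4 + e1 + e2
  apply Complex.ext
  · rw [Complex.mul_re]
    dsimp only
    field_simp
    refine mul_left_cancel₀ (pow_ne_zero 2 hw) ?_
    linear_combination (-2 * v.re) * e1 + u.re * e5 - u.im * e6
  · rw [Complex.mul_im]
    dsimp only
    field_simp
    refine mul_left_cancel₀ (pow_ne_zero 2 hw) ?_
    linear_combination (-2 * v.im) * e1 + u.im * e5 + u.re * e6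

theorem ae_pos_restrict_Ici : ∀ᵐ x ∂haarR.restrict (Ici (0 : ℝ)), 0 < x := by
  rw [restrict_Ici_eq_Ioi]
  exact ae_restrict_mem measurableSet_Ioi

/-- The moduli of √ρ applied to e₁, e₂, e₁ + e₂ and e₁ + ie₂ are all proportional to w, so
`eq_mul_of_norm_eq` gives √ρ e₂ = κ √ρ e₁ with κ independent of the point. Hence the range of √ρ is
a line. -/
theorem IsDensity.exists_eq_pureState {ρ : L2Pos →L[ℂ] L2Pos} (hρ : IsDensity ρ) {w : ℝ → ℝ}
    (hw : ∀ x, 0 < x → w x ≠ 0)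
    (h : ∀ e : L2Pos, ∃ c : ℝ, 0 ≤ c ∧ ∀ᵐ x ∂haarR.restrict (Ici 0), ‖sqrtOp ρ e x‖ = c * w x) :
    ∃ φ : L2Pos, ‖φ‖ = 1 ∧ ρ = pureState φ ∧
      ∃ c : ℝ, 0 ≤ c ∧ ∀ᵐ x ∂haarR.restrict (Ici 0), ‖φ x‖ = c * w x := by
  obtain ⟨i, hi⟩ : ∃ i, sqrtOp ρ (onb L2Pos i) ≠ 0 := by
    by_contra! h0
    have h1 := hρ.tsum_enorm_sq (onb L2Pos)
    simp [h0] at h1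
  obtain ⟨e₁, hr⟩ : ∃ e₁, ‖sqrtOp ρ e₁‖ = 1 := by
    have hpos : 0 < ‖sqrtOp ρ (onb L2Pos i)‖ := norm_pos_iff.2 hi
    refine ⟨((‖sqrtOp ρ (onb L2Pos i)‖⁻¹ : ℝ) : ℂ) • onb L2Pos i, ?_⟩
    rw [map_smul, norm_smul, Complex.norm_real, Real.norm_of_nonneg (by positivity),
      inv_mul_cancel₀ hpos.ne']
  obtain ⟨c₁, hc₁, h₁⟩ := h e₁
  have hc : c₁ ≠ 0 := by
    rintro rfl
    have : sqrtOp ρ e₁ = 0 := by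
      refine Lp.ext ?_
      filter_upwards [h₁, Lp.coeFn_zero ℂ 2 (haarR.restrict (Ici 0))] with x hx h0
      rw [h0]
      simpa using hx
    rw [this, norm_zero] at hr
    exact zero_ne_one hr
  refine ⟨sqrtOp ρ e₁, hr, hρ.eq_pureState hr fun e₂ => ?_, c₁, hc₁, h₁⟩
  obtain ⟨c₂, -, h₂⟩ := h e₂
  obtain ⟨c₃, -, h₃⟩ := h (e₁ + e₂)
  obtain ⟨c₄, -, h₄⟩ := h (e₁ + Complex.I • e₂)
  rw [map_add] at h₃ h₄
  rw [map_smul] at h₄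
  set κ : ℂ := ⟨(c₃ ^ 2 - c₁ ^ 2 - c₂ ^ 2) / (2 * c₁ ^ 2),
    -(c₄ ^ 2 - c₁ ^ 2 - c₂ ^ 2) / (2 * c₁ ^ 2)⟩
  refine ⟨κ, Lp.ext ?_⟩
  filter_upwards [h₁, h₂, h₃, h₄, ae_pos_restrict_Ici, Lp.coeFn_add (sqrtOp ρ e₁) (sqrtOp ρ e₂),
    Lp.coeFn_add (sqrtOp ρ e₁) (Complex.I • sqrtOp ρ e₂),
    Lp.coeFn_smul Complex.I (sqrtOp ρ e₂), Lp.coeFn_smul κ (sqrtOp ρ e₁)]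
    with x h₁ h₂ h₃ h₄ hx a₁ a₂ a₃ a₄
  rw [a₁, Pi.add_apply] at h₃
  rw [a₂, Pi.add_apply, a₃, Pi.smul_apply, smul_eq_mul] at h₄
  exact (eq_mul_of_norm_eq (hw x hx) hc h₁ h₂ h₃ h₄).trans a₄.symm

/-! ## Errors of pure states -/

theorem energy_pureState {φ : L2Pos} (hφ : ‖φ‖ = 1) :
    energy (pureState φ) = secondMoment (extendByZero φ) := by
  rw [energy]
  simp_rw [secondMoment_eq_lintegral_withDensity]
  rw [← lintegral_sum_measure]
  congr 1
  ext B hB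
  rw [Measure.sum_apply _ hB]
  simp_rw [withDensity_apply_eq_enorm_sq _ hB, rootVec_eq]
  exact tsum_enorm_sq_pureState (onb L2Pos) hφ (projOp B hB ∘L extendByZero.toContinuousLinearMap)

theorem norm_rep (g : ℝ) (φ : L2Pos) : ‖rep g φ‖ = ‖φ‖ := by
  rw [Lp.norm_def, Lp.norm_def]
  congr 1
  refine eLpNorm_congr_norm_ae ?_
  filter_upwards [rep_coeFn g φ] with x hx
  rw [hx, norm_mul, Complex.norm_exp_ofReal_mul_I, one_mul]

/-- The distribution in the state f(g)φ is that in φ translated by g, so the error does not depend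
on g and the supremum is over a constant. -/
theorem IsCovariant.worstError_pureState {M : POVM L2Pos} (hM : IsCovariant M) {φ : L2Pos}
    (hφ : ‖φ‖ = 1) : worstError (pureState φ) M = ∫⁻ x, ENNReal.ofReal (x ^ 2) ∂M.dist φ := by
  have h : ∀ g, errorAt g (pureState φ) M = ∫⁻ x, ENNReal.ofReal (x ^ 2) ∂M.dist φ := fun g => by
    rw [errorAt, comp_pureState_comp_adjoint, M.outcome_pureState (by rw [norm_rep, hφ])]
    have h1 := hM.dist_rep_neg g (rep g φ)
    rw [rep_neg_rep] at h1
    rw [h1, lintegral_map (by fun_prop) (by fun_prop)]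
  rw [worstError]
  simp_rw [h]
  exact ciSup_const

/-! ## Gaussian integrals -/

/-- With t⁴ = 3/E the factor (3/E)^{3/4} is t³, so the Gaussian computations involve integer powers
only. -/
theorem exists_pos_eq_three_div {E : ℝ} (hE : 0 < E) : ∃ t : ℝ, 0 < t ∧ E = 3 / t ^ 4 := by
  refine ⟨(3 / E) ^ (1 / 4 : ℝ), by positivity, ?_⟩
  rw [← Real.rpow_natCast, ← Real.rpow_mul (by positivity)]
  norm_num

theorem rpow_three_quarters {s : ℝ} (hs : 0 < s) : (s ^ 4) ^ (3 / 4 : ℝ) = s ^ 3 := by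
  rw [← Real.rpow_natCast, ← Real.rpow_mul hs.le, ← Real.rpow_natCast]
  norm_num

theorem oddOptimal_eq {t : ℝ} (ht : 0 < t) (x : ℝ) :
    oddOptimal (3 / t ^ 4) x = t ^ 3 * x * Real.exp (-(t ^ 4 / 4) * x ^ 2) := by
  rw [oddOptimal, div_div_cancel₀ (by norm_num), rpow_three_quarters ht]
  congr 2
  field_simp

theorem optimalInput_eq (E x : ℝ) : optimalInput E x = √2 * oddOptimal E x := by
  rw [optimalInput, oddOptimal]; ring

theorem integrable_pow_mul_exp {b : ℝ} (hb : 0 < b) (n : ℕ) :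
    Integrable fun x : ℝ => x ^ n * Real.exp (-b * x ^ 2) := by
  have := integrable_rpow_mul_exp_neg_mul_sq hb (s := n) (by linarith [n.cast_nonneg (α := ℝ)])
  simpa using this

theorem hasDerivAt_exp_neg_mul_sq (b x : ℝ) : HasDerivAt (fun x : ℝ => Real.exp (-b * x ^ 2))
    (-(2 * b * x) * Real.exp (-b * x ^ 2)) x := by
  have h := ((hasDerivAt_pow 2 x).const_mul (-b)).exp
  convert h using 1
  push_cast
  ring

/-- The derivative of x^{n+1} e^{−bx²} integrates to zero. -/
theorem integral_pow_mul_exp {b : ℝ} (hb : 0 < b) (n : ℕ) :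
    ∫ x : ℝ, x ^ (n + 2) * Real.exp (-b * x ^ 2)
      = (n + 1) / (2 * b) * ∫ x : ℝ, x ^ n * Real.exp (-b * x ^ 2) := by
  have h0 := integrable_pow_mul_exp hb n
  have h2 := integrable_pow_mul_exp hb (n + 2)
  have hd : ∀ x : ℝ, HasDerivAt (fun x : ℝ => x ^ (n + 1) * Real.exp (-b * x ^ 2))
      ((n + 1) * (x ^ n * Real.exp (-b * x ^ 2))
        - (2 * b) * (x ^ (n + 2) * Real.exp (-b * x ^ 2))) x := fun x => by
    refine ((hasDerivAt_pow (n + 1) x).mul (hasDerivAt_exp_neg_mul_sq b x)).congr_deriv ?_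
    rw [Nat.add_sub_cancel]
    push_cast
    ring
  have h := integral_eq_zero_of_hasDerivAt_of_integrable hd
    ((h0.const_mul _).sub (h2.const_mul _)) (integrable_pow_mul_exp hb (n + 1))
  rw [integral_sub (h0.const_mul _) (h2.const_mul _), integral_const_mul, integral_const_mul] at h
  rw [div_mul_eq_mul_div, eq_div_iff (by positivity)]
  linarith

theorem sqrt_pi_div {t : ℝ} (ht : 0 < t) : √(Real.pi / (t ^ 4 / 2)) = √(2 * Real.pi) / t ^ 2 := by
  rw [show Real.pi / (t ^ 4 / 2) = 2 * Real.pi / (t ^ 2) ^ 2 by field_simp,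
    Real.sqrt_div (by positivity), Real.sqrt_sq (by positivity)]

theorem moments {t : ℝ} (ht : 0 < t) :
    (∫ x : ℝ, x ^ 0 * Real.exp (-(t ^ 4 / 2) * x ^ 2)) = √(2 * Real.pi) / t ^ 2 ∧
    (∫ x : ℝ, x ^ 2 * Real.exp (-(t ^ 4 / 2) * x ^ 2)) = √(2 * Real.pi) / t ^ 6 ∧
    (∫ x : ℝ, x ^ 4 * Real.exp (-(t ^ 4 / 2) * x ^ 2)) = 3 * √(2 * Real.pi) / t ^ 10 := by
  have hb : 0 < t ^ 4 / 2 := by positivity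
  have h0 : (∫ x : ℝ, x ^ 0 * Real.exp (-(t ^ 4 / 2) * x ^ 2)) = √(2 * Real.pi) / t ^ 2 := by
    simp_rw [pow_zero, one_mul]
    rw [integral_gaussian, sqrt_pi_div ht]
  have h2 := integral_pow_mul_exp hb 0
  have h4 := integral_pow_mul_exp hb 2
  rw [h0] at h2
  rw [zero_add] at h2
  rw [h2] at h4
  refine ⟨h0, h2.trans ?_, h4.trans ?_⟩
  · push_cast; field_simp; norm_num
  · push_cast; field_simp; norm_num

theorem lintegral_haarR_ofReal {f : ℝ → ℝ} (hf : Integrable f) (h0 : ∀ x, 0 ≤ f x) :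
    ∫⁻ x, ENNReal.ofReal (f x) ∂haarR = ENNReal.ofReal ((∫ x, f x) / √(2 * Real.pi)) := by
  rw [lintegral_haarR, ← ofReal_integral_eq_lintegral_ofReal hf (Filter.Eventually.of_forall h0),
    ← ENNReal.ofReal_mul (by positivity), one_div_mul_eq_div]

theorem exp_sq_eq (t x : ℝ) :
    Real.exp (-(t ^ 4 / 4) * x ^ 2) ^ 2 = Real.exp (-(t ^ 4 / 2) * x ^ 2) := by
  rw [← Real.exp_nat_mul]
  congr 1
  push_cast
  ring

/-- The derivative of `oddOptimal`. -/
def derivOptimal (E x : ℝ) : ℝ :=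
  (3 / E) ^ (3 / 4 : ℝ) * (1 - 3 / (2 * E) * x ^ 2) * Real.exp (-(3 * x ^ 2) / (4 * E))

theorem derivOptimal_eq {t : ℝ} (ht : 0 < t) (x : ℝ) :
    derivOptimal (3 / t ^ 4) x
      = t ^ 3 * (1 - t ^ 4 / 2 * x ^ 2) * Real.exp (-(t ^ 4 / 4) * x ^ 2) := by
  rw [derivOptimal, div_div_cancel₀ (by norm_num), rpow_three_quarters ht]
  congr 2
  · field_simp
  · field_simp

theorem hasDerivAt_oddOptimal {E : ℝ} (hE : 0 < E) (x : ℝ) :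
    HasDerivAt (oddOptimal E) (derivOptimal E x) x := by
  obtain ⟨t, ht, rfl⟩ := exists_pos_eq_three_div hE
  rw [funext (oddOptimal_eq ht), derivOptimal_eq ht]
  refine (((hasDerivAt_id x).const_mul (t ^ 3)).mul
    (hasDerivAt_exp_neg_mul_sq (t ^ 4 / 4) x)).congr_deriv ?_
  simp only [id]
  ring

theorem continuous_derivOptimal (E : ℝ) : Continuous (derivOptimal E) := by
  unfold derivOptimal; fun_prop

theorem lintegral_oddOptimal_sq {E : ℝ} (hE : 0 < E) :
    ∫⁻ x, ENNReal.ofReal (oddOptimal E x ^ 2) ∂haarR = 1 := by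
  obtain ⟨t, ht, rfl⟩ := exists_pos_eq_three_div hE
  have e : ∀ x, oddOptimal (3 / t ^ 4) x ^ 2
      = t ^ 6 * (x ^ 2 * Real.exp (-(t ^ 4 / 2) * x ^ 2)) := fun x => by
    rw [oddOptimal_eq ht, ← exp_sq_eq]; ring
  simp_rw [e]
  have hi := (integrable_pow_mul_exp (b := t ^ 4 / 2) (by positivity) 2).const_mul (t ^ 6)
  rw [lintegral_haarR_ofReal hi (fun x => by positivity), integral_const_mul, (moments ht).2.1,
    ENNReal.ofReal_eq_one]
  field_simp

theorem lintegral_sq_mul_oddOptimal_sq {E : ℝ} (hE : 0 < E) :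
    ∫⁻ x, ENNReal.ofReal (x ^ 2 * oddOptimal E x ^ 2) ∂haarR = ENNReal.ofReal E := by
  obtain ⟨t, ht, rfl⟩ := exists_pos_eq_three_div hE
  have e : ∀ x, x ^ 2 * oddOptimal (3 / t ^ 4) x ^ 2
      = t ^ 6 * (x ^ 4 * Real.exp (-(t ^ 4 / 2) * x ^ 2)) := fun x => by
    rw [oddOptimal_eq ht, ← exp_sq_eq]; ring
  simp_rw [e]
  have hi := (integrable_pow_mul_exp (b := t ^ 4 / 2) (by positivity) 4).const_mul (t ^ 6)
  rw [lintegral_haarR_ofReal hi (fun x => by positivity), integral_const_mul, (moments ht).2.2]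
  congr 1
  field_simp

theorem lintegral_derivOptimal_sq {E : ℝ} (hE : 0 < E) :
    ∫⁻ x, ENNReal.ofReal (derivOptimal E x ^ 2) ∂haarR = ENNReal.ofReal (9 / (4 * E)) := by
  obtain ⟨t, ht, rfl⟩ := exists_pos_eq_three_div hE
  have hb : 0 < t ^ 4 / 2 := by positivity
  have e : ∀ x, derivOptimal (3 / t ^ 4) x ^ 2
      = t ^ 6 * (x ^ 0 * Real.exp (-(t ^ 4 / 2) * x ^ 2))
        - t ^ 10 * (x ^ 2 * Real.exp (-(t ^ 4 / 2) * x ^ 2))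
        + t ^ 14 / 4 * (x ^ 4 * Real.exp (-(t ^ 4 / 2) * x ^ 2)) := fun x => by
    rw [derivOptimal_eq ht, ← exp_sq_eq]; ring
  have h0 := (integrable_pow_mul_exp hb 0).const_mul (t ^ 6)
  have h2 := (integrable_pow_mul_exp hb 2).const_mul (t ^ 10)
  have h4 := (integrable_pow_mul_exp hb 4).const_mul (t ^ 14 / 4)
  have h02 : Integrable fun x => t ^ 6 * (x ^ 0 * Real.exp (-(t ^ 4 / 2) * x ^ 2))
      - t ^ 10 * (x ^ 2 * Real.exp (-(t ^ 4 / 2) * x ^ 2)) := h0.sub h2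
  have hi : Integrable fun x => derivOptimal (3 / t ^ 4) x ^ 2 := by
    rw [funext e]
    exact h02.add h4
  rw [lintegral_haarR_ofReal hi (fun x => by positivity)]
  simp_rw [e]
  rw [integral_add h02 h4, integral_sub h0 h2, integral_const_mul, integral_const_mul,
    integral_const_mul, (moments ht).1, (moments ht).2.1, (moments ht).2.2]
  congr 1
  field_simp
  norm_num

/-- Accounts for the factor √2 between the half-line and the odd minimizer: the half-line moments
reduce to those on the whole line. -/
theorem lintegral_Ioi_two_mul {f : ℝ → ℝ} (h : ∀ x, f (-x) = f x) :
    ∫⁻ x in Ioi 0, ENNReal.ofReal (2 * f x) ∂haarR = ∫⁻ x, ENNReal.ofReal (f x) ∂haarR := by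
  rw [lintegral_haarR_eq_add]
  simp_rw [h, ENNReal.ofReal_mul zero_le_two, ENNReal.ofReal_ofNat]
  rw [lintegral_const_mul' _ _ (by simp), two_mul]

/-! ## The optimal functions -/

theorem memLp_two_of_lintegral {μ : Measure ℝ} {f : ℝ → ℂ} (hf : Measurable f)
    (h : ∫⁻ x, ‖f x‖ₑ ^ 2 ∂μ ≠ ⊤) : MemLp f 2 μ := by
  refine ⟨hf.aestronglyMeasurable, ?_⟩
  rw [eLpNorm_lt_top_iff_lintegral_rpow_enorm_lt_top (by norm_num) (by norm_num)]
  simpa using h.lt_top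

theorem enorm_ofReal_sq (r : ℝ) : ‖(r : ℂ)‖ₑ ^ 2 = ENNReal.ofReal (r ^ 2) := by
  rw [← ofReal_norm, Complex.norm_real, ← ENNReal.ofReal_pow (norm_nonneg _), Real.norm_eq_abs,
    sq_abs]

theorem isWeakDeriv_of_primitive {φ ψ : L2R} {v : ℝ → ℝ} (hv : LocallyIntegrable v)
    (hψ : ψ =ᵐ[volume] fun x => (v x : ℂ))
    (hφ : φ =ᵐ[volume] fun x => ((∫ y in (0 : ℝ)..x, v y : ℝ) : ℂ)) : IsWeakDeriv φ ψ := by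
  intro η hη hηc
  have h := congrArg (fun r : ℝ => (r : ℂ)) (integral_deriv_mul_primitive hv hη hηc)
  rw [Complex.ofReal_neg, ← integral_complex_ofReal, ← integral_complex_ofReal] at h
  rw [integral_congr_ae (g := fun x => (((deriv η x * ∫ t in (0 : ℝ)..x, v t) : ℝ) : ℂ)),
    integral_congr_ae (g := fun x => ((η x * v x : ℝ) : ℂ)) (f := fun x => (η x : ℂ) * ψ x)]
  · exact h
  · filter_upwards [hψ] with x hx
    rw [hx]; push_cast; rfl
  · filter_upwards [hφ] with x hx
    rw [hx]; push_cast; rfl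

theorem momentumForm_le_of_primitive {φ : L2R} {v : ℝ → ℝ} (hm : Measurable v)
    (hv : LocallyIntegrable v) {d : ℝ}
    (hd : ∫⁻ x, ENNReal.ofReal (v x ^ 2) ∂haarR = ENNReal.ofReal d)
    (hφ : φ =ᵐ[volume] fun x => ((∫ y in (0 : ℝ)..x, v y : ℝ) : ℂ)) :
    momentumForm φ ≤ ENNReal.ofReal d := by
  have hL : ∫⁻ x, ‖(v x : ℂ)‖ₑ ^ 2 ∂haarR = ENNReal.ofReal d := by
    simp_rw [enorm_ofReal_sq]; exact hd
  have hmem : MemLp (fun x => (v x : ℂ)) 2 haarR :=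
    memLp_two_of_lintegral (by fun_prop) (by rw [hL]; exact ENNReal.ofReal_ne_top)
  refine iInf₂_le_of_le (hmem.toLp _)
    (isWeakDeriv_of_primitive hv (ae_haarR_iff.1 hmem.coeFn_toLp) hφ) ?_
  rw [enorm_sq_eq_lintegral, ← hL]
  refine le_of_eq (lintegral_congr_ae ?_)
  filter_upwards [hmem.coeFn_toLp] with x hx
  rw [hx]

theorem oddOptimal_neg (E x : ℝ) : oddOptimal E (-x) = -oddOptimal E x := by
  rw [oddOptimal, oddOptimal, neg_sq]; ring

theorem derivOptimal_neg (E x : ℝ) : derivOptimal E (-x) = derivOptimal E x := by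
  rw [derivOptimal, derivOptimal, neg_sq]

theorem continuous_oddOptimal (E : ℝ) : Continuous (oddOptimal E) := by
  unfold oddOptimal; fun_prop

theorem integral_derivOptimal {E : ℝ} (hE : 0 < E) (x : ℝ) :
    ∫ y in (0 : ℝ)..x, derivOptimal E y = oddOptimal E x := by
  rw [intervalIntegral.integral_eq_sub_of_hasDerivAt (fun y _ => hasDerivAt_oddOptimal hE y)
    ((continuous_derivOptimal E).intervalIntegrable _ _)]
  simp [oddOptimal]

theorem norm_eq_one_of_enorm_sq {V : Type*} [NormedAddCommGroup V] {v : V} (h : ‖v‖ₑ ^ 2 = 1) :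
    ‖v‖ = 1 := by
  rw [← ofReal_norm, ← ENNReal.ofReal_pow (norm_nonneg _), ENNReal.ofReal_eq_one] at h
  exact (pow_eq_one_iff_of_nonneg (norm_nonneg _) two_ne_zero).1 h

/-- Only an upper bound for the momentum form is needed, from one exhibited derivative; the reverse
inequality is the uncertainty relation. -/
theorem exists_oddOptimal {E : ℝ} (hE : 0 < E) :
    ∃ φ : L2R, (φ =ᵐ[haarR] fun x => (oddOptimal E x : ℂ)) ∧ IsOdd φ ∧ ‖φ‖ = 1 ∧
      secondMoment φ = ENNReal.ofReal E ∧ momentumForm φ ≤ ENNReal.ofReal (9 / (4 * E)) := by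
  have hL : ∫⁻ x, ‖(oddOptimal E x : ℂ)‖ₑ ^ 2 ∂haarR = 1 := by
    simp_rw [enorm_ofReal_sq]; exact lintegral_oddOptimal_sq hE
  have hmeas := (continuous_oddOptimal E).measurable
  have hmem : MemLp (fun x => (oddOptimal E x : ℂ)) 2 haarR :=
    memLp_two_of_lintegral (by fun_prop) (by rw [hL]; exact ENNReal.one_ne_top)
  have hae := hmem.coeFn_toLp
  refine ⟨hmem.toLp _, hae, ?_, norm_eq_one_of_enorm_sq ?_, ?_, ?_⟩
  · filter_upwards [hae, measurePreserving_neg_haarR.quasiMeasurePreserving.ae hae] with x h1 h2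
    rw [h1, h2, oddOptimal_neg, Complex.ofReal_neg]
  · rw [enorm_sq_eq_lintegral, ← hL]
    refine lintegral_congr_ae ?_
    filter_upwards [hae] with x hx
    rw [hx]
  · rw [secondMoment, ← lintegral_sq_mul_oddOptimal_sq hE]
    refine lintegral_congr_ae ?_
    filter_upwards [hae] with x hx
    rw [hx, enorm_ofReal_sq, ENNReal.ofReal_mul (sq_nonneg x)]
  · refine momentumForm_le_of_primitive (continuous_derivOptimal E).measurable
      (continuous_derivOptimal E).locallyIntegrable (lintegral_derivOptimal_sq hE) ?_
    simp_rw [integral_derivOptimal hE]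
    exact ae_haarR_iff.1 hae

theorem exists_optimalInput {E : ℝ} (hE : 0 < E) :
    ∃ φ : L2Pos, (φ =ᵐ[haarR.restrict (Ici 0)] fun x => (optimalInput E x : ℂ)) ∧ ‖φ‖ = 1 ∧
      secondMoment (extendByZero φ) = ENNReal.ofReal E ∧
      momentumForm (extendByZero φ) ≤ ENNReal.ofReal (9 / (4 * E)) := by
  have hsq : ∀ x, optimalInput E x ^ 2 = 2 * oddOptimal E x ^ 2 := fun x => by
    rw [optimalInput_eq, mul_pow, Real.sq_sqrt zero_le_two]
  have hL : ∫⁻ x in Ici 0, ‖(optimalInput E x : ℂ)‖ₑ ^ 2 ∂haarR = 1 := by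
    simp_rw [enorm_ofReal_sq, hsq]
    rw [restrict_Ici_eq_Ioi, lintegral_Ioi_two_mul (fun x => by rw [oddOptimal_neg, neg_sq])]
    exact lintegral_oddOptimal_sq hE
  have hmeas : Measurable (optimalInput E) := by unfold optimalInput; fun_prop
  have hmem : MemLp (fun x => (optimalInput E x : ℂ)) 2 (haarR.restrict (Ici 0)) :=
    memLp_two_of_lintegral (by fun_prop) (by rw [hL]; exact ENNReal.one_ne_top)
  have hae := hmem.coeFn_toLp
  have hext : extendByZero (hmem.toLp _) =ᵐ[haarR]
      (Ici (0 : ℝ)).indicator fun x => (optimalInput E x : ℂ) := by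
    filter_upwards [extendByZero_coeFn (hmem.toLp _), (ae_restrict_iff' measurableSet_Ici).1 hae]
      with x h1 h2
    rw [h1]
    by_cases hx : x ∈ Ici (0 : ℝ)
    · rw [indicator_of_mem hx, indicator_of_mem hx, h2 hx]
    · rw [indicator_of_notMem hx, indicator_of_notMem hx]
  refine ⟨hmem.toLp _, hae, norm_eq_one_of_enorm_sq ?_, ?_, ?_⟩
  · rw [enorm_sq_eq_lintegral, ← hL]
    refine lintegral_congr_ae ?_
    filter_upwards [hae] with x hx
    rw [hx]
  · rw [secondMoment, lintegral_extendByZero, ← lintegral_sq_mul_oddOptimal_sq hE,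
      ← lintegral_Ioi_two_mul (fun x => by rw [oddOptimal_neg, neg_sq, neg_sq])]
    refine lintegral_congr_ae ?_
    filter_upwards [ae_restrict_of_ae hext, ae_restrict_mem measurableSet_Ioi] with x hx hx0
    have hx0 : x ∈ Ici (0 : ℝ) := Ioi_subset_Ici_self hx0
    rw [hx, indicator_of_mem hx0, enorm_ofReal_sq, ← ENNReal.ofReal_mul (sq_nonneg x), hsq]
    ring_nf
  · have hc : Continuous fun x => √2 * derivOptimal E x := by
      have := continuous_derivOptimal E
      fun_prop
    -- The weak derivative of the extension by zero is the truncated derivative, without a point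
    -- mass at 0, because the function vanishes at the origin.
    refine momentumForm_le_of_primitive (v := (Ioi 0).indicator fun x => √2 * derivOptimal E x)
      (hc.measurable.indicator measurableSet_Ioi) (hc.locallyIntegrable.indicator measurableSet_Ioi)
      ?_ ?_
    · rw [← lintegral_derivOptimal_sq hE,
        ← lintegral_Ioi_two_mul (f := fun x => derivOptimal E x ^ 2)
          (fun x => by rw [derivOptimal_neg]),
        ← lintegral_indicator measurableSet_Ioi]
      refine lintegral_congr fun x => ?_
      by_cases hx : x ∈ Ioi (0 : ℝ)
      · rw [indicator_of_mem hx, indicator_of_mem hx, mul_pow, Real.sq_sqrt zero_le_two]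
      · rw [indicator_of_notMem hx, indicator_of_notMem hx]; simp
    · filter_upwards [ae_haarR_iff.1 hext] with x hx
      rw [hx]
      by_cases hx0 : x ∈ Ici (0 : ℝ)
      · rw [indicator_of_mem hx0, intervalIntegral.integral_of_le hx0,
          setIntegral_congr_fun (g := fun x => √2 * derivOptimal E x) measurableSet_Ioc
            (fun y hy => indicator_of_mem (show y ∈ Ioi (0 : ℝ) from hy.1) _),
          ← intervalIntegral.integral_of_le hx0, intervalIntegral.integral_const_mul,
          integral_derivOptimal hE, optimalInput_eq]
      · have hx1 : x ≤ 0 := (not_le.1 hx0).le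
        rw [indicator_of_notMem hx0, intervalIntegral.integral_of_ge hx1,
          setIntegral_congr_fun (g := fun _ => (0 : ℝ)) measurableSet_Ioc
            (fun y hy => indicator_of_notMem (s := Ioi (0 : ℝ)) (not_lt.2 hy.2) _)]
        simp

/-! ## The Fourier transform of the odd minimizer -/

/-- The derivative of e^{igx} e^{−bx²} integrates to zero, which expresses this integral through the
Fourier transform of the Gaussian. -/
theorem integral_exp_mul_mul_gaussian {b : ℝ} (hb : 0 < b) (g : ℝ) :
    ∫ x : ℝ, Complex.exp ((g * x : ℝ) * Complex.I) * (x * Real.exp (-b * x ^ 2) : ℝ)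
      = Complex.I * ((g / (2 * b) * (√(Real.pi / b) * Real.exp (-g ^ 2 / (4 * b))) : ℝ) : ℂ) := by
  have hexp : ∀ x : ℝ, HasDerivAt (fun x : ℝ => Complex.exp ((g * x : ℝ) * Complex.I))
      (Complex.exp ((g * x : ℝ) * Complex.I) * (g * Complex.I)) x := fun x => by
    have h := (((hasDerivAt_id x).const_mul g).ofReal_comp.mul_const Complex.I).cexp
    refine h.congr_deriv ?_
    simp
  have hi : ∀ n : ℕ, Integrable fun x : ℝ => Complex.exp ((g * x : ℝ) * Complex.I)
      * (x ^ n * Real.exp (-b * x ^ 2) : ℝ) := fun n => by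
    refine (integrable_pow_mul_exp hb n).ofReal.bdd_mul (c := 1)
      (Continuous.aestronglyMeasurable (by fun_prop)) (Filter.Eventually.of_forall fun x => ?_)
    exact (Complex.norm_exp_ofReal_mul_I _).le
  have hd : ∀ x : ℝ, HasDerivAt (fun x : ℝ => Complex.exp ((g * x : ℝ) * Complex.I)
      * (x ^ 0 * Real.exp (-b * x ^ 2) : ℝ))
      ((g * Complex.I) * (Complex.exp ((g * x : ℝ) * Complex.I) * (x ^ 0 * Real.exp (-b * x ^ 2) : ℝ))
        - (2 * b) * (Complex.exp ((g * x : ℝ) * Complex.I) * (x ^ 1 * Real.exp (-b * x ^ 2) : ℝ)))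
      x := fun x => by
    simp_rw [pow_zero, one_mul]
    refine ((hexp x).mul (hasDerivAt_exp_neg_mul_sq b x).ofReal_comp).congr_deriv ?_
    push_cast
    ring
  have h := integral_eq_zero_of_hasDerivAt_of_integrable hd
    (((hi 0).const_mul _).sub ((hi 1).const_mul _)) (hi 0)
  rw [integral_sub ((hi 0).const_mul _) ((hi 1).const_mul _), integral_const_mul,
    integral_const_mul] at h
  have hg : ∫ x : ℝ, Complex.exp ((g * x : ℝ) * Complex.I) * (x ^ 0 * Real.exp (-b * x ^ 2) : ℝ)
      = ((√(Real.pi / b) * Real.exp (-g ^ 2 / (4 * b)) : ℝ) : ℂ) := by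
    have h1 := fourierIntegral_gaussian (b := b) (by simpa using hb) g
    have h2 : ((√(Real.pi / b) : ℝ) : ℂ) = ((Real.pi : ℂ) / b) ^ (1 / 2 : ℂ) := by
      rw [Real.sqrt_eq_rpow, Complex.ofReal_cpow (by positivity)]
      push_cast
      rfl
    push_cast
    rw [h2, ← h1]
    refine integral_congr_ae (Filter.Eventually.of_forall fun x => ?_)
    simp only [pow_zero, one_mul]
    ring_nf
  rw [hg] at h
  simp_rw [pow_one] at h
  have hb' : (b : ℂ) ≠ 0 := Complex.ofReal_ne_zero.2 hb.ne'
  refine mul_left_cancel₀ (mul_ne_zero two_ne_zero hb') ((sub_eq_zero.1 h).symm.trans ?_)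
  push_cast
  field_simp

theorem invFourier_oddOptimal {E : ℝ} (hE : 0 < E) {φ : L2R}
    (hφ : φ =ᵐ[haarR] fun x => (oddOptimal E x : ℂ)) :
    invFourier φ =ᵐ[haarR] fun g =>
      Complex.I * (((4 * E / 3) ^ (3 / 4 : ℝ) * g * Real.exp (-(g ^ 2 * E) / 3) : ℝ) : ℂ) := by
  obtain ⟨t, ht, rfl⟩ := exists_pos_eq_three_div hE
  have hb : 0 < t ^ 4 / 4 := by positivity
  have hint : Integrable φ := by
    refine ((integrable_pow_mul_exp hb 1).const_mul (t ^ 3)).ofReal.congr ?_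
    filter_upwards [ae_haarR_iff.1 hφ] with x hx
    rw [hx, oddOptimal_eq ht, pow_one, mul_assoc]
    rfl
  filter_upwards [invFourier_ae_eq_invFourierInt φ hint] with g hg
  have e : ∀ x, Complex.exp ((g * x : ℝ) * Complex.I) * (oddOptimal (3 / t ^ 4) x : ℂ)
      = (t ^ 3 : ℝ) * (Complex.exp ((g * x : ℝ) * Complex.I)
        * (x * Real.exp (-(t ^ 4 / 4) * x ^ 2) : ℝ)) := fun x => by
    rw [oddOptimal_eq ht]
    push_cast
    ring
  have hs : √2 ^ 4 = 4 := by
    rw [show (√2 : ℝ) ^ 4 = (√2 ^ 2) ^ 2 by ring, Real.sq_sqrt zero_le_two]; norm_num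
  have h4 : (4 * (3 / t ^ 4) / 3 : ℝ) = (√2 / t) ^ 4 := by
    rw [div_pow, hs]; field_simp
  have hroot : √(Real.pi / (t ^ 4 / 4)) = 2 * √Real.pi / t ^ 2 := by
    rw [show Real.pi / (t ^ 4 / 4) = Real.pi * (2 / t ^ 2) ^ 2 by field_simp; norm_num,
      Real.sqrt_mul Real.pi_pos.le, Real.sqrt_sq (by positivity)]
    ring
  rw [hg, invFourierInt_congr_ae (ae_haarR_iff.1 hφ), invFourierInt]
  simp_rw [e]
  rw [integral_const_mul, integral_exp_mul_mul_gaussian hb, h4,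
    rpow_three_quarters (by positivity), hroot, Real.sqrt_mul zero_le_two,
    show -g ^ 2 / (4 * (t ^ 4 / 4)) = -(g ^ 2 * (3 / t ^ 4)) / 3 by field_simp]
  rw [mul_left_comm _ Complex.I, mul_left_comm _ Complex.I, ← Complex.ofReal_mul,
    ← Complex.ofReal_mul]
  congr 2
  have h2 : √2 ^ 3 * √2 = 4 := by rw [← hs]; ring
  have h3 : 0 < √Real.pi := Real.sqrt_pos.2 Real.pi_pos
  field_simp
  linear_combination (-g) * h2

/-! ## The standard measurement -/

theorem inner_standardPOVM {B : Set ℝ} (hB : MeasurableSet B) (φ ψ : L2Pos) :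
    ⟪φ, standardPOVM.op B ψ⟫_ℂ = ∫ x in B, ⟪invFourierPos φ x, invFourierPos ψ x⟫_ℂ ∂haarR := by
  rw [standardPOVM]
  dsimp only
  rw [dif_pos hB, ContinuousLinearMap.comp_apply, ContinuousLinearMap.comp_apply,
    ContinuousLinearMap.adjoint_inner_right, inner_projOp]
  rfl

theorem invFourierPos_rep_neg (g : ℝ) (φ : L2Pos) :
    invFourierPos (rep (-g) φ) =ᵐ[haarR] fun x => invFourierPos φ (x + g) := by
  have h := invFourier_of_ae_eq_exp_mul (-g) (extendByZero_rep (-g) φ)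
  simp_rw [sub_neg_eq_add] at h
  exact h

/-- Modulation of φ translates F⁻¹[φ], and `haarR` is translation invariant. -/
theorem isCovariant_standardPOVM : IsCovariant standardPOVM := by
  intro g B hB
  have hpre : (fun x => x + g) ⁻¹' ((fun x => g + x) '' B) = B := by
    ext x
    simp [add_comm x g]
  have hB' : MeasurableSet ((fun x => g + x) '' B) :=
    (measurableEmbedding_addLeft g).measurableSet_image' hB
  refine ContinuousLinearMap.ext fun ψ => ext_inner_left ℂ fun φ => ?_
  rw [ContinuousLinearMap.comp_apply, ContinuousLinearMap.comp_apply,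
    ← ContinuousLinearMap.adjoint_inner_left, adjoint_rep, inner_standardPOVM hB,
    inner_standardPOVM hB', ← (measurePreserving_add_haarR g).setIntegral_preimage_emb
      (measurableEmbedding_addRight g) (fun x => ⟪invFourierPos φ x, invFourierPos ψ x⟫_ℂ), hpre]
  refine integral_congr_ae (ae_restrict_of_ae ?_)
  filter_upwards [invFourierPos_rep_neg g φ, invFourierPos_rep_neg g ψ] with x h1 h2
  rw [h1, h2]

theorem integrable_norm_sq_haarR (φ : L2R) : Integrable (fun x => ‖φ x‖ ^ 2) haarR := by
  have := (Lp.memLp φ).integrable_norm_pow (by norm_num)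
  simpa using this

theorem dist_standardPOVM (φ : L2Pos) :
    standardPOVM.dist φ = haarR.withDensity fun x => ‖invFourierPos φ x‖ₑ ^ 2 := by
  ext B hB
  rw [POVM.dist_apply _ _ hB, inner_standardPOVM hB, withDensity_apply _ hB,
    lintegral_enorm_sq (integrable_norm_sq_haarR _).integrableOn]
  have h : ∀ x, ⟪invFourierPos φ x, invFourierPos φ x⟫_ℂ = ((‖invFourierPos φ x‖ ^ 2 : ℝ) : ℂ) :=
    fun x => by rw [inner_self_eq_norm_sq_to_K]; norm_cast
  simp_rw [h]
  rw [integral_complex_ofReal, Complex.ofReal_re]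

theorem worstError_standardPOVM {φ : L2Pos} (hφ : ‖φ‖ = 1) :
    worstError (pureState φ) standardPOVM = secondMoment (invFourierPos φ) := by
  rw [isCovariant_standardPOVM.worstError_pureState hφ, dist_standardPOVM,
    secondMoment_eq_lintegral_withDensity]

theorem secondMoment_invFourierPos (φ : L2Pos) :
    secondMoment (invFourierPos φ) = momentumForm (extendByZero φ) :=
  (momentumForm_eq_secondMoment _).symm

/-! ## Conjugate measurements -/

/-- The measurement `B ↦ U M(B) U†` for a unitary operator `U`. -/
def POVM.conj {H : Type*} [NormedAddCommGroup H] [InnerProductSpace ℂ H] [CompleteSpace H]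
    (M : POVM H) (U : H →L[ℂ] H) (hU : U ∘L ContinuousLinearMap.adjoint U = 1) : POVM H where
  op B := U ∘L M.op B ∘L ContinuousLinearMap.adjoint U
  positive B hB := (M.positive B hB).conj_adjoint U
  op_univ := by
    rw [M.op_univ]
    exact hU
  additive B hB hd φ ψ := by
    have h := M.additive B hB hd (ContinuousLinearMap.adjoint U φ) (ContinuousLinearMap.adjoint U ψ)
    simpa only [ContinuousLinearMap.adjoint_inner_left, ContinuousLinearMap.comp_apply] using h

theorem POVM.dist_conj {H : Type*} [NormedAddCommGroup H] [InnerProductSpace ℂ H] [CompleteSpace H]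
    (M : POVM H) (U : H →L[ℂ] H) (hU : U ∘L ContinuousLinearMap.adjoint U = 1) (φ : H) :
    (M.conj U hU).dist φ = M.dist (ContinuousLinearMap.adjoint U φ) := by
  ext B hB
  rw [POVM.dist_apply _ _ hB, POVM.dist_apply _ _ hB, ContinuousLinearMap.adjoint_inner_left]
  rfl

theorem IsCovariant.conj {M : POVM L2Pos} (hM : IsCovariant M) {U : L2Pos →L[ℂ] L2Pos}
    (hU : U ∘L ContinuousLinearMap.adjoint U = 1) (hc : ∀ g, rep g ∘L U = U ∘L rep g) :
    IsCovariant (M.conj U hU) := by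
  intro g B hB
  have h1 := hM g B hB
  have h2 : ContinuousLinearMap.adjoint U ∘L ContinuousLinearMap.adjoint (rep g)
      = ContinuousLinearMap.adjoint (rep g) ∘L ContinuousLinearMap.adjoint U := by
    rw [← ContinuousLinearMap.adjoint_comp, ← ContinuousLinearMap.adjoint_comp, hc]
  change rep g ∘L (U ∘L M.op B ∘L ContinuousLinearMap.adjoint U)
    ∘L ContinuousLinearMap.adjoint (rep g) = U ∘L M.op _ ∘L ContinuousLinearMap.adjoint U
  calc rep g ∘L (U ∘L M.op B ∘L ContinuousLinearMap.adjoint U) ∘L ContinuousLinearMap.adjoint (rep g)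
      = (rep g ∘L U) ∘L M.op B ∘L
        (ContinuousLinearMap.adjoint U ∘L ContinuousLinearMap.adjoint (rep g)) := rfl
    _ = U ∘L (rep g ∘L M.op B ∘L ContinuousLinearMap.adjoint (rep g))
        ∘L ContinuousLinearMap.adjoint U := by rw [hc, h2]; rfl
    _ = _ := by rw [h1]

/-- Every function in `L²(ℝ₊)` arises from its modulus by a unitary multiplication operator. -/
theorem exists_phase (φ : L2Pos) : ∃ U : L2Pos →L[ℂ] L2Pos,
    U ∘L ContinuousLinearMap.adjoint U = 1 ∧ (∀ g, rep g ∘L U = U ∘L rep g) ∧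
      ContinuousLinearMap.adjoint U φ = absPos φ := by
  obtain ⟨f, hf, hφf⟩ : ∃ f : ℝ → ℂ, Measurable f ∧ φ =ᵐ[haarR.restrict (Ici 0)] f :=
    ⟨_, (Lp.stronglyMeasurable φ).measurable, Filter.EventuallyEq.rfl⟩
  -- The value 1 at the zeros of f keeps m unimodular everywhere, so multiplication by m is unitary.
  set m : ℝ → ℂ := fun x => if f x = 0 then 1 else f x / ‖f x‖
  have hm : Measurable m := Measurable.ite (hf (measurableSet_singleton 0)) measurable_const
    (hf.div (by fun_prop))
  have hn : ∀ x, ‖m x‖ = 1 := fun x => by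
    by_cases h : f x = 0
    · simp [m, h]
    · simp [m, h]
  have hmc : Measurable fun x => (starRingEnd ℂ) (m x) :=
    Complex.continuous_conj.measurable.comp hm
  have hmul : ∀ x, m x * (starRingEnd ℂ) (m x) = 1 := fun x => by
    rw [Complex.mul_conj, Complex.normSq_eq_norm_sq, hn]; simp
  have hadj : ContinuousLinearMap.adjoint (mulOp (haarR.restrict (Ici 0)) m hm fun x => (hn x).le)
      = mulOp _ (fun x => (starRingEnd ℂ) (m x)) hmc
        (fun x => by rw [RCLike.norm_conj]; exact (hn x).le) := by
    symm
    rw [ContinuousLinearMap.eq_adjoint_iff]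
    intro φ ψ
    rw [L2.inner_def, L2.inner_def]
    refine integral_congr_ae ?_
    filter_upwards [mulOp_coeFn hmc (fun x => by rw [RCLike.norm_conj]; exact (hn x).le) φ,
      mulOp_coeFn hm (fun x => (hn x).le) ψ] with x h1 h2
    rw [h1, h2]
    simp only [RCLike.inner_apply, map_mul, Complex.conj_conj]
    ring
  refine ⟨mulOp _ m hm fun x => (hn x).le, ?_, fun g => ?_, ?_⟩
  · rw [hadj]
    refine ContinuousLinearMap.ext fun ψ => Lp.ext ?_
    filter_upwards [mulOp_coeFn hmc (fun x => by rw [RCLike.norm_conj]; exact (hn x).le) ψ,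
      mulOp_coeFn hm (fun x => (hn x).le) (mulOp (haarR.restrict (Ici 0)) _ hmc
        (fun x => by rw [RCLike.norm_conj]; exact (hn x).le) ψ)] with x h1 h2
    rw [ContinuousLinearMap.comp_apply, h2, h1, ← mul_assoc, hmul, one_mul]
    rfl
  · refine ContinuousLinearMap.ext fun ψ => Lp.ext ?_
    filter_upwards [mulOp_coeFn hm (fun x => (hn x).le) ψ, mulOp_coeFn hm (fun x => (hn x).le)
      (rep g ψ), rep_coeFn g ψ, rep_coeFn g (mulOp _ m hm (fun x => (hn x).le) ψ)]
      with x h1 h2 h3 h4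
    rw [ContinuousLinearMap.comp_apply, ContinuousLinearMap.comp_apply, h4, h1, h2, h3]
    ring
  · rw [hadj]
    refine Lp.ext ?_
    filter_upwards [mulOp_coeFn hmc (fun x => by rw [RCLike.norm_conj]; exact (hn x).le) φ,
      absPos_coeFn φ, hφf] with x h1 h2 h3
    rw [h1, h2, h3]
    by_cases h : f x = 0
    · simp [h]
    · have hfx : f x = m x * ‖f x‖ := by
        have : ((‖f x‖ : ℝ) : ℂ) ≠ 0 := by simpa using h
        simp only [m, if_neg h]
        field_simp
      calc (starRingEnd ℂ) (m x) * f x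
          = (starRingEnd ℂ) (m x) * (m x * ((‖f x‖ : ℝ) : ℂ)) := by rw [← hfx]
        _ = (‖f x‖ : ℝ) := by rw [← mul_assoc, mul_comm _ (m x), hmul, one_mul]

/-! ## The optimal value -/

section Optimal

variable {E : ℝ} (hE : 0 < E)

include hE in
-- The value a = 3/(2E) maximizes 3a − a²E, with maximum 9/(4E).
theorem ofReal_three_mul_eq : ENNReal.ofReal (3 * (3 / (2 * E)))
    = ENNReal.ofReal (9 / (4 * E)) + ENNReal.ofReal ((3 / (2 * E)) ^ 2) * ENNReal.ofReal E := by
  rw [← ENNReal.ofReal_mul (by positivity), ← ENNReal.ofReal_add (by positivity) (by positivity)]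
  congr 1
  field_simp
  norm_num

include hE in
theorem optimum_le {d e : ℝ≥0∞}
    (h : ENNReal.ofReal (3 * (3 / (2 * E))) ≤ d + ENNReal.ofReal ((3 / (2 * E)) ^ 2) * e)
    (he : e ≤ ENNReal.ofReal E) : ENNReal.ofReal (9 / (4 * E)) ≤ d := by
  rw [ofReal_three_mul_eq hE] at h
  refine (ENNReal.add_le_add_iff_right (ENNReal.mul_ne_top (a := ENNReal.ofReal ((3 / (2 * E)) ^ 2))
    ENNReal.ofReal_ne_top (ENNReal.ofReal_ne_top (r := E)))).1 (h.trans ?_)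
  gcongr

include hE in
theorem add_le_of_eq_optimum {d e : ℝ≥0∞} (h : d = ENNReal.ofReal (9 / (4 * E)))
    (he : e ≤ ENNReal.ofReal E) :
    d + ENNReal.ofReal ((3 / (2 * E)) ^ 2) * e ≤ ENNReal.ofReal (3 * (3 / (2 * E))) := by
  rw [ofReal_three_mul_eq hE, h]
  gcongr

theorem oddOptimal_eq_mul (E x : ℝ) : oddOptimal E x
    = (3 / E) ^ (3 / 4 : ℝ) * (x * Real.exp (-(3 / (2 * E) * x ^ 2) / 2)) := by
  rw [oddOptimal, mul_assoc]
  congr 3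
  ring

theorem optimalInput_eq_mul (E x : ℝ) : optimalInput E x
    = √2 * (3 / E) ^ (3 / 4 : ℝ) * (x * Real.exp (-(3 / (2 * E) * x ^ 2) / 2)) := by
  rw [optimalInput_eq, oddOptimal_eq_mul, mul_assoc]

theorem smul_ae_eq {μ : Measure ℝ} {φ ψ : Lp ℂ 2 μ} {f : ℝ → ℂ} {c : ℂ} (hψ : ψ =ᵐ[μ] f)
    (hφ : φ =ᵐ[μ] fun x => c * f x) : φ = c • ψ := by
  refine Lp.ext ?_
  filter_upwards [hψ, hφ, Lp.coeFn_smul c ψ] with x h1 h2 h3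
  rw [h2, h3, Pi.smul_apply, h1, smul_eq_mul]

theorem norm_eq_one_of_smul {V : Type*} [NormedAddCommGroup V] [NormedSpace ℂ V] {v w : V} {c : ℂ}
    (hv : ‖v‖ = 1) (hw : ‖w‖ = 1) (h : w = c • v) : ‖c‖ = 1 := by
  rwa [h, norm_smul, hv, mul_one] at hw

theorem secondMoment_smul {c : ℂ} (hc : ‖c‖ = 1) (φ : L2R) :
    secondMoment (c • φ) = secondMoment φ := by
  refine lintegral_congr_ae ?_
  filter_upwards [Lp.coeFn_smul c φ] with x hx
  rw [hx, Pi.smul_apply, enorm_smul, ← ofReal_norm c, hc, ENNReal.ofReal_one, one_mul]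

theorem momentumForm_smul {c : ℂ} (hc : ‖c‖ = 1) (φ : L2R) :
    momentumForm (c • φ) = momentumForm φ := by
  rw [momentumForm_eq_secondMoment, map_smul, secondMoment_smul hc, momentumForm_eq_secondMoment]

include hE in
theorem optimum_le_momentumForm {φ : L2Pos} (hφ : ‖φ‖ = 1)
    (h : secondMoment (extendByZero φ) ≤ ENNReal.ofReal E) :
    ENNReal.ofReal (9 / (4 * E)) ≤ momentumForm (extendByZero φ) := by
  have h1 := (uncertainty_L2Pos (a := 3 / (2 * E)) (by positivity) φ).1
  rw [← ofReal_norm φ, hφ, ENNReal.ofReal_one, one_pow, mul_one] at h1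
  exact optimum_le hE h1 h

include hE in
theorem optimum_le_momentumForm_of_isOdd {φ : L2R} (ho : IsOdd φ) (hφ : ‖φ‖ = 1)
    (h : secondMoment φ ≤ ENNReal.ofReal E) :
    ENNReal.ofReal (9 / (4 * E)) ≤ momentumForm φ := by
  have h1 := (uncertainty_isOdd (a := 3 / (2 * E)) (by positivity) ho).1
  rw [← ofReal_norm φ, hφ, ENNReal.ofReal_one, one_pow, mul_one] at h1
  exact optimum_le hE h1 h

include hE in
-- An optimal φ gives equality in the uncertainty relation at a = 3/(2E), so it is a multiple of the
-- optimal input, and the norms force a factor of modulus one. Conversely, norm and both forms are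
-- invariant under a constant phase.
theorem isOptimal_iff (φ : L2Pos) :
    (‖φ‖ = 1 ∧ secondMoment (extendByZero φ) ≤ ENNReal.ofReal E ∧
        momentumForm (extendByZero φ) = ENNReal.ofReal (9 / (4 * E))) ↔
      ∃ c : ℂ, ‖c‖ = 1 ∧ φ =ᵐ[haarR.restrict (Ici 0)] fun x => c * (optimalInput E x : ℂ) := by
  obtain ⟨φ₀, h0, hn, hs, hm⟩ := exists_optimalInput hE
  constructor
  · rintro ⟨h1, h2, h3⟩
    obtain ⟨c, hc⟩ := (uncertainty_L2Pos (a := 3 / (2 * E)) (by positivity) φ).2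
      (ne_top_of_le_ne_top ENNReal.ofReal_ne_top h2) (by
        rw [← ofReal_norm φ, h1, ENNReal.ofReal_one, one_pow, mul_one]
        exact add_le_of_eq_optimum hE h3 h2)
    have hK : √2 * (3 / E) ^ (3 / 4 : ℝ) ≠ 0 := by positivity
    have hK' : ((√2 * (3 / E) ^ (3 / 4 : ℝ) : ℝ) : ℂ) ≠ 0 := Complex.ofReal_ne_zero.2 hK
    have hc' : φ =ᵐ[haarR.restrict (Ici 0)] fun x =>
        c / (√2 * (3 / E) ^ (3 / 4 : ℝ) : ℝ) * (optimalInput E x : ℂ) := by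
      filter_upwards [hc] with x hx
      rw [hx, optimalInput_eq_mul, Complex.ofReal_mul (√2 * (3 / E) ^ (3 / 4 : ℝ)), ← mul_assoc,
        div_mul_cancel₀ _ hK']
    exact ⟨_, norm_eq_one_of_smul hn h1 (smul_ae_eq h0 hc'), hc'⟩
  · rintro ⟨c, hc, h⟩
    have h1 : φ = c • φ₀ := smul_ae_eq h0 h
    rw [h1, map_smul, momentumForm_smul hc, secondMoment_smul hc, norm_smul, hc, one_mul]
    exact ⟨hn, hs.le, le_antisymm hm (optimum_le_momentumForm hE hn hs.le)⟩

include hE in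
theorem isOptimal_isOdd_iff (φ : L2R) :
    (IsOdd φ ∧ ‖φ‖ = 1 ∧ secondMoment φ ≤ ENNReal.ofReal E ∧
        momentumForm φ = ENNReal.ofReal (9 / (4 * E))) ↔
      ∃ c : ℂ, ‖c‖ = 1 ∧ φ =ᵐ[haarR] fun x => c * (oddOptimal E x : ℂ) := by
  obtain ⟨φ₀, h0, ho, hn, hs, hm⟩ := exists_oddOptimal hE
  constructor
  · rintro ⟨hodd, h1, h2, h3⟩
    obtain ⟨c, hc⟩ := (uncertainty_isOdd (a := 3 / (2 * E)) (by positivity) hodd).2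
      (ne_top_of_le_ne_top ENNReal.ofReal_ne_top h2) (by
        rw [← ofReal_norm φ, h1, ENNReal.ofReal_one, one_pow, mul_one]
        exact add_le_of_eq_optimum hE h3 h2)
    have hK : (3 / E) ^ (3 / 4 : ℝ) ≠ 0 := by positivity
    have hK' : (((3 / E) ^ (3 / 4 : ℝ) : ℝ) : ℂ) ≠ 0 := Complex.ofReal_ne_zero.2 hK
    have hc' : φ =ᵐ[haarR] fun x =>
        c / ((3 / E) ^ (3 / 4 : ℝ) : ℝ) * (oddOptimal E x : ℂ) := by
      filter_upwards [hc] with x hx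
      rw [hx, oddOptimal_eq_mul, Complex.ofReal_mul ((3 / E) ^ (3 / 4 : ℝ)), ← mul_assoc,
        div_mul_cancel₀ _ hK']
    exact ⟨_, norm_eq_one_of_smul hn h1 (smul_ae_eq h0 hc'), hc'⟩
  · rintro ⟨c, hc, h⟩
    have h1 : φ = c • φ₀ := smul_ae_eq h0 h
    refine ⟨?_, ?_⟩
    · filter_upwards [h, measurePreserving_neg_haarR.quasiMeasurePreserving.ae h] with x h1 h2
      rw [h1, h2, oddOptimal_neg, Complex.ofReal_neg, mul_neg]
    · rw [h1, momentumForm_smul hc, secondMoment_smul hc, norm_smul, hc, one_mul]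
      exact ⟨hn, hs.le, le_antisymm hm (optimum_le_momentumForm_of_isOdd hE ho hn hs.le)⟩

include hE in
theorem IsDensity.optimum_le_worstError {ρ : L2Pos →L[ℂ] L2Pos} (hρ : IsDensity ρ) {M : POVM L2Pos}
    (hM : IsCovariant M) (h : energy ρ ≤ ENNReal.ofReal E) :
    ENNReal.ofReal (9 / (4 * E)) ≤ worstError ρ M :=
  optimum_le hE (hρ.le_worstError_add_energy hM (by positivity)) h

include hE in
-- Equality in the averaged bound fixes only |φ|; the proportionality factor is nonnegative and both
-- norms are one, so it equals 1. The phase stays free because M is arbitrary.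
theorem IsDensity.exists_pureState_of_optimal {ρ : L2Pos →L[ℂ] L2Pos} (hρ : IsDensity ρ)
    {M : POVM L2Pos} (hM : IsCovariant M) (h : energy ρ ≤ ENNReal.ofReal E)
    (hopt : worstError ρ M = ENNReal.ofReal (9 / (4 * E))) :
    ∃ φ : L2Pos, ‖φ‖ = 1 ∧ ρ = pureState φ ∧
      ∀ᵐ x ∂haarR.restrict (Ici 0), ‖φ x‖ = optimalInput E x := by
  obtain ⟨φ₀, h0, hn, -, -⟩ := exists_optimalInput hE
  obtain ⟨φ, h1, h2, c, hc0, hc⟩ := hρ.exists_eq_pureState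
    (fun x hx => (mul_pos hx (Real.exp_pos _)).ne')
    (hρ.exists_norm_sqrt_eq hM (a := 3 / (2 * E)) (by positivity) (add_le_of_eq_optimum hE hopt h))
  refine ⟨φ, h1, h2, ?_⟩
  have hK : 0 < √2 * (3 / E) ^ (3 / 4 : ℝ) := by positivity
  have hc' : ∀ᵐ x ∂haarR.restrict (Ici 0),
      ‖φ x‖ = c / (√2 * (3 / E) ^ (3 / 4 : ℝ)) * optimalInput E x := by
    filter_upwards [hc] with x hx
    rw [hx, optimalInput_eq_mul, ← mul_assoc (c / _), div_mul_cancel₀ _ hK.ne']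
  have habs : absPos φ =ᵐ[haarR.restrict (Ici 0)] fun x =>
      ((c / (√2 * (3 / E) ^ (3 / 4 : ℝ)) : ℝ) : ℂ) * (optimalInput E x : ℂ) := by
    filter_upwards [absPos_coeFn φ, hc'] with x h3 h4
    rw [h3, h4, Complex.ofReal_mul]
  have hn' : ‖absPos φ‖ = 1 := by
    rw [← h1, ← toReal_enorm, enorm_absPos, toReal_enorm]
  have h5 := norm_eq_one_of_smul hn hn' (smul_ae_eq h0 habs)
  rw [Complex.norm_real, Real.norm_of_nonneg (by positivity)] at h5
  simp_rw [h5, one_mul] at hc'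
  exact hc'

end Optimal

end RealEstimation

end

/-! ### The main theorem -/

theorem mainTheorem4 (E : ℝ) (hE : 0 < E) :
    -- the five minima exist and are equal to `9 / (4E)`
    IsLeast (scheme1Errors E) (ENNReal.ofReal (9 / (4 * E))) ∧
    IsLeast (scheme2Errors E) (ENNReal.ofReal (9 / (4 * E))) ∧
    IsLeast (inputErrors E) (ENNReal.ofReal (9 / (4 * E))) ∧
    IsLeast (momentumValues E) (ENNReal.ofReal (9 / (4 * E))) ∧
    IsLeast (oddMomentumValues E) (ENNReal.ofReal (9 / (4 * E))) ∧
    -- the unique minimizers, up to a constant phase, of the last three problems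
    (∀ φ : L2Pos,
      (‖φ‖ = 1 ∧ secondMoment (extendByZero φ) ≤ ENNReal.ofReal E ∧
        secondMoment (invFourierPos φ) = ENNReal.ofReal (9 / (4 * E))) ↔
      ∃ c : ℂ, ‖c‖ = 1 ∧ φ =ᵐ[haarR.restrict (Ici 0)] fun x => c * (optimalInput E x : ℂ)) ∧
    (∀ φ : L2Pos,
      (‖φ‖ = 1 ∧ secondMoment (extendByZero φ) ≤ ENNReal.ofReal E ∧
        momentumForm (extendByZero φ) = ENNReal.ofReal (9 / (4 * E))) ↔
      ∃ c : ℂ, ‖c‖ = 1 ∧ φ =ᵐ[haarR.restrict (Ici 0)] fun x => c * (optimalInput E x : ℂ)) ∧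
    (∀ φ : L2R,
      (IsOdd φ ∧ ‖φ‖ = 1 ∧ secondMoment φ ≤ ENNReal.ofReal E ∧
        momentumForm φ = ENNReal.ofReal (9 / (4 * E))) ↔
      ∃ c : ℂ, ‖c‖ = 1 ∧ φ =ᵐ[haarR] fun x => c * (oddOptimal E x : ℂ)) ∧
    -- the optimal states for the standard covariant measurement, and for a free choice of it
    IsCovariant standardPOVM ∧
    (∀ ρ : L2Pos →L[ℂ] L2Pos,
      (IsDensity ρ ∧ energy ρ ≤ ENNReal.ofReal E ∧
        worstError ρ standardPOVM = ENNReal.ofReal (9 / (4 * E))) ↔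
      ∃ φ : L2Pos, φ =ᵐ[haarR.restrict (Ici 0)] (fun x => (optimalInput E x : ℂ)) ∧
        ρ = pureState φ) ∧
    (∀ ρ : L2Pos →L[ℂ] L2Pos,
      (IsDensity ρ ∧ energy ρ ≤ ENNReal.ofReal E ∧
        ∃ M : POVM L2Pos, IsCovariant M ∧ worstError ρ M = ENNReal.ofReal (9 / (4 * E))) ↔
      ∃ φ : L2Pos, (∀ᵐ x ∂(haarR.restrict (Ici 0)), ‖φ x‖ = optimalInput E x) ∧
        ρ = pureState φ) ∧
    -- the inverse Fourier transform of the odd minimizer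
    (∃ φ : L2R, φ =ᵐ[haarR] (fun x => (oddOptimal E x : ℂ)) ∧
      invFourier φ =ᵐ[haarR] fun g =>
        Complex.I * (((4 * E / 3) ^ (3 / 4 : ℝ) * g * Real.exp (-(g ^ 2 * E) / 3) : ℝ) : ℂ)) := by

  obtain ⟨φ₀, h0, hn, hs, hm⟩ := exists_optimalInput hE
  have hm0 : momentumForm (extendByZero φ₀) = ENNReal.ofReal (9 / (4 * E)) :=
    le_antisymm hm (optimum_le_momentumForm hE hn hs.le)
  have hw0 : worstError (pureState φ₀) standardPOVM = ENNReal.ofReal (9 / (4 * E)) := by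
    rw [worstError_standardPOVM hn, secondMoment_invFourierPos, hm0]
  have hen0 : energy (pureState φ₀) ≤ ENNReal.ofReal E := by rw [energy_pureState hn, hs]
  have heq : ∀ φ : L2Pos, φ =ᵐ[haarR.restrict (Ici 0)] (fun x => (optimalInput E x : ℂ)) →
      φ = φ₀ := fun φ hφ => Lp.ext (hφ.trans h0.symm)
  obtain ⟨φ₁, h0', ho', hn', hs', hm'⟩ := exists_oddOptimal hE
  refine ⟨⟨?_, ?_⟩, ⟨?_, ?_⟩, ⟨?_, ?_⟩, ⟨?_, ?_⟩, ⟨?_, ?_⟩, fun φ => ?_, isOptimal_iff hE,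
    isOptimal_isOdd_iff hE, isCovariant_standardPOVM, fun ρ => ?_, fun ρ => ?_,
    φ₁, h0', invFourier_oddOptimal hE h0'⟩
  · exact ⟨_, _, isDensity_pureState hn, isCovariant_standardPOVM, hen0, hw0.symm⟩
  · rintro d ⟨ρ, M, hρ, hM, h, rfl⟩
    exact hρ.optimum_le_worstError hE hM h
  -- The randomized scheme concentrated on index 0 reproduces the deterministic optimum.
  · refine ⟨fun i => if i = 0 then 1 else 0, fun _ => pureState φ₀, fun _ => standardPOVM, ?_,
      fun _ => isDensity_pureState hn, fun _ => isCovariant_standardPOVM, ?_, ?_⟩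
    · rw [tsum_ite_eq]
    · simpa [ite_mul, tsum_ite_eq] using hen0
    · simp [ite_mul, tsum_ite_eq, hw0]
  · rintro d ⟨p, ρ, M, hp, hρ, hM, h, rfl⟩
    -- The affine bound is averaged before the energy constraint is used, since the individual
    -- energies may exceed E.
    refine optimum_le hE ?_ h
    rw [← ENNReal.tsum_mul_left, ← ENNReal.tsum_add,
      ← one_mul (ENNReal.ofReal (3 * (3 / (2 * E)))), ← hp, ← ENNReal.tsum_mul_right]
    refine ENNReal.tsum_le_tsum fun i => ?_
    rw [mul_left_comm, ← mul_add]
    gcongr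
    exact (hρ i).le_worstError_add_energy (hM i) (by positivity)
  · exact ⟨φ₀, hn, hs.le, by rw [secondMoment_invFourierPos, hm0]⟩
  · rintro d ⟨φ, h1, h2, rfl⟩
    rw [secondMoment_invFourierPos]
    exact optimum_le_momentumForm hE h1 h2
  · exact ⟨φ₀, hn, hs.le, hm0.symm⟩
  · rintro d ⟨φ, h1, h2, rfl⟩
    exact optimum_le_momentumForm hE h1 h2
  · exact ⟨φ₁, ho', hn', hs'.le,
      (le_antisymm hm' (optimum_le_momentumForm_of_isOdd hE ho' hn' hs'.le)).symm⟩
  · rintro d ⟨φ, h1, h2, h3, rfl⟩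
    exact optimum_le_momentumForm_of_isOdd hE h1 h2 h3
  · rw [secondMoment_invFourierPos]
    exact isOptimal_iff hE φ
  · constructor
    · rintro ⟨hρ, h1, h2⟩
      obtain ⟨φ, hφ, rfl, -⟩ := hρ.exists_pureState_of_optimal hE isCovariant_standardPOVM h1 h2
      rw [energy_pureState hφ] at h1
      rw [worstError_standardPOVM hφ, secondMoment_invFourierPos] at h2
      -- For the standard measurement the error is the momentum form of φ itself, so φ is optimal up
      -- to a constant phase, which disappears in the projection.
      obtain ⟨c, hc, h⟩ := (isOptimal_iff hE φ).1 ⟨hφ, h1, h2⟩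
      exact ⟨φ₀, h0, by rw [smul_ae_eq h0 h, pureState_smul hc]⟩
    · rintro ⟨φ, hφ, rfl⟩
      rw [heq φ hφ]
      exact ⟨isDensity_pureState hn, hen0, hw0⟩
  · constructor
    · rintro ⟨hρ, h1, M, hM, h2⟩
      obtain ⟨φ, -, hρφ, hφ⟩ := hρ.exists_pureState_of_optimal hE hM h1 h2
      exact ⟨φ, hφ, hρφ⟩
    · rintro ⟨φ, hφ, rfl⟩
      have habs : absPos φ = φ₀ := heq _ (by
        filter_upwards [absPos_coeFn φ, hφ] with x h1 h2
        rw [h1, h2])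
      have hnφ : ‖φ‖ = 1 := by rw [← hn, ← habs, ← toReal_enorm, ← enorm_absPos, toReal_enorm]
      -- The phase of φ is moved into the measurement: the conjugated standard measurement has in φ
      -- the distribution that the standard one has in |φ|, the optimal input.
      obtain ⟨U, hU, hc, hUφ⟩ := exists_phase φ
      refine ⟨isDensity_pureState hnφ, ?_, standardPOVM.conj U hU,
        isCovariant_standardPOVM.conj hU hc, ?_⟩
      · rw [energy_pureState hnφ, ← secondMoment_absL2R, ← extendByZero_absPos, habs, hs]
      · rw [(isCovariant_standardPOVM.conj hU hc).worstError_pureState hnφ, POVM.dist_conj, hUφ,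
          habs, ← isCovariant_standardPOVM.worstError_pureState hn, hw0]
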